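/- Let $\omega=\sum_{i=1}^n\omega_i\delta_{x_i}$ and $v=\sum_{i=1}^n v_i\delta_{x_i}$ be discrete measures on $\mathbb R$ with $x_1<\dots<x_n$, $\omega_i\in\mathbb R$, $v_i\ge 0$ and $|\omega_i|+v_i>0$, and consider $$-f''+\tfrac14 f=z\,\omega f+z^2 v f\quad\text{on }\mathbb R$$ in the sense of distributions: $f$ is continuous, $-f''+\frac14 f=0$ off $\{x_1,\dots,x_n\}$, and $f'(x_i-)=f'(x_i+)+z\omega_i f(x_i)+z^2v_if(x_i)$ for every $i$. The eigenvalues are the $z\in\mathbb C$ for which there is a nontrivial bounded solution; they are real, nonzero and finite in number; denote them by $\lambda_1<\dots<\lambda_N$. Let $\phi_+(z,\cdot)$ be the solution equal to $e^{-x/2}$ for all $x$ near $+\infty$, and put $$\gamma_i^2=\int|\phi_+(\lambda_i,x)|^2\,d\omega(x)+2\lambda_i\int|\phi_+(\lambda_i,x)|^2\,dv(x),\qquad \varphi_i(x)=\frac{\phi_+(\lambda_i,x)}{\sqrt{\lambda_i\gamma_i^2}},$$ where $\lambda_i\gamma_i^2>0$. For $a\in\mathbb R$, the interior spectral data of $(\omega,v)$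 at $a$ is $\{\lambda_i,\varphi_i(a)\}_{i=1}^N$. **Theorem.** Fix $a\in\mathbb R$ and let $\{\lambda_i,\varphi_i(a)\}_{i=1}^N$ be the interior spectral data at $a$ of some $(\omega,v)$. Assume that $$\alpha:=1-\sum_{i=1}^N|\varphi_i(a)|^2\neq0$$ and that $\lambda_{j_0}<0<\lambda_{j_0+1}$ for some $j_0\in\{1,\dots,N-1\}$. Let $k$ be the number of indices $i$ with $\varphi_i(a)=0$. Let $\mathcal F\subset\mathbb R^{2N}$ be the set of the spectral data $(\lambda_1,\dots,\lambda_N,\lambda_1\tilde\gamma_1^2,\dots,\lambda_N\tilde\gamma_N^2)$ of all pairs $(\tilde\omega,\tilde v)$ of the above form whose interior spectral data at $a$ is the given one. If $k\ge1$, then infinitely many pairs $(\tilde\omega,\tilde v)$ have the given interior spectral data at $a$. Moreover: (i) if $\varphi_1(a)=0$ and $\varphi_N(a)=0$, then $\mathcal F$ is a connected smooth embedded submanifold of $\mathbb R^{2N}$ of dimension $k$; (ii) if exactly one of $\varphi_1(a),\varphi_N(a)$ is zero, then $\mathcal F$ is the union of 2 pairwise disjoint, connected, nonempty smooth embedded submanifolds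 of $\mathbb R^{2N}$ of dimension $k$, each of them open in $\mathcal F$; (iii) if $\varphi_1(a)\neq0$ and $\varphi_N(a)\ne0$, then $\mathcal F$ is the union of 4 pairwise disjoint, connected, nonempty smooth embedded submanifolds of $\mathbb R^{2N}$ of dimension $k$, each of them open in $\mathcal F$. -/

import Mathlib

open Filter Topology Set
open scoped ContDiff

/-- A pair `(ω, v)` of finitely supported discrete measures on `ℝ`,
`ω = ∑ ω_i δ_{x_i}` (real weights) and `v = ∑ v_i δ_{x_i}` (nonnegative weights).
`w x` and `v x` are the masses of the point `x`. The points `x_1 < ⋯ < x_n` are the elements of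
`supp w ∪ supp v`, so that `|ω_i| + v_i > 0` at each of them, and a pair of measures corresponds to
exactly one term of this structure. -/
structure PeakonPair where
  w : ℝ →₀ ℝ
  v : ℝ →₀ ℝ
  v_nonneg : ∀ x, 0 ≤ v x

namespace PeakonPair

/-- The set `{x_1, …, x_n}`. -/
def nodes (c : PeakonPair) : Set ℝ := {x | c.w x ≠ 0 ∨ c.v x ≠ 0}

/-- `f` solves `-f'' + f / 4 = z ω f + z² v f` on `ℝ` in the sense of distributions:
`f` is continuous, `-f'' + f / 4 = 0` away from the nodes, and at each node `x`
`f'(x-) = f'(x+) + z ω({x}) f(x) + z² v({x}) f(x)`. -/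
structure IsSolution {𝕜 : Type} [RCLike 𝕜] (c : PeakonPair) (z : 𝕜) (f : ℝ → 𝕜) : Prop where
  continuous : Continuous f
  differentiableAt : ∀ x, x ∉ c.nodes → DifferentiableAt ℝ f x
  ode : ∀ x, x ∉ c.nodes → HasDerivAt (deriv f) (f x / 4) x
  jump : ∀ x ∈ c.nodes, ∃ L R : 𝕜,
    Tendsto (deriv f) (𝓝[<] x) (𝓝 L) ∧ Tendsto (deriv f) (𝓝[>] x) (𝓝 R) ∧
      L = R + z * (c.w x : 𝕜) * f x + z ^ 2 * (c.v x : 𝕜) * f x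

/-- `z ∈ ℂ` is an eigenvalue: there is a nontrivial bounded solution. -/
def IsEigenvalue (c : PeakonPair) (z : ℂ) : Prop :=
  ∃ f : ℝ → ℂ, c.IsSolution z f ∧ f ≠ 0 ∧ ∃ C : ℝ, ∀ x, ‖f x‖ ≤ C

/-- `λ_1 < ⋯ < λ_N` is the increasing enumeration of the spectrum `σ(H)`, the set of all complex
eigenvalues. -/
structure IsSpectrum (c : PeakonPair) {N : ℕ} (lam : Fin N → ℝ) : Prop where
  strictMono : StrictMono lam
  eigenvalue_iff : ∀ z : ℂ, c.IsEigenvalue z ↔ ∃ i, z = (lam i : ℂ)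

/-- `f` is the solution `φ_+(z, ·)`, that is, the solution equal to `e^{-x/2}` for all `x` near
`+∞`, for real `z`. -/
structure IsPhiPlus (c : PeakonPair) (z : ℝ) (f : ℝ → ℝ) : Prop where
  isSolution : c.IsSolution z f
  eq_exp : ∀ᶠ x in atTop, f x = Real.exp (-x / 2)

/-- `γ² = ∫ |f|² dω + 2 z ∫ |f|² dv`, used for `f = φ_+(z, ·)`. -/
def gammaSq (c : PeakonPair) (z : ℝ) (f : ℝ → ℝ) : ℝ :=
  (c.w.sum fun x m => |f x| ^ 2 * m) + 2 * z * (c.v.sum fun x m => |f x| ^ 2 * m)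

/-- `g` is the normalized eigenfunction `φ_+(z, ·) / √(z γ_z²)` (for an eigenvalue `z`). -/
def IsNormalizedEigenfunction (c : PeakonPair) (z : ℝ) (g : ℝ → ℝ) : Prop :=
  ∃ f : ℝ → ℝ, c.IsPhiPlus z f ∧ ∀ x, g x = f x / Real.sqrt (z * c.gammaSq z f)

/-- `{λ_i, φ_i(a)}_{i=1}^N` is the interior spectral data of `(ω, v)` at the point `a`: the `λ_i`
enumerate the spectrum increasingly and `p i` is the value at `a` of the `i`-th normalized
eigenfunction. -/
structure IsInteriorData (c : PeakonPair) (a : ℝ) {N : ℕ} (lam p : Fin N → ℝ) : Prop where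
  isSpectrum : c.IsSpectrum lam
  value : ∀ i, ∃ g : ℝ → ℝ, c.IsNormalizedEigenfunction (lam i) g ∧ p i = g a

/-- `{λ_i, λ_i γ_{λ_i}²}_{i=1}^N` is the spectral data of `(ω, v)`: the `λ_i` enumerate the
spectrum increasingly and `τ i` is the (modified) norming constant of `λ_i`. -/
structure IsSpectralData (c : PeakonPair) {N : ℕ} (lam τ : Fin N → ℝ) : Prop where
  isSpectrum : c.IsSpectrum lam
  norming : ∀ i, ∃ f : ℝ → ℝ, c.IsPhiPlus (lam i) f ∧ τ i = lam i * c.gammaSq (lam i) f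

end PeakonPair

/-- The set `ℱ ⊆ ℝ^N × ℝ^N = ℝ^{2N}` of the spectral data
`(λ_1, …, λ_N, λ_1 γ_1², …, λ_N γ_N²)` of all `(ω, v)` whose interior spectral data at `a` is the
given one. -/
def inverseSpectralFamily (a : ℝ) {N : ℕ} (lam p : Fin N → ℝ) :
    Set ((Fin N → ℝ) × (Fin N → ℝ)) :=
  {q | ∃ c : PeakonPair, c.IsInteriorData a lam p ∧ c.IsSpectralData q.1 q.2}

/-- `M` is a smooth embedded submanifold of dimension `k` of the finite-dimensional space `E`:
around each point of `M` there is a smooth diffeomorphism between open subsets of `E` that maps `M`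
onto a `k`-dimensional linear subspace. -/
def IsEmbeddedSubmanifold {E : Type} [NormedAddCommGroup E] [NormedSpace ℝ E]
    [FiniteDimensional ℝ E] (k : ℕ) (M : Set E) : Prop :=
  ∀ p ∈ M, ∃ (Φ : OpenPartialHomeomorph E E) (V : Submodule ℝ E),
    p ∈ Φ.source ∧ ContDiffOn ℝ ∞ Φ Φ.source ∧ ContDiffOn ℝ ∞ Φ.symm Φ.target ∧
      Module.finrank ℝ V = k ∧ Φ '' (Φ.source ∩ M) = Φ.target ∩ (V : Set E)

/-- `F` is the union of `m` pairwise disjoint, connected (in particular nonempty) embedded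
submanifolds of dimension `k`, each of them open in `F`; thus `F` has exactly `m` connected
components. -/
def IsDisjointUnionOfManifolds {E : Type} [NormedAddCommGroup E] [NormedSpace ℝ E]
    [FiniteDimensional ℝ E] (m k : ℕ) (F : Set E) : Prop :=
  ∃ M : Fin m → Set E, F = ⋃ i, M i ∧ (Pairwise fun i j => Disjoint (M i) (M j)) ∧
    ∀ i, IsConnected (M i) ∧ IsEmbeddedSubmanifold k (M i) ∧ ∃ U, IsOpen U ∧ M i = F ∩ U

/-! After multiplication by `e^{x/2}` a solution is piecewise linear in `e^x`. Its value for `φ_+(z,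
·)` at `a` is a polynomial `P(z)` (`rightPoly`), and reflection gives a polynomial `Q(z)` for the
solution `φ_-` decaying at `-∞`. The eigenvalues are the zeros of the Wronskian polynomial `W`, and
`P`, `Q`, `W` all equal `1` at `z = 0`. If `φ_- = K φ_+` at an eigenvalue `λ`, then `-λ W'(λ) = K τ`
with `τ = λ γ²`, so `G = P Q / W` has the expansion `α + ∑ φ_i(a)² / (1 - z / λ_i)`
(`green_identity`). The interior data therefore fix `W`, the product `P Q`, and the sign of `P(λ_i)`
wherever `φ_i(a) ≠ 0`. What remains free is how `P Q` is factored and how residues are shared.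

Comparing leading coefficients gives `α ≥ 0`, hence `α > 0`, and `z G` is a Nevanlinna function
growing linearly. Its zeros are `0` and a set `B`, they are separated by the actual poles, and `1 /
G = 1 + z ∑ σ_b / (z - b)` with `σ_b > 0` (`exists_greenZeros`). A cancelled pole (`φ_i(a) = 0`) is
a common zero of `P` and `Q` and lies in `B`. So `P` has a root set `S` with `nullSet ⊆ S ⊆ B`, and
`Q` has the roots `nullSet ∪ B \ S`.

By `wronskian_eq`, `1 / G - 1` is the sum of two half-line functions whose poles are the roots of
`P` and of `Q`. Conversely, a continued fraction realizes any positive residues on a half-line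
(`exists_pair_half_line`). Hence every way of splitting `σ_b` into two positive parts at each
cancelled pole occurs; equivalently, the norming constants there take arbitrary positive values
(`exists_pair_of_tau`). This is the factor `(0, ∞)^k`.

The signs of `P` at the actual poles decide which zeros lying between two poles belong to `S`. Only
the lowest and the highest element of `B` lie outside; since poles occur on both sides of `0` and
`P(0) = 1`, they do not affect these signs. Each of them is free unless it is itself cancelled, that
is, unless `φ_1(a) = 0`, respectively `φ_N(a) = 0` (`card_freeSet`). Each of the resulting 1, 2 or 4
sets `S` prescribes `τ_i = e^{-a} P(λ_i)² / φ_i(a)²` at the other indices, and different sets give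
different values (`exists_norming_ne`). The family is thus a disjoint union of open orthants in
parallel affine subspaces of dimension `k`. -/

/-! ### Discrete Volterra equations in the variable `e^x`. -/

section Volterra

variable {R : Type*} [CommRing R] [Algebra ℝ R]

theorem card_filter_lt_lt (T : Finset ℝ) {x t : ℝ} (ht : t ∈ T) (hx : x < t) :
    (T.filter (t < ·)).card < (T.filter (x < ·)).card := by
  apply Finset.card_lt_card
  refine ⟨fun r hr => ?_, fun h => ?_⟩
  · simp only [Finset.mem_filter] at hr ⊢
    exact ⟨hr.1, hx.trans hr.2⟩
  · have := h (Finset.mem_filter.2 ⟨ht, hx⟩)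
    simp at this

/-- The value at `x` involves only points of `T` to the right of `x`, so the iteration is stationary
at `x` after as many steps as there are such points. The ring `R` is general because the equation is
used both for numbers and for polynomials in the spectral parameter. -/
theorem volterra_exists (T : Finset ℝ) (k g : ℝ → R) :
    ∃ h : ℝ → R, ∀ x, h x = g x +
      ∑ t ∈ T with x < t, (Real.exp x - Real.exp t) • (k t * h t) := by
  set Op : (ℝ → R) → ℝ → R := fun h x => g x +
      ∑ t ∈ T with x < t, (Real.exp x - Real.exp t) • (k t * h t) with hOp
  have key : ∀ h x, Op h x = g x +
      ∑ t ∈ T with x < t, (Real.exp x - Real.exp t) • (k t * h t) := fun _ _ => rfl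
  have claim : ∀ n x, (T.filter (x < ·)).card ≤ n → Op^[n + 1] g x = Op^[n] g x := by
    intro n
    induction n with
    | zero =>
      intro x hx
      have : T.filter (x < ·) = ∅ := by simpa using hx
      simp [hOp, this]
    | succ n ih =>
      intro x hx
      rw [Function.iterate_succ_apply', Function.iterate_succ_apply' Op n]
      rw [key, key]
      congr 1
      refine Finset.sum_congr rfl fun t ht => ?_
      rw [Finset.mem_filter] at ht
      have := card_filter_lt_lt T ht.1 ht.2
      rw [← ih t (by omega), Function.iterate_succ_apply']
  refine ⟨Op^[T.card] g, fun x => ?_⟩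
  conv_lhs => rw [← claim _ x (Finset.card_filter_le _ _)]
  rw [Function.iterate_succ_apply']

theorem volterra_unique {T : Finset ℝ} {k g h h' : ℝ → R}
    (hh : ∀ x, h x = g x + ∑ t ∈ T with x < t, (Real.exp x - Real.exp t) • (k t * h t))
    (hh' : ∀ x, h' x = g x + ∑ t ∈ T with x < t, (Real.exp x - Real.exp t) • (k t * h' t)) :
    h = h' := by
  have : ∀ n x, (T.filter (x < ·)).card < n → h x = h' x := by
    intro n
    induction n with
    | zero => intro x hx; omega
    | succ n ih =>
      intro x hx
      rw [hh x, hh' x]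
      congr 1
      refine Finset.sum_congr rfl fun t ht => ?_
      rw [Finset.mem_filter] at ht
      have := card_filter_lt_lt T ht.1 ht.2
      rw [ih t (by omega)]
  exact funext fun x => this _ x (Nat.lt_succ_self _)

/-- Green's identity for a right and a left solution with different coefficients. -/
theorem volterra_green {T : Finset ℝ} {k k' h g : ℝ → R}
    (hh : ∀ x, h x = 1 + ∑ t ∈ T with x < t, (Real.exp x - Real.exp t) • (k t * h t))
    (hg : ∀ x, g x = algebraMap ℝ R (Real.exp x) -
      ∑ t ∈ T with t < x, (Real.exp x - Real.exp t) • (k' t * g t)) :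
    ∑ t ∈ T, (k t - k' t) * (h t * g t) =
      ∑ t ∈ T, Real.exp t • (k t * h t) - ∑ t ∈ T, k' t * g t := by
  -- Here `g t` is expanded, in `e2` it is `h t`. The two double sums agree after interchanging the
  -- summations, so they cancel in the difference.
  have e1 : ∑ t ∈ T, k t * (h t * g t) = ∑ t ∈ T, Real.exp t • (k t * h t) -
      ∑ t ∈ T, ∑ r ∈ T, if r < t then
        (Real.exp t - Real.exp r) • ((k' r * g r) * (k t * h t)) else 0 := by
    rw [← Finset.sum_sub_distrib]
    refine Finset.sum_congr rfl fun t _ => ?_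
    rw [← Finset.sum_filter, hg t, mul_sub, mul_sub, Finset.mul_sum, Finset.mul_sum]
    congr 1
    · rw [Algebra.smul_def]; ring
    · refine Finset.sum_congr rfl fun r _ => ?_
      simp only [Algebra.smul_def]; ring
  have e2 : ∑ t ∈ T, k' t * (h t * g t) = ∑ t ∈ T, k' t * g t -
      ∑ t ∈ T, ∑ r ∈ T, if t < r then
        (Real.exp r - Real.exp t) • ((k' t * g t) * (k r * h r)) else 0 := by
    rw [← Finset.sum_sub_distrib]
    refine Finset.sum_congr rfl fun t _ => ?_
    rw [← Finset.sum_filter, hh t, add_mul, mul_add, Finset.sum_mul, Finset.mul_sum, sub_eq_add_neg,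
      ← Finset.sum_neg_distrib]
    congr 1
    · ring
    · refine Finset.sum_congr rfl fun r _ => ?_
      simp only [Algebra.smul_def, map_sub]; ring
  simp only [sub_mul, Finset.sum_sub_distrib]
  rw [e1, e2, Finset.sum_comm]
  ring

/-- The Wronskian at `a` of a right and a left solution with the same coefficients. -/
theorem volterra_wronskian {T : Finset ℝ} {k h g : ℝ → R} (a : ℝ)
    (hh : ∀ x, h x = 1 + ∑ t ∈ T with x < t, (Real.exp x - Real.exp t) • (k t * h t))
    (hg : ∀ x, g x = algebraMap ℝ R (Real.exp x) -
      ∑ t ∈ T with t < x, (Real.exp x - Real.exp t) • (k t * g t)) :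
    1 - ∑ t ∈ T, Real.exp t • (k t * h t) =
      h a * (1 - ∑ t ∈ T with t ≤ a, k t * g t) - (∑ t ∈ T with a < t, k t * h t) * g a := by
  -- The right solution is restarted at `a`: the points beyond `a` enter only through its value and
  -- its slope there.
  have h2 : ∀ t ≤ a, h t = h a + (Real.exp t - Real.exp a) • (∑ r ∈ T with a < r, k r * h r) +
      ∑ r ∈ T.filter (· ≤ a) with t < r, (Real.exp t - Real.exp r) • (k r * h r) := by
    intro t ht
    rw [hh t, hh a, add_assoc, add_assoc]
    congr 1
    simp only [Finset.sum_filter, Finset.smul_sum, ← Finset.sum_add_distrib]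
    refine Finset.sum_congr rfl fun r _ => ?_
    by_cases h1 : a < r
    · simp only [h1, ht.trans_lt h1, not_le.2 h1, if_true, if_false, Algebra.smul_def, map_sub]
      ring
    · simp [h1, not_lt.1 h1]
  have e0 : ∑ t ∈ T, Real.exp t • (k t * h t) =
      ∑ t ∈ T with t ≤ a, Real.exp t • (k t * h t) + (1 - h a) +
        Real.exp a • ∑ t ∈ T with a < t, k t * h t := by
    rw [hh a]
    simp only [Finset.sum_filter, Finset.smul_sum]
    rw [sub_add_cancel_left, ← sub_eq_zero, ← Finset.sum_neg_distrib, ← Finset.sum_add_distrib,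
      ← Finset.sum_add_distrib, ← Finset.sum_sub_distrib]
    refine Finset.sum_eq_zero fun r _ => ?_
    by_cases h1 : a < r
    · simp only [h1, not_le.2 h1, if_true, if_false, Algebra.smul_def, map_sub]
      ring
    · simp [h1, not_lt.1 h1]
  have hga : g a = algebraMap ℝ R (Real.exp a) -
      ∑ t ∈ T with t ≤ a, (Real.exp a - Real.exp t) • (k t * g t) := by
    rw [hg a]
    congr 1
    simp only [Finset.sum_filter]
    refine Finset.sum_congr rfl fun r _ => ?_
    rcases lt_trichotomy r a with h | h | h
    · simp [h, h.le]
    · simp [h]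
    · simp [h.not_gt, h.not_ge]
  set T' := T.filter (· ≤ a)
  set Q := ∑ t ∈ T with a < t, k t * h t
  have e1 : ∑ t ∈ T', k t * (h t * g t) = ∑ t ∈ T', Real.exp t • (k t * h t) -
      ∑ t ∈ T', ∑ r ∈ T', if r < t then
        (Real.exp t - Real.exp r) • ((k r * g r) * (k t * h t)) else 0 := by
    rw [← Finset.sum_sub_distrib]
    refine Finset.sum_congr rfl fun t ht => ?_
    have hta : t ≤ a := (Finset.mem_filter.1 ht).2
    have : T.filter (· < t) = T'.filter (· < t) := by
      ext r; simp only [Finset.mem_filter, T']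
      exact ⟨fun h => ⟨⟨h.1, h.2.le.trans hta⟩, h.2⟩, fun h => ⟨h.1.1, h.2⟩⟩
    rw [← Finset.sum_filter, hg t, mul_sub, mul_sub, Finset.mul_sum, Finset.mul_sum, this]
    congr 1
    · rw [Algebra.smul_def]; ring
    · refine Finset.sum_congr rfl fun r _ => ?_
      simp only [Algebra.smul_def]; ring
  have e2 : ∑ t ∈ T', k t * (h t * g t) = h a * ∑ t ∈ T', k t * g t -
      Q * (∑ t ∈ T', (Real.exp a - Real.exp t) • (k t * g t)) -
      ∑ t ∈ T', ∑ r ∈ T', if t < r then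
        (Real.exp r - Real.exp t) • ((k t * g t) * (k r * h r)) else 0 := by
    rw [Finset.mul_sum, Finset.mul_sum, ← Finset.sum_sub_distrib, ← Finset.sum_sub_distrib]
    refine Finset.sum_congr rfl fun t ht => ?_
    have hta : t ≤ a := (Finset.mem_filter.1 ht).2
    have hs : k t * ((∑ r ∈ T' with t < r, (Real.exp t - Real.exp r) • (k r * h r)) * g t) =
        - ∑ r ∈ T' with t < r, (Real.exp r - Real.exp t) • (k t * g t * (k r * h r)) := by
      rw [Finset.sum_mul, Finset.mul_sum, ← Finset.sum_neg_distrib]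
      refine Finset.sum_congr rfl fun r _ => ?_
      simp only [Algebra.smul_def, map_sub]; ring
    rw [← Finset.sum_filter, h2 t hta, add_mul, mul_add, hs]
    simp only [Algebra.smul_def, map_sub]; ring
  rw [e1, Finset.sum_comm] at e2
  have e3 := sub_eq_iff_eq_add.1 e2
  rw [e0, e3, hga, Algebra.smul_def (Real.exp a) Q]
  ring

/-- A left solution is also given by data at `+∞`. -/
theorem volterra_left_to_right {T : Finset ℝ} {k g : ℝ → R}
    (hg : ∀ x, g x = algebraMap ℝ R (Real.exp x) -
      ∑ t ∈ T with t < x, (Real.exp x - Real.exp t) • (k t * g t)) (x : ℝ) :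
    g x = (Real.exp x • (1 - ∑ t ∈ T, k t * g t) + ∑ t ∈ T, Real.exp t • (k t * g t)) +
      ∑ t ∈ T with x < t, (Real.exp x - Real.exp t) • (k t * g t) := by
  have e : ∑ t ∈ T, Real.exp x • (k t * g t) = ∑ t ∈ T, Real.exp t • (k t * g t) +
      ∑ t ∈ T with x < t, (Real.exp x - Real.exp t) • (k t * g t) +
      ∑ t ∈ T with t < x, (Real.exp x - Real.exp t) • (k t * g t) := by
    simp only [Finset.sum_filter, ← Finset.sum_add_distrib]
    refine Finset.sum_congr rfl fun r _ => ?_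
    rcases lt_trichotomy r x with h | h | h
    · simp [h, h.not_gt, sub_smul]
    · simp [h]
    · simp [h, h.not_gt, sub_smul]
  rw [hg x, smul_sub, Finset.smul_sum, e, ← Algebra.algebraMap_eq_smul_one]
  ring

end Volterra

/-! ### Piecewise solutions of `f'' = f / 4`. -/

section PiecewiseExponential

variable {𝕜 : Type} [RCLike 𝕜]

theorem eventually_filter_lt_right (T : Finset ℝ) (x₀ : ℝ) :
    ∀ᶠ x in 𝓝[>] x₀, T.filter (x < ·) = T.filter (x₀ < ·) := by
  have h : ∀ᶠ x in 𝓝[>] x₀, ∀ t ∈ T, x₀ < t → x < t := by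
    rw [Finset.eventually_all]
    intro t _
    by_cases h : x₀ < t
    · exact (eventually_nhdsWithin_of_eventually_nhds (eventually_lt_nhds h)).mono fun x hx _ => hx
    · exact Eventually.of_forall fun x h' => absurd h' h
  filter_upwards [h, self_mem_nhdsWithin] with x hx hx'
  refine Finset.filter_congr fun t ht => ⟨fun h => lt_trans hx' h, hx t ht⟩

theorem eventually_filter_lt_left (T : Finset ℝ) (x₀ : ℝ) :
    ∀ᶠ x in 𝓝[<] x₀, T.filter (x < ·) = T.filter (x₀ ≤ ·) := by
  have h : ∀ᶠ x in 𝓝[<] x₀, ∀ t ∈ T, t < x₀ → t < x := by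
    rw [Finset.eventually_all]
    intro t _
    by_cases h : t < x₀
    · exact (eventually_nhdsWithin_of_eventually_nhds (eventually_gt_nhds h)).mono fun x hx _ => hx
    · exact Eventually.of_forall fun x h' => absurd h' h
  filter_upwards [h, self_mem_nhdsWithin] with x hx hx'
  refine Finset.filter_congr fun t ht => ⟨fun h => ?_, fun h => lt_of_lt_of_le hx' h⟩
  by_contra h'
  exact absurd (hx t ht (not_le.1 h')) h.not_gt

theorem filter_le_eq_filter_lt {T : Finset ℝ} {x : ℝ} (hx : x ∉ T) :
    T.filter (x ≤ ·) = T.filter (x < ·) :=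
  Finset.filter_congr fun _ ht => ⟨fun h => h.lt_of_ne fun e => hx (e ▸ ht), le_of_lt⟩

theorem filter_le_eq_insert {T : Finset ℝ} {x : ℝ} (hx : x ∈ T) :
    T.filter (x ≤ ·) = insert x (T.filter (x < ·)) := by
  ext t
  simp only [Finset.mem_filter, Finset.mem_insert, le_iff_eq_or_lt]
  constructor
  · rintro ⟨h, rfl | h'⟩
    · exact Or.inl rfl
    · exact Or.inr ⟨h, h'⟩
  · rintro (rfl | h)
    · exact ⟨hx, Or.inl rfl⟩
    · exact ⟨h.1, Or.inr h.2⟩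

theorem eventually_filter_lt {T : Finset ℝ} {x₀ : ℝ} (hx : x₀ ∉ T) :
    ∀ᶠ x in 𝓝 x₀, T.filter (x < ·) = T.filter (x₀ < ·) := by
  rw [← pure_sup_nhdsNE, ← Iio_union_Ioi, nhdsWithin_union]
  have h := eventually_filter_lt_left T x₀
  rw [filter_le_eq_filter_lt hx] at h
  exact eventually_sup.2 ⟨by simp, eventually_sup.2 ⟨h, eventually_filter_lt_right T x₀⟩⟩

/-- The general solution of `f'' = f / 4`. -/
noncomputable def expSol (A B : 𝕜) (x : ℝ) : 𝕜 := Real.exp (x / 2) • A + Real.exp (-x / 2) • B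

theorem hasDerivAt_expSol (A B : 𝕜) (x : ℝ) :
    HasDerivAt (expSol A B) (expSol (A / 2) (-B / 2) x) x := by
  have h1 : HasDerivAt (fun x : ℝ => Real.exp (x / 2)) (Real.exp (x / 2) * (1 / 2)) x :=
    ((hasDerivAt_id x).div_const 2).exp
  have h2 : HasDerivAt (fun x : ℝ => Real.exp (-x / 2)) (Real.exp (-x / 2) * (-1 / 2)) x :=
    ((hasDerivAt_id x).neg.div_const 2).exp
  refine HasDerivAt.congr_deriv (f := expSol A B) ((h1.smul_const A).add (h2.smul_const B)) ?_
  simp only [expSol, RCLike.real_smul_eq_coe_mul]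
  push_cast
  ring

theorem deriv_expSol (A B : 𝕜) : deriv (expSol A B) = expSol (A / 2) (-B / 2) :=
  funext fun x => (hasDerivAt_expSol A B x).deriv

theorem continuous_expSol (A B : 𝕜) : Continuous (expSol A B) :=
  continuous_iff_continuousAt.2 fun x => (hasDerivAt_expSol A B x).continuousAt

theorem eventually_deriv_eq_of_right {f g : ℝ → 𝕜} {x₀ : ℝ} (h : f =ᶠ[𝓝[>] x₀] g) :
    deriv f =ᶠ[𝓝[>] x₀] deriv g := by
  filter_upwards [eventually_eventually_nhdsWithin.2 h, self_mem_nhdsWithin] with y hy hy'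
  rw [IsOpen.nhdsWithin_eq isOpen_Ioi hy'] at hy
  exact EventuallyEq.deriv_eq hy

theorem eventually_deriv_eq_of_left {f g : ℝ → 𝕜} {x₀ : ℝ} (h : f =ᶠ[𝓝[<] x₀] g) :
    deriv f =ᶠ[𝓝[<] x₀] deriv g := by
  filter_upwards [eventually_eventually_nhdsWithin.2 h, self_mem_nhdsWithin] with y hy hy'
  rw [IsOpen.nhdsWithin_eq isOpen_Iio hy'] at hy
  exact EventuallyEq.deriv_eq hy

/-- A piecewise solution of `f'' = f / 4` with jumps of the derivative at the points of `T`. -/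
noncomputable def pieceSol (T : Finset ℝ) (A B : 𝕜) (Y : ℝ → 𝕜) (x : ℝ) : 𝕜 :=
  expSol (A + ∑ t ∈ T with x < t, Y t) (B - ∑ t ∈ T with x < t, Real.exp t • Y t) x

variable {T : Finset ℝ} {A B : 𝕜} {Y : ℝ → 𝕜}

theorem pieceSol_eventuallyEq_right (x₀ : ℝ) : pieceSol T A B Y =ᶠ[𝓝[>] x₀]
    expSol (A + ∑ t ∈ T with x₀ < t, Y t) (B - ∑ t ∈ T with x₀ < t, Real.exp t • Y t) := by
  filter_upwards [eventually_filter_lt_right T x₀] with x hx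
  rw [pieceSol, hx]

theorem pieceSol_eventuallyEq_left (x₀ : ℝ) : pieceSol T A B Y =ᶠ[𝓝[<] x₀]
    expSol (A + ∑ t ∈ T with x₀ ≤ t, Y t) (B - ∑ t ∈ T with x₀ ≤ t, Real.exp t • Y t) := by
  filter_upwards [eventually_filter_lt_left T x₀] with x hx
  rw [pieceSol, hx]

theorem exp_half_mul_self (x : ℝ) : Real.exp (-x / 2) * Real.exp x = Real.exp (x / 2) := by
  rw [← Real.exp_add]; ring_nf

/-- The term of the point `x₀` itself contributes `(e^{x₀/2} - e^{-x₀/2} e^{x₀}) Y = 0` to the value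
at `x₀`; this is why `pieceSol` is continuous although its coefficients jump. -/
theorem pieceSol_eq_left (x₀ : ℝ) : pieceSol T A B Y x₀ =
    expSol (A + ∑ t ∈ T with x₀ ≤ t, Y t) (B - ∑ t ∈ T with x₀ ≤ t, Real.exp t • Y t) x₀ := by
  by_cases hx : x₀ ∈ T
  · rw [filter_le_eq_insert hx, Finset.sum_insert (by simp), Finset.sum_insert (by simp), pieceSol]
    have := congrArg (fun r : ℝ => (r : 𝕜)) (exp_half_mul_self x₀)
    simp only [expSol, RCLike.real_smul_eq_coe_mul]
    push_cast at this
    linear_combination (Y x₀) * this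
  · rw [filter_le_eq_filter_lt hx, pieceSol]

theorem pieceSol_eventuallyEq {x₀ : ℝ} (hx : x₀ ∉ T) : pieceSol T A B Y =ᶠ[𝓝 x₀]
    expSol (A + ∑ t ∈ T with x₀ < t, Y t) (B - ∑ t ∈ T with x₀ < t, Real.exp t • Y t) := by
  have h1 := pieceSol_eventuallyEq_left (T := T) (A := A) (B := B) (Y := Y) x₀
  have h2 := pieceSol_eventuallyEq_right (T := T) (A := A) (B := B) (Y := Y) x₀
  rw [filter_le_eq_filter_lt hx] at h1
  have h3 : ∀ᶠ x in 𝓝[≠] x₀, pieceSol T A B Y x =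
    expSol (A + ∑ t ∈ T with x₀ < t, Y t) (B - ∑ t ∈ T with x₀ < t, Real.exp t • Y t) x := by
    rw [← Iio_union_Ioi, nhdsWithin_union]
    exact eventually_sup.2 ⟨h1, h2⟩
  rw [← pure_sup_nhdsNE]
  exact eventually_sup.2 ⟨by simp [pieceSol], h3⟩

theorem continuous_pieceSol : Continuous (pieceSol T A B Y) := by
  refine continuous_iff_continuousAt.2 fun x₀ => continuousAt_iff_continuous_left'_right'.2 ⟨?_, ?_⟩
  · rw [ContinuousWithinAt, pieceSol_eq_left]
    exact ((continuous_expSol _ _).continuousWithinAt (s := Iio x₀)).tendsto.congr'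
      (pieceSol_eventuallyEq_left x₀).symm
  · rw [ContinuousWithinAt, pieceSol]
    exact ((continuous_expSol _ _).continuousWithinAt (s := Ioi x₀)).tendsto.congr'
      (pieceSol_eventuallyEq_right x₀).symm

theorem deriv_pieceSol_left (x₀ : ℝ) : Tendsto (deriv (pieceSol T A B Y)) (𝓝[<] x₀)
    (𝓝 (expSol ((A + ∑ t ∈ T with x₀ ≤ t, Y t) / 2)
      (-(B - ∑ t ∈ T with x₀ ≤ t, Real.exp t • Y t) / 2) x₀)) := by
  have h := eventually_deriv_eq_of_left
    (pieceSol_eventuallyEq_left (T := T) (A := A) (B := B) (Y := Y) x₀)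
  rw [deriv_expSol] at h
  exact ((continuous_expSol _ _).continuousWithinAt (s := Iio x₀)).tendsto.congr' h.symm

theorem deriv_pieceSol_right (x₀ : ℝ) : Tendsto (deriv (pieceSol T A B Y)) (𝓝[>] x₀)
    (𝓝 (expSol ((A + ∑ t ∈ T with x₀ < t, Y t) / 2)
      (-(B - ∑ t ∈ T with x₀ < t, Real.exp t • Y t) / 2) x₀)) := by
  have h := eventually_deriv_eq_of_right
    (pieceSol_eventuallyEq_right (T := T) (A := A) (B := B) (Y := Y) x₀)
  rw [deriv_expSol] at h
  exact ((continuous_expSol _ _).continuousWithinAt (s := Ioi x₀)).tendsto.congr' h.symm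

/-- Filling in the common one-sided limits on `T` gives a continuous function with derivative zero
off a countable set, to which the fundamental theorem of calculus with exceptional points applies.
-/
theorem constant_off_finset {g : ℝ → 𝕜} (hd : ∀ x ∉ T, HasDerivAt g 0 x)
    (hl : ∀ t ∈ T, ∃ L, Tendsto g (𝓝[<] t) (𝓝 L) ∧ Tendsto g (𝓝[>] t) (𝓝 L)) :
    ∃ C, ∀ x ∉ T, g x = C := by
  classical
  choose! L hL using hl
  set G : ℝ → 𝕜 := fun x => if x ∈ T then L x else g x with hG
  have hne : ∀ x₀, ∀ᶠ x in 𝓝[≠] x₀, x ∉ T := by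
    intro x₀
    have : ((T : Set ℝ) \ {x₀})ᶜ ∈ 𝓝 x₀ :=
      (T.finite_toSet.subset sdiff_subset).isClosed.isOpen_compl.mem_nhds (by simp)
    filter_upwards [nhdsWithin_le_nhds this, self_mem_nhdsWithin] with x hx hx' hxT
    exact hx ⟨hxT, hx'⟩
  have hGg : ∀ x₀, G =ᶠ[𝓝[≠] x₀] g := fun x₀ => (hne x₀).mono fun x hx => by simp [hG, hx]
  have hc : Continuous G := by
    refine continuous_iff_continuousAt.2 fun x₀ => continuousAt_iff_punctured_nhds.2 ?_
    refine Tendsto.congr' (hGg x₀).symm ?_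
    by_cases hx : x₀ ∈ T
    · simp only [hG, hx, if_true]
      rw [← Iio_union_Ioi, nhdsWithin_union]
      exact (hL x₀ hx).1.sup (hL x₀ hx).2
    · simp only [hG, hx, if_false]
      exact (hd x₀ hx).continuousAt.tendsto.mono_left nhdsWithin_le_nhds
  have hdG : ∀ x ∉ T, HasDerivAt G 0 x := by
    intro x hx
    refine (hd x hx).congr_of_eventuallyEq ?_
    rw [EventuallyEq, ← pure_sup_nhdsNE]
    exact eventually_sup.2 ⟨by simp [hG, hx], hGg x⟩
  have key : ∀ a b, a ≤ b → G b = G a := by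
    intro a b hab
    have := MeasureTheory.integral_eq_of_hasDerivAt_off_countable_of_le G (fun _ => 0) hab
      T.countable_toSet hc.continuousOn (fun x hx => hdG x hx.2) (by simp)
    simp only [intervalIntegral.integral_zero] at this
    exact (sub_eq_zero.1 this.symm)
  refine ⟨G 0, fun x hx => ?_⟩
  have : G x = g x := by simp [hG, hx]
  rw [← this]
  rcases le_total 0 x with h | h
  · exact key _ _ h
  · exact (key _ _ h).symm

end PiecewiseExponential

/-! ### The distributional equation in terms of `pieceSol`. -/

namespace PeakonPair

open Polynomial in
/-- The coefficient of the equation at the point `t`, in the variable `s = e ^ x`. -/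
noncomputable def kap (c : PeakonPair) (t : ℝ) : ℝ[X] :=
  C (Real.exp (-t)) * (C (c.w t) * X + C (c.v t) * X ^ 2)

/-- The points `x_1, …, x_n`. -/
noncomputable def pts (c : PeakonPair) : Finset ℝ := c.w.support ∪ c.v.support

theorem mem_pts {c : PeakonPair} {x : ℝ} : x ∈ c.pts ↔ x ∈ c.nodes := by
  simp [pts, nodes]

variable {𝕜 : Type} [RCLike 𝕜]

open Polynomial in
theorem aeval_kap (c : PeakonPair) (z : 𝕜) (t : ℝ) : aeval z (c.kap t) =
    Real.exp (-t) * (z * c.w t + z ^ 2 * c.v t) := by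
  simp only [kap, map_mul, map_add, aeval_C, aeval_X, map_pow]
  simp only [RCLike.algebraMap_eq_ofReal]
  ring

/-- The contribution of the point `t` to the solution `f`. -/
noncomputable def source (c : PeakonPair) (z : 𝕜) (f : ℝ → 𝕜) (t : ℝ) : 𝕜 :=
  Polynomial.aeval z (c.kap t) * (Real.exp (t / 2) • f t)

theorem exp_half_sq (x : ℝ) : Real.exp x = Real.exp (x / 2) * Real.exp (x / 2) := by
  rw [← Real.exp_add]; ring_nf

theorem exp_neg_half (x : ℝ) : Real.exp (-x / 2) = (Real.exp (x / 2))⁻¹ := by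
  rw [← Real.exp_neg]; ring_nf

theorem isSolution_of_eq_pieceSol {c : PeakonPair} {z : 𝕜} {f : ℝ → 𝕜} {A B : 𝕜}
    (h : f = pieceSol c.pts A B (c.source z f)) : c.IsSolution z f := by
  have key : ∀ x ∉ c.pts, HasDerivAt f (deriv f x) x ∧ HasDerivAt (deriv f) (f x / 4) x := by
    intro x hx
    have h1 := pieceSol_eventuallyEq (A := A) (B := B) (Y := c.source z f) hx
    rw [← h] at h1
    refine ⟨((hasDerivAt_expSol _ _ x).congr_of_eventuallyEq h1).differentiableAt.hasDerivAt, ?_⟩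
    have h2 := h1.deriv
    rw [deriv_expSol] at h2
    refine ((hasDerivAt_expSol _ _ x).congr_of_eventuallyEq h2).congr_deriv ?_
    rw [h1.self_of_nhds]
    simp only [expSol, RCLike.real_smul_eq_coe_mul]
    ring
  refine ⟨by rw [h]; exact continuous_pieceSol, fun x hx => ?_, fun x hx => ?_, fun x hx => ?_⟩
  · exact (key x (mt mem_pts.1 hx)).1.differentiableAt
  · exact (key x (mt mem_pts.1 hx)).2
  · have h1 := deriv_pieceSol_left (T := c.pts) (A := A) (B := B) (Y := c.source z f) x
    have h2 := deriv_pieceSol_right (T := c.pts) (A := A) (B := B) (Y := c.source z f) x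
    rw [← h] at h1 h2
    refine ⟨_, _, h1, h2, ?_⟩
    rw [filter_le_eq_insert (mem_pts.2 hx), Finset.sum_insert (by simp),
      Finset.sum_insert (by simp)]
    simp only [expSol, source, aeval_kap, RCLike.real_smul_eq_coe_mul]
    rw [exp_half_sq x, exp_neg_half, Real.exp_neg, exp_half_sq x]
    have : (Real.exp (x / 2) : 𝕜) ≠ 0 := by exact_mod_cast (Real.exp_pos _).ne'
    push_cast
    field_simp
    ring

/-- Off the nodes `e^{-x/2} (f/2 + f')` and `e^{x/2} (f/2 - f')` are locally constant; they are the
coefficients of the two exponentials. The jump condition says that they change at a node by the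
source terms, so after correction by the corresponding sums they have no jumps left and are
constant. -/
theorem IsSolution.eq_pieceSol {c : PeakonPair} {z : 𝕜} {f : ℝ → 𝕜} (h : c.IsSolution z f) :
    ∃ A B : 𝕜, f = pieceSol c.pts A B (c.source z f) := by
  have hd : ∀ x ∉ c.pts, HasDerivAt f (deriv f x) x := fun x hx =>
    (h.differentiableAt x (mt mem_pts.2 hx)).hasDerivAt
  have hdd : ∀ x ∉ c.pts, HasDerivAt (deriv f) (f x / 4) x := fun x hx =>
    h.ode x (mt mem_pts.2 hx)
  have e1 : ∀ x : ℝ, HasDerivAt (fun x : ℝ => Real.exp (x / 2)) (Real.exp (x / 2) * (1 / 2)) x :=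
    fun x => ((hasDerivAt_id x).div_const 2).exp
  have e2 : ∀ x : ℝ, HasDerivAt (fun x : ℝ => Real.exp (-x / 2))
      (Real.exp (-x / 2) * (-1 / 2)) x :=
    fun x => ((hasDerivAt_id x).neg.div_const 2).exp
  obtain ⟨A, hA⟩ := constant_off_finset (T := c.pts)
    (g := fun x => Real.exp (-x / 2) • (f x / 2 + deriv f x) -
      ∑ t ∈ c.pts with x < t, c.source z f t) (by
      intro x hx
      have h1 := ((e2 x).smul (((hd x hx).div_const 2).add (hdd x hx))).sub_const
        (∑ t ∈ c.pts with x < t, c.source z f t)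
      refine (h1.congr_of_eventuallyEq ?_).congr_deriv ?_
      · filter_upwards [eventually_filter_lt hx] with y hy
        simp only [hy, Pi.smul_apply', Pi.add_apply]
      · simp only [RCLike.real_smul_eq_coe_mul, Pi.add_apply]
        push_cast
        ring) (by
      intro x hx
      obtain ⟨L, R, hL, hR, hLR⟩ := h.jump x (mem_pts.1 hx)
      refine ⟨_, ?_, ((((e2 x).continuousAt.continuousWithinAt (s := Ioi x)).tendsto.smul
        (((h.continuous.continuousWithinAt (s := Ioi x)).tendsto.div_const 2).add hR)).sub_const
          (∑ t ∈ c.pts with x < t, c.source z f t)).congr' ?_⟩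
      · refine Tendsto.congr' ?_ (((((e2 x).continuousAt.continuousWithinAt
          (s := Iio x)).tendsto.smul (((h.continuous.continuousWithinAt
            (s := Iio x)).tendsto.div_const 2).add hL)).sub_const
              (∑ t ∈ c.pts with x ≤ t, c.source z f t)).trans (le_of_eq ?_))
        · filter_upwards [eventually_filter_lt_left c.pts x] with y hy
          rw [hy]
        · congr 1
          rw [filter_le_eq_insert hx, Finset.sum_insert (by simp), hLR]
          simp only [source, aeval_kap, RCLike.real_smul_eq_coe_mul]
          rw [exp_neg_half, Real.exp_neg, exp_half_sq x]
          have : (Real.exp (x / 2) : 𝕜) ≠ 0 := by exact_mod_cast (Real.exp_pos _).ne'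
          push_cast
          field_simp
          ring
      · filter_upwards [eventually_filter_lt_right c.pts x] with y hy
        rw [hy])
  obtain ⟨B, hB⟩ := constant_off_finset (T := c.pts)
    (g := fun x => Real.exp (x / 2) • (f x / 2 - deriv f x) +
      ∑ t ∈ c.pts with x < t, Real.exp t • c.source z f t) (by
      intro x hx
      have h1 := ((e1 x).smul (((hd x hx).div_const 2).sub (hdd x hx))).add_const
        (∑ t ∈ c.pts with x < t, Real.exp t • c.source z f t)
      refine (h1.congr_of_eventuallyEq ?_).congr_deriv ?_
      · filter_upwards [eventually_filter_lt hx] with y hy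
        simp only [hy, Pi.smul_apply', Pi.sub_apply]
      · simp only [RCLike.real_smul_eq_coe_mul, Pi.sub_apply]
        push_cast
        ring) (by
      intro x hx
      obtain ⟨L, R, hL, hR, hLR⟩ := h.jump x (mem_pts.1 hx)
      refine ⟨_, ?_, ((((e1 x).continuousAt.continuousWithinAt (s := Ioi x)).tendsto.smul
        (((h.continuous.continuousWithinAt (s := Ioi x)).tendsto.div_const 2).sub hR)).add_const
          (∑ t ∈ c.pts with x < t, Real.exp t • c.source z f t)).congr' ?_⟩
      · refine Tendsto.congr' ?_ (((((e1 x).continuousAt.continuousWithinAt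
          (s := Iio x)).tendsto.smul (((h.continuous.continuousWithinAt
            (s := Iio x)).tendsto.div_const 2).sub hL)).add_const
              (∑ t ∈ c.pts with x ≤ t, Real.exp t • c.source z f t)).trans (le_of_eq ?_))
        · filter_upwards [eventually_filter_lt_left c.pts x] with y hy
          rw [hy]
        · congr 1
          rw [filter_le_eq_insert hx, Finset.sum_insert (by simp), hLR]
          simp only [source, aeval_kap, RCLike.real_smul_eq_coe_mul]
          rw [Real.exp_neg, exp_half_sq x]
          have : (Real.exp (x / 2) : 𝕜) ≠ 0 := by exact_mod_cast (Real.exp_pos _).ne'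
          push_cast
          field_simp
          ring
      · filter_upwards [eventually_filter_lt_right c.pts x] with y hy
        rw [hy])
  refine ⟨A, B, Continuous.ext_on (c.pts.countable_toSet.dense_compl ℝ) h.continuous
    continuous_pieceSol fun x hx => ?_⟩
  have hx' : x ∉ c.pts := hx
  rw [pieceSol, ← hA x hx', ← hB x hx']
  simp only [expSol, RCLike.real_smul_eq_coe_mul]
  have : (Real.exp (x / 2) : 𝕜) ≠ 0 := by exact_mod_cast (Real.exp_pos _).ne'
  rw [exp_neg_half]
  push_cast
  field_simp
  ring

end PeakonPair

/-! ### The solution `φ_+` and the eigenvalues as zeros of a polynomial. -/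

theorem eq_zero_of_bounded_exp {𝕜 : Type} [RCLike 𝕜] {A B : 𝕜} {C M : ℝ}
    (h : ∀ x, M ≤ x → ‖expSol A B x‖ ≤ C) : A = 0 := by
  by_contra hA
  have hA' : 0 < ‖A‖ := norm_pos_iff.2 hA
  have ht : Tendsto (fun x : ℝ => Real.exp (x / 2)) atTop atTop :=
    Real.tendsto_exp_atTop.comp (tendsto_id.atTop_div_const (by norm_num))
  obtain ⟨x, hx, hx'⟩ := ((ht.eventually_gt_atTop ((C + ‖B‖) / ‖A‖)).and
    (eventually_ge_atTop (max M 0))).exists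
  have h1 := h x (le_trans (le_max_left _ _) hx')
  have h0 : 0 ≤ x := le_trans (le_max_right _ _) hx'
  have h2 : ‖Real.exp (x / 2) • A‖ ≤ ‖expSol A B x‖ + ‖Real.exp (-x / 2) • B‖ := by
    have := norm_sub_le (expSol A B x) (Real.exp (-x / 2) • B)
    simpa [expSol] using this
  rw [norm_smul, norm_smul, Real.norm_of_nonneg (Real.exp_pos _).le,
    Real.norm_of_nonneg (Real.exp_pos _).le] at h2
  have h3 : Real.exp (-x / 2) ≤ 1 := Real.exp_le_one_iff.2 (by linarith)
  rw [div_lt_iff₀ hA'] at hx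
  nlinarith [norm_nonneg B]

theorem exists_le_finset (T : Finset ℝ) : ∃ m : ℝ, ∀ t ∈ T, m < t := by
  obtain ⟨m, hm⟩ := T.bddBelow
  exact ⟨m - 1, fun t ht => by linarith [hm ht]⟩

theorem exists_ge_finset (T : Finset ℝ) : ∃ m : ℝ, ∀ t ∈ T, t < m := by
  obtain ⟨m, hm⟩ := T.bddAbove
  exact ⟨m + 1, fun t ht => by linarith [hm ht]⟩

namespace PeakonPair

open Polynomial

/-- The polynomial `z ↦ e^{x/2} φ_+(z, x)`. -/
noncomputable def rightPoly (c : PeakonPair) : ℝ → ℝ[X] :=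
  (volterra_exists c.pts c.kap fun _ => 1).choose

theorem rightPoly_eq (c : PeakonPair) (x : ℝ) : c.rightPoly x = 1 +
    ∑ t ∈ c.pts with x < t, (Real.exp x - Real.exp t) • (c.kap t * c.rightPoly t) :=
  (volterra_exists c.pts c.kap fun _ => 1).choose_spec x

/-- The Wronskian of `φ_+` and `φ_-`. -/
noncomputable def wronskian (c : PeakonPair) : ℝ[X] :=
  1 - ∑ t ∈ c.pts, Real.exp t • (c.kap t * c.rightPoly t)

variable {𝕜 : Type} [RCLike 𝕜]

theorem aeval_rightPoly_eq (c : PeakonPair) (z : 𝕜) (x : ℝ) : aeval z (c.rightPoly x) = 1 +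
    ∑ t ∈ c.pts with x < t,
      (Real.exp x - Real.exp t) • (aeval z (c.kap t) * aeval z (c.rightPoly t)) := by
  rw [rightPoly_eq]
  simp only [map_add, map_one, map_sum, map_smul, map_mul]

theorem aeval_wronskian (c : PeakonPair) (z : 𝕜) : aeval z c.wronskian =
    1 - ∑ t ∈ c.pts, Real.exp t • (aeval z (c.kap t) * aeval z (c.rightPoly t)) := by
  simp only [wronskian, map_sub, map_one, map_sum, map_smul, map_mul]

/-- The solution `φ_+(z, ·)`. -/
noncomputable def phi (c : PeakonPair) (z : 𝕜) (x : ℝ) : 𝕜 :=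
  Real.exp (-x / 2) • aeval z (c.rightPoly x)

theorem exp_half_smul_pieceSol {T : Finset ℝ} {A B : 𝕜} {Y : ℝ → 𝕜} (x : ℝ) :
    Real.exp (x / 2) • pieceSol T A B Y x = (Real.exp x • A + B) +
      ∑ t ∈ T with x < t, (Real.exp x - Real.exp t) • Y t := by
  simp only [pieceSol, expSol, sub_smul, Finset.sum_sub_distrib, ← Finset.smul_sum]
  rw [exp_half_sq x, exp_neg_half]
  have : (Real.exp (x / 2) : 𝕜) ≠ 0 := by exact_mod_cast (Real.exp_pos _).ne'
  simp only [RCLike.real_smul_eq_coe_mul]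
  push_cast
  field_simp
  ring

theorem exp_half_smul_inj {a b : 𝕜} (x : ℝ) (h : Real.exp (x / 2) • a = Real.exp (x / 2) • b) :
    a = b := by
  simpa [(Real.exp_pos _).ne'] using h

theorem exp_half_smul_phi (c : PeakonPair) (z : 𝕜) (x : ℝ) :
    Real.exp (x / 2) • c.phi z x = aeval z (c.rightPoly x) := by
  rw [phi, smul_smul, exp_neg_half, mul_inv_cancel₀ (Real.exp_pos _).ne', one_smul]

theorem phi_eq_pieceSol (c : PeakonPair) (z : 𝕜) :
    c.phi z = pieceSol c.pts 0 1 (c.source z (c.phi z)) := by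
  funext x
  apply exp_half_smul_inj x
  rw [exp_half_smul_pieceSol, exp_half_smul_phi, aeval_rightPoly_eq]
  simp only [source, exp_half_smul_phi, smul_zero, zero_add]

theorem eq_smul_phi {c : PeakonPair} {z : 𝕜} {f : ℝ → 𝕜} {B : 𝕜}
    (h : f = pieceSol c.pts 0 B (c.source z f)) (x : ℝ) : f x = B * c.phi z x := by
  apply exp_half_smul_inj x
  have h1 := volterra_unique (T := c.pts) (k := fun t => aeval z (c.kap t)) (g := fun _ => B)
    (h := fun x => Real.exp (x / 2) • f x) (h' := fun x => B * aeval z (c.rightPoly x)) ?_ ?_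
  · rw [mul_comm B, ← smul_mul_assoc, exp_half_smul_phi, mul_comm]
    exact congrFun h1 x
  · intro x
    have := congrArg (Real.exp (x / 2) • ·) (congrFun h x)
    simp only [exp_half_smul_pieceSol, smul_zero, zero_add] at this
    exact this
  · intro x
    rw [aeval_rightPoly_eq, mul_add, mul_one, Finset.mul_sum]
    congr 1
    refine Finset.sum_congr rfl fun t _ => ?_
    rw [mul_smul_comm, mul_left_comm]

theorem phi_isSolution (c : PeakonPair) (z : 𝕜) : c.IsSolution z (c.phi z) :=
  isSolution_of_eq_pieceSol (c.phi_eq_pieceSol z)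

theorem pieceSol_of_right {T : Finset ℝ} {A B : 𝕜} {Y : ℝ → 𝕜} {x : ℝ} (hx : ∀ t ∈ T, t < x) :
    pieceSol T A B Y x = expSol A B x := by
  have : T.filter (x < ·) = ∅ := Finset.filter_false_of_mem fun t ht => (hx t ht).not_gt
  simp [pieceSol, this]

theorem pieceSol_of_left {T : Finset ℝ} {A B : 𝕜} {Y : ℝ → 𝕜} {x : ℝ} (hx : ∀ t ∈ T, x < t) :
    pieceSol T A B Y x = expSol (A + ∑ t ∈ T, Y t) (B - ∑ t ∈ T, Real.exp t • Y t) x := by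
  have : T.filter (x < ·) = T := Finset.filter_true_of_mem hx
  simp [pieceSol, this]

theorem phi_isPhiPlus (c : PeakonPair) (z : ℝ) : c.IsPhiPlus z (c.phi z) := by
  refine ⟨c.phi_isSolution z, ?_⟩
  obtain ⟨M, hM⟩ := exists_ge_finset c.pts
  filter_upwards [eventually_ge_atTop M] with x hx
  rw [phi_eq_pieceSol, pieceSol_of_right fun t ht => (hM t ht).trans_le hx]
  simp [expSol]

theorem IsPhiPlus.eq_phi {c : PeakonPair} {z : ℝ} {f : ℝ → ℝ} (h : c.IsPhiPlus z f) :
    f = c.phi z := by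
  obtain ⟨A, B, hf⟩ := h.isSolution.eq_pieceSol
  obtain ⟨M, hM⟩ := exists_ge_finset c.pts
  obtain ⟨M', hM'⟩ := eventually_atTop.1 h.eq_exp
  have key : ∀ x, max M M' ≤ x → A * Real.exp x + B = 1 := by
    intro x hx
    have h2 : c.pts.filter (x < ·) = ∅ := Finset.filter_false_of_mem fun t ht =>
      ((hM t ht).trans_le ((le_max_left _ _).trans hx)).not_gt
    have h1 := exp_half_smul_pieceSol (T := c.pts) (A := A) (B := B) (Y := c.source z f) x
    rw [← hf, h2, hM' x ((le_max_right _ _).trans hx), smul_eq_mul, smul_eq_mul,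
      exp_neg_half, mul_inv_cancel₀ (Real.exp_pos (x / 2)).ne'] at h1
    simp only [Finset.sum_empty, add_zero] at h1
    linarith
  have k1 := key _ le_rfl
  have k2 := key (max M M' + 1) (by linarith)
  have hA : A = 0 := by
    have h3 : A * (Real.exp (max M M' + 1) - Real.exp (max M M')) = 0 := by linarith
    have h4 : Real.exp (max M M') < Real.exp (max M M' + 1) := Real.exp_lt_exp.2 (by linarith)
    rcases mul_eq_zero.1 h3 with h | h
    · exact h
    · linarith
  have hB : B = 1 := by rw [hA] at k1; linarith
  subst hA hB
  funext x
  rw [eq_smul_phi hf, one_mul]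

/-- The left side is the coefficient of `e^{-x/2}` to the left of all nodes. Its vanishing is
boundedness at `-∞`, which ties eigenvalues to zeros of `wronskian`. -/
theorem sum_source {c : PeakonPair} {z : 𝕜} {f : ℝ → 𝕜} {B : 𝕜}
    (h : ∀ x, f x = B * c.phi z x) :
    B - ∑ t ∈ c.pts, Real.exp t • c.source z f t = B * aeval z c.wronskian := by
  rw [aeval_wronskian, mul_sub, mul_one, Finset.mul_sum]
  congr 1
  refine Finset.sum_congr rfl fun t _ => ?_
  rw [source, h, ← exp_half_smul_phi]
  simp only [RCLike.real_smul_eq_coe_mul]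
  ring

theorem isEigenvalue_iff (c : PeakonPair) (z : ℂ) : c.IsEigenvalue z ↔ aeval z c.wronskian = 0 := by
  obtain ⟨M, hM⟩ := exists_ge_finset c.pts
  obtain ⟨m, hm⟩ := exists_le_finset c.pts
  constructor
  · rintro ⟨f, hf, hf0, C, hC⟩
    obtain ⟨A, B, hfe⟩ := hf.eq_pieceSol
    have hA : A = 0 := by
      refine eq_zero_of_bounded_exp (B := B) (C := C) (M := M) fun x hx => ?_
      rw [← pieceSol_of_right (T := c.pts) (Y := c.source z f)
        fun t ht => (hM t ht).trans_le hx, ← hfe]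
      exact hC x
    subst hA
    have hB : B ≠ 0 := by
      rintro rfl
      exact hf0 (funext fun x => by rw [eq_smul_phi hfe, zero_mul]; rfl)
    -- Replacing `x` by `-x` exchanges the two exponentials, so the growth argument at `+∞` also
    -- covers `-∞`.
    have hB' : B - ∑ t ∈ c.pts, Real.exp t • c.source z f t = 0 := by
      refine eq_zero_of_bounded_exp (B := 0 + ∑ t ∈ c.pts, c.source z f t) (C := C) (M := -m)
        fun x hx => ?_
      have := hC (-x)
      rw [hfe, pieceSol_of_left (fun t ht => lt_of_le_of_lt (by linarith) (hm t ht))] at this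
      rw [expSol, neg_neg] at this
      rwa [expSol, add_comm]
    rw [sum_source (eq_smul_phi hfe)] at hB'
    exact (mul_eq_zero.1 hB').resolve_left hB
  · intro hz
    have hM1 : ∀ x, M ≤ x → c.phi z x = Real.exp (-x / 2) := fun x hx => by
      rw [phi_eq_pieceSol, pieceSol_of_right fun t ht => (hM t ht).trans_le hx]
      simp [expSol]
    have hm1 : ∀ x, x ≤ m →
        c.phi z x = Real.exp (x / 2) * ∑ t ∈ c.pts, c.source z (c.phi z) t := fun x hx => by
      rw [phi_eq_pieceSol, pieceSol_of_left (fun t ht => hx.trans_lt (hm t ht)),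
        ← phi_eq_pieceSol, sum_source (B := 1) (by simp), hz]
      simp [expSol]
    obtain ⟨C, hC⟩ := isCompact_Icc.exists_bound_of_continuousOn
      (s := Icc m M) (c.phi_isSolution z).continuous.continuousOn
    refine ⟨c.phi z, c.phi_isSolution z, fun h0 => ?_, max C (max (Real.exp (-M / 2))
      (Real.exp (m / 2) * ‖∑ t ∈ c.pts, c.source z (c.phi z) t‖)), fun x => ?_⟩
    · have := hM1 M le_rfl
      rw [h0, Pi.zero_apply] at this
      exact (Real.exp_pos (-M / 2)).ne (by exact_mod_cast this)
    · rcases le_total M x with h | h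
      · refine le_trans ?_ ((le_max_left _ _).trans (le_max_right _ _))
        rw [hM1 x h, Complex.norm_real, Real.norm_of_nonneg (Real.exp_pos _).le]
        exact Real.exp_le_exp.2 (by linarith)
      · rcases le_total x m with h' | h'
        · refine le_trans ?_ ((le_max_right _ _).trans (le_max_right _ _))
          rw [hm1 x h', norm_mul, Complex.norm_real, Real.norm_of_nonneg (Real.exp_pos _).le]
          gcongr
        · exact (hC x ⟨h', h⟩).trans (le_max_left _ _)

theorem isSpectrum_iff {c : PeakonPair} {N : ℕ} {lam : Fin N → ℝ} : c.IsSpectrum lam ↔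
    StrictMono lam ∧ ∀ z : ℂ, aeval z c.wronskian = 0 ↔ ∃ i, z = (lam i : ℂ) := by
  simp only [← isEigenvalue_iff]
  exact ⟨fun h => ⟨h.1, h.2⟩, fun h => ⟨h.1, h.2⟩⟩

/-- The modified norming constant `z γ_z²`. -/
noncomputable def tau (c : PeakonPair) (z : ℝ) : ℝ := z * c.gammaSq z (c.phi z)

theorem isInteriorData_iff {c : PeakonPair} {a : ℝ} {N : ℕ} {lam p : Fin N → ℝ} :
    c.IsInteriorData a lam p ↔ c.IsSpectrum lam ∧
      ∀ i, p i = c.phi (lam i) a / √(c.tau (lam i)) := by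
  constructor
  · rintro ⟨h1, h2⟩
    refine ⟨h1, fun i => ?_⟩
    obtain ⟨g, ⟨f, hf, hg⟩, hp⟩ := h2 i
    rw [hp, hg, hf.eq_phi, tau]
  · rintro ⟨h1, h2⟩
    exact ⟨h1, fun i => ⟨_, ⟨_, c.phi_isPhiPlus (lam i), fun x => rfl⟩, h2 i⟩⟩

theorem isSpectralData_iff {c : PeakonPair} {N : ℕ} {lam τ : Fin N → ℝ} :
    c.IsSpectralData lam τ ↔ c.IsSpectrum lam ∧ ∀ i, τ i = c.tau (lam i) := by
  constructor
  · rintro ⟨h1, h2⟩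
    refine ⟨h1, fun i => ?_⟩
    obtain ⟨f, hf, hp⟩ := h2 i
    rw [hp, hf.eq_phi, tau]
  · rintro ⟨h1, h2⟩
    exact ⟨h1, fun i => ⟨_, c.phi_isPhiPlus (lam i), h2 i⟩⟩

theorem tau_eq (c : PeakonPair) (z : ℝ) : c.tau z = ∑ t ∈ c.pts,
    (z * c.w t + 2 * z ^ 2 * c.v t) * (Real.exp (-t) * (c.rightPoly t).eval z ^ 2) := by
  have h1 : ∀ x, |c.phi z x| ^ 2 = Real.exp (-x) * (c.rightPoly x).eval z ^ 2 := by
    intro x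
    rw [sq_abs, phi, coe_aeval_eq_eval, smul_eq_mul, mul_pow, ← Real.exp_nat_mul]
    congr 2
    push_cast; ring
  rw [tau, gammaSq, Finsupp.sum_of_support_subset (s := c.pts) _ Finset.subset_union_left _
    (by simp), Finsupp.sum_of_support_subset (s := c.pts) _ Finset.subset_union_right _ (by simp),
    Finset.mul_sum, ← Finset.sum_add_distrib, Finset.mul_sum]
  refine Finset.sum_congr rfl fun t _ => ?_
  rw [h1]
  ring

end PeakonPair

/-! ### Positivity of the energy form with kernel `min (e^s) (e^t)`. -/

/-- Raising `m` to `e^r`, with `r` the smallest point, splits off the square `(e^r - m) (∑ y)²`; in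
the remaining form the row and the column of `r` vanish, so the induction continues with the bound
`e^r`. -/
theorem sum_min_exp_nonneg (T : Finset ℝ) (y : ℝ → ℝ) : ∀ m : ℝ, (∀ t ∈ T, m ≤ Real.exp t) →
    0 ≤ ∑ s ∈ T, ∑ t ∈ T, (min (Real.exp s) (Real.exp t) - m) * (y s * y t) := by
  induction T using Finset.induction_on_min with
  | empty => simp
  | insert r T hr ih =>
    intro m hm
    have hrT : r ∉ T := fun h => lt_irrefl _ (hr r h)
    have hmin : ∀ t ∈ T, min (Real.exp r) (Real.exp t) = Real.exp r := fun t ht =>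
      min_eq_left (Real.exp_le_exp.2 (hr t ht).le)
    have h1 : ∑ s ∈ insert r T, ∑ t ∈ insert r T,
        (min (Real.exp s) (Real.exp t) - m) * (y s * y t) =
        (Real.exp r - m) * (∑ t ∈ insert r T, y t) ^ 2 +
        ∑ s ∈ insert r T, ∑ t ∈ insert r T,
          (min (Real.exp s) (Real.exp t) - Real.exp r) * (y s * y t) := by
      rw [sq, Finset.sum_mul_sum, Finset.mul_sum, ← Finset.sum_add_distrib]
      refine Finset.sum_congr rfl fun s _ => ?_
      rw [Finset.mul_sum, ← Finset.sum_add_distrib]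
      refine Finset.sum_congr rfl fun t _ => ?_
      ring
    have h2 : ∑ s ∈ insert r T, ∑ t ∈ insert r T,
          (min (Real.exp s) (Real.exp t) - Real.exp r) * (y s * y t) =
        ∑ s ∈ T, ∑ t ∈ T, (min (Real.exp s) (Real.exp t) - Real.exp r) * (y s * y t) := by
      rw [Finset.sum_insert hrT]
      have : ∑ t ∈ insert r T, (min (Real.exp r) (Real.exp t) - Real.exp r) * (y r * y t) = 0 := by
        refine Finset.sum_eq_zero fun t ht => ?_
        rcases Finset.mem_insert.1 ht with rfl | ht
        · simp
        · simp [hmin t ht]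
      rw [this, zero_add]
      refine Finset.sum_congr rfl fun s hs => ?_
      rw [Finset.sum_insert hrT, min_comm, hmin s hs, sub_self, zero_mul, zero_add]
    rw [h1, h2]
    have h3 := hm r (Finset.mem_insert_self _ _)
    have h4 := ih (Real.exp r) fun t ht => Real.exp_le_exp.2 (hr t ht).le
    have h5 := mul_nonneg (sub_nonneg.2 h3) (sq_nonneg (∑ t ∈ insert r T, y t))
    linarith

/-- Adding a point `M` to the right of `T` with weight `-e^{-M}` changes the form by `-2 e^{-M} +
e^{-M}`, thanks to the constraint. Nonnegativity of the enlarged form then bounds the original one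
below by `e^{-M}`. -/
theorem sum_min_exp_pos {T : Finset ℝ} {y : ℝ → ℝ} (h : ∑ t ∈ T, Real.exp t * y t = 1) :
    0 < ∑ s ∈ T, ∑ t ∈ T, min (Real.exp s) (Real.exp t) * (y s * y t) := by
  obtain ⟨M, hM⟩ := exists_ge_finset T
  have hMT : M ∉ T := fun h => lt_irrefl _ (hM M h)
  set y' : ℝ → ℝ := Function.update y M (-Real.exp (-M)) with hy'
  have hyM : y' M = -Real.exp (-M) := Function.update_self ..
  have hyT : ∀ t ∈ T, y' t = y t := fun t ht =>
    Function.update_of_ne (ne_of_mem_of_not_mem ht hMT) ..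
  have hmin : ∀ t ∈ T, min (Real.exp t) (Real.exp M) = Real.exp t := fun t ht =>
      min_eq_left (Real.exp_le_exp.2 (hM t ht).le)
  have h1 := sum_min_exp_nonneg (insert M T) y' 0 fun t _ => (Real.exp_pos t).le
  simp only [sub_zero] at h1
  have h2 : ∑ t ∈ T, min (Real.exp M) (Real.exp t) * (y' M * y' t) = -Real.exp (-M) := by
    rw [← mul_one (-Real.exp (-M)), ← h, Finset.mul_sum]
    refine Finset.sum_congr rfl fun t ht => ?_
    rw [min_comm, hmin t ht, hyM, hyT t ht]; ring
  have h3 : ∑ s ∈ T, ∑ t ∈ insert M T, min (Real.exp s) (Real.exp t) * (y' s * y' t) =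
      -Real.exp (-M) + ∑ s ∈ T, ∑ t ∈ T, min (Real.exp s) (Real.exp t) * (y s * y t) := by
    rw [← h2, ← Finset.sum_add_distrib]
    refine Finset.sum_congr rfl fun s hs => ?_
    rw [Finset.sum_insert hMT, min_comm (Real.exp s), mul_comm (y' s)]
    congr 1
    exact Finset.sum_congr rfl fun t ht => by rw [hyT s hs, hyT t ht]
  rw [Finset.sum_insert hMT, h3, Finset.sum_insert hMT, h2, min_self, hyM] at h1
  have h4 : Real.exp M * Real.exp (-M) = 1 := by rw [← Real.exp_add]; simp
  have h5 := Real.exp_pos (-M)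
  nlinarith

/-! ### Reflection, the left solution and the norming constants. -/

namespace PeakonPair

open Polynomial

/-- The reflection of a pair of measures at the origin. -/
noncomputable def refl (c : PeakonPair) : PeakonPair where
  w := c.w.equivMapDomain (Equiv.neg ℝ)
  v := c.v.equivMapDomain (Equiv.neg ℝ)
  v_nonneg x := by simpa using c.v_nonneg (-x)

theorem refl_w (c : PeakonPair) (t : ℝ) : c.refl.w t = c.w (-t) := by simp [refl]

theorem refl_v (c : PeakonPair) (t : ℝ) : c.refl.v t = c.v (-t) := by simp [refl]

theorem mem_pts_iff {c : PeakonPair} {x : ℝ} : x ∈ c.pts ↔ c.w x ≠ 0 ∨ c.v x ≠ 0 := by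
  simp [pts]

theorem mem_pts_refl {c : PeakonPair} {x : ℝ} : x ∈ c.refl.pts ↔ -x ∈ c.pts := by
  simp [mem_pts_iff, refl_w, refl_v]

theorem sum_pts_refl {M : Type*} [AddCommMonoid M] (c : PeakonPair) (a : ℝ) (F : ℝ → M) :
    ∑ t ∈ c.refl.pts with -a < t, F t = ∑ t ∈ c.pts with t < a, F (-t) := by
  refine Finset.sum_bij' (fun t _ => -t) (fun t _ => -t) ?_ ?_ ?_ ?_ ?_ <;>
    simp only [Finset.mem_filter, mem_pts_refl, neg_neg, implies_true]
  · exact fun t ht => ⟨ht.1, by linarith [ht.2]⟩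
  · exact fun t ht => ⟨ht.1, by linarith [ht.2]⟩

theorem kap_refl (c : PeakonPair) (t : ℝ) : c.refl.kap (-t) = C (Real.exp (2 * t)) * c.kap t := by
  rw [kap, kap, refl_w, refl_v, neg_neg, ← mul_assoc, ← C_mul, ← Real.exp_add]
  congr 3
  ring

/-- The polynomial `z ↦ e^{x/2} φ_-(z, x)`. -/
noncomputable def leftPoly (c : PeakonPair) (x : ℝ) : ℝ[X] :=
  C (Real.exp x) * c.refl.rightPoly (-x)

theorem leftPoly_eq (c : PeakonPair) (x : ℝ) : c.leftPoly x = algebraMap ℝ ℝ[X] (Real.exp x) -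
    ∑ t ∈ c.pts with t < x, (Real.exp x - Real.exp t) • (c.kap t * c.leftPoly t) := by
  rw [leftPoly, rightPoly_eq, sum_pts_refl, mul_add, mul_one, sub_eq_add_neg,
    ← Finset.sum_neg_distrib, Finset.mul_sum]
  congr 1
  refine Finset.sum_congr rfl fun t _ => ?_
  rw [leftPoly, kap_refl, Algebra.smul_def, Algebra.smul_def, algebraMap_eq, two_mul, Real.exp_add,
    Real.exp_neg, Real.exp_neg]
  have h1 : C (Real.exp x) * C (Real.exp x)⁻¹ = (1 : ℝ[X]) := by
    rw [← C_mul, mul_inv_cancel₀ (Real.exp_pos x).ne', C_1]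
  have h2 : C (Real.exp t) * C (Real.exp t)⁻¹ = (1 : ℝ[X]) := by
    rw [← C_mul, mul_inv_cancel₀ (Real.exp_pos t).ne', C_1]
  simp only [C_sub, C_mul]
  linear_combination (c.kap t * c.refl.rightPoly (-t) * C (Real.exp t) ^ 2) * h1 -
    (c.kap t * c.refl.rightPoly (-t) * C (Real.exp t) * C (Real.exp x)) * h2

theorem wronskian_eq_left (c : PeakonPair) :
    c.wronskian = 1 - ∑ t ∈ c.pts, c.kap t * c.leftPoly t := by
  have := volterra_green c.rightPoly_eq c.leftPoly_eq
  simp only [sub_self, zero_mul, Finset.sum_const_zero] at this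
  rw [wronskian, ← sub_eq_zero]
  linear_combination this

/-- The derivative of `rightPoly` with respect to `e ^ x`, to the right of `x`. -/
noncomputable def slope (c : PeakonPair) (x : ℝ) : ℝ[X] :=
  ∑ t ∈ c.pts with x < t, c.kap t * c.rightPoly t

theorem one_sub_sum_left {c : PeakonPair} {a : ℝ} (ha : a ∉ c.pts) :
    1 - ∑ t ∈ c.pts with t ≤ a, c.kap t * c.leftPoly t =
      c.refl.rightPoly (-a) - C (Real.exp (-a)) * c.refl.slope (-a) := by
  have h : c.pts.filter (· ≤ a) = c.pts.filter (· < a) :=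
    Finset.filter_congr fun t ht => ⟨fun h => h.lt_of_ne fun e => ha (e ▸ ht), le_of_lt⟩
  rw [h, rightPoly_eq, slope, sum_pts_refl, sum_pts_refl, Finset.mul_sum, add_sub_assoc,
    ← Finset.sum_sub_distrib, sub_eq_add_neg, ← Finset.sum_neg_distrib]
  congr 1
  refine Finset.sum_congr rfl fun t _ => ?_
  rw [leftPoly, kap_refl, Algebra.smul_def, algebraMap_eq, two_mul, Real.exp_add, Real.exp_neg t]
  have h2 : C (Real.exp t) * C (Real.exp t)⁻¹ = (1 : ℝ[X]) := by
    rw [← C_mul, mul_inv_cancel₀ (Real.exp_pos t).ne', C_1]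
  simp only [C_sub, C_mul]
  linear_combination (c.kap t * c.refl.rightPoly (-t) * C (Real.exp t)) * h2

/-- Divided by the product of the two values at `a`, the right side is `1` minus one term for each
half-line. Through this decoupling the inverse problem reduces to two half-line problems. -/
theorem wronskian_eq {c : PeakonPair} {a : ℝ} (ha : a ∉ c.pts) :
    c.wronskian = c.rightPoly a * c.refl.rightPoly (-a) -
      C (Real.exp (-a)) * c.rightPoly a * c.refl.slope (-a) -
      C (Real.exp a) * c.slope a * c.refl.rightPoly (-a) := by
  have := volterra_wronskian a c.rightPoly_eq c.leftPoly_eq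
  rw [one_sub_sum_left ha, leftPoly] at this
  rw [wronskian, this]
  simp only [slope]
  ring

theorem eval_rightPoly_eq (c : PeakonPair) (z x : ℝ) : (c.rightPoly x).eval z = 1 +
    ∑ t ∈ c.pts with x < t,
      (Real.exp x - Real.exp t) • ((c.kap t).eval z * (c.rightPoly t).eval z) := by
  rw [rightPoly_eq]
  simp [eval_finsetSum]

theorem eval_leftPoly_eq (c : PeakonPair) (z x : ℝ) : (c.leftPoly x).eval z =
    algebraMap ℝ ℝ (Real.exp x) - ∑ t ∈ c.pts with t < x,
      (Real.exp x - Real.exp t) • ((c.kap t).eval z * (c.leftPoly t).eval z) := by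
  rw [leftPoly_eq]
  simp [eval_finsetSum]

theorem eval_wronskian (c : PeakonPair) (z : ℝ) : c.wronskian.eval z =
    1 - ∑ t ∈ c.pts, Real.exp t * ((c.kap t).eval z * (c.rightPoly t).eval z) := by
  simp [wronskian, eval_finsetSum]

theorem eval_wronskian_left (c : PeakonPair) (z : ℝ) : c.wronskian.eval z =
    1 - ∑ t ∈ c.pts, (c.kap t).eval z * (c.leftPoly t).eval z := by
  simp [wronskian_eq_left, eval_finsetSum]

/-- Seen from `+∞`, the left solution has `W(z)` as the coefficient of `e^x`. At a zero of `W` only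
a constant is left as inhomogeneity, and uniqueness for the Volterra equation makes it a multiple of
the right solution. -/
theorem exists_leftPoly_eq {c : PeakonPair} {z : ℝ} (hz : c.wronskian.eval z = 0) :
    ∃ B, ∀ x, (c.leftPoly x).eval z = B * (c.rightPoly x).eval z := by
  refine ⟨∑ t ∈ c.pts, Real.exp t • ((c.kap t).eval z * (c.leftPoly t).eval z), fun x =>
    congrFun (volterra_unique (T := c.pts) (k := fun t => (c.kap t).eval z)
      (g := fun _ => ∑ t ∈ c.pts, Real.exp t • ((c.kap t).eval z * (c.leftPoly t).eval z))
      (h := fun x => (c.leftPoly x).eval z) (h' := fun x => _ * (c.rightPoly x).eval z)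
      (fun x => ?_) (fun x => ?_)) x⟩
  · rw [volterra_left_to_right (k := fun t => (c.kap t).eval z)
      (g := fun t => (c.leftPoly t).eval z) (c.eval_leftPoly_eq z) x, ← eval_wronskian_left, hz,
      smul_zero, zero_add]
  · rw [eval_rightPoly_eq, mul_add, mul_one, Finset.mul_sum]
    congr 1
    refine Finset.sum_congr rfl fun t _ => ?_
    rw [mul_smul_comm, mul_left_comm]

/-- Green's identity is applied with the right solution frozen at `z` and the left solution kept as
a polynomial. It writes `W` as a sum with factors `k(z) - k`, which vanish at `z`, so only these
factors are differentiated there. -/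
theorem neg_mul_derivative_wronskian {c : PeakonPair} {z B : ℝ} (hz : c.wronskian.eval z = 0)
    (hB : ∀ x, (c.leftPoly x).eval z = B * (c.rightPoly x).eval z) :
    -z * c.wronskian.derivative.eval z = B * c.tau z := by
  have h1 := volterra_green (T := c.pts) (k := fun t => C ((c.kap t).eval z)) (k' := c.kap)
    (h := fun t => C ((c.rightPoly t).eval z)) (g := c.leftPoly) (fun x => by
      rw [eval_rightPoly_eq]
      simp only [map_add, map_sum, C_1, smul_eq_mul, C_mul, Algebra.smul_def, algebraMap_eq])
    c.leftPoly_eq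
  have h2 : ∑ t ∈ c.pts, Real.exp t • (C ((c.kap t).eval z) * C ((c.rightPoly t).eval z)) = 1 := by
    rw [eval_wronskian, sub_eq_zero] at hz
    rw [← C_1, hz]
    simp only [map_sum, C_mul, Algebra.smul_def, algebraMap_eq]
  rw [h2, ← wronskian_eq_left] at h1
  rw [← h1, tau_eq, derivative_sum, eval_finsetSum, Finset.mul_sum, Finset.mul_sum]
  refine Finset.sum_congr rfl fun t _ => ?_
  simp only [derivative_mul, derivative_sub, derivative_C, eval_add, eval_mul, eval_sub, eval_C,
    sub_self, zero_mul, add_zero, zero_sub, eval_neg, hB, kap, derivative_add, derivative_X,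
    derivative_X_pow, eval_zero, eval_X, eval_pow, eval_one, Nat.cast_ofNat]
  ring

/-- `W(z) = 0` turns the Volterra equation into `h(x) = ∑ min (e^x) (e^t) y_t`. Hence `τ` is the
positive energy of `y` plus a nonnegative term: of the two copies of `z² v` in `τ`, one belongs to
the energy and the other remains. -/
theorem tau_pos {c : PeakonPair} {z : ℝ} (hz : c.wronskian.eval z = 0) : 0 < c.tau z := by
  set y : ℝ → ℝ := fun t => (c.kap t).eval z * (c.rightPoly t).eval z with hy
  have h1 : ∑ t ∈ c.pts, Real.exp t * y t = 1 := by
    rw [eval_wronskian, sub_eq_zero] at hz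
    exact hz.symm
  have h2 : ∀ x, (c.rightPoly x).eval z = ∑ t ∈ c.pts, min (Real.exp x) (Real.exp t) * y t := by
    intro x
    rw [eval_rightPoly_eq, ← h1, Finset.sum_filter, ← Finset.sum_add_distrib]
    refine Finset.sum_congr rfl fun t _ => ?_
    by_cases h : x < t
    · rw [if_pos h, min_eq_left (Real.exp_le_exp.2 h.le), smul_eq_mul]; ring
    · rw [if_neg h, min_eq_right (Real.exp_le_exp.2 (not_lt.1 h)), add_zero]
  have h3 := sum_min_exp_pos h1
  have h4 : c.tau z = ∑ s ∈ c.pts, ∑ t ∈ c.pts, min (Real.exp s) (Real.exp t) * (y s * y t) +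
      ∑ t ∈ c.pts, z ^ 2 * c.v t * (Real.exp (-t) * (c.rightPoly t).eval z ^ 2) := by
    rw [tau_eq, ← Finset.sum_add_distrib]
    refine Finset.sum_congr rfl fun s _ => ?_
    have : ∑ t ∈ c.pts, min (Real.exp s) (Real.exp t) * (y s * y t) =
        y s * (c.rightPoly s).eval z := by
      rw [h2, Finset.mul_sum]
      exact Finset.sum_congr rfl fun t _ => by ring
    rw [this]
    simp only [hy, kap, eval_mul, eval_add, eval_C, eval_X, eval_pow]
    ring
  rw [h4]
  refine add_pos_of_pos_of_nonneg h3 (Finset.sum_nonneg fun t _ => ?_)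
  have := c.v_nonneg t
  positivity

/-- The proportionality of the two solutions also holds for their slopes at `a`. At a cancelled pole
both values vanish, and the slopes are what carries the norming constant. -/
theorem eval_left_slope {c : PeakonPair} {z B a : ℝ} (ha : a ∉ c.pts)
    (hz : c.wronskian.eval z = 0)
    (hB : ∀ x, (c.leftPoly x).eval z = B * (c.rightPoly x).eval z) :
    (c.refl.rightPoly (-a)).eval z - Real.exp (-a) * (c.refl.slope (-a)).eval z =
      B * (c.slope a).eval z := by
  have h1 := congrArg (eval z) (one_sub_sum_left ha)
  have h2 := c.eval_wronskian_left z
  rw [hz] at h2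
  simp only [eval_sub, eval_one, eval_finsetSum, eval_mul, eval_C] at h1
  rw [← h1, slope, eval_finsetSum, Finset.mul_sum,
    ← Finset.sum_filter_add_sum_filter_not c.pts (· ≤ a)] at *
  simp only [not_le] at h2
  have h3 : ∑ t ∈ c.pts with a < t, B * (c.kap t * c.rightPoly t).eval z =
      ∑ t ∈ c.pts with a < t, (c.kap t).eval z * (c.leftPoly t).eval z :=
    Finset.sum_congr rfl fun t _ => by rw [hB, eval_mul]; ring
  rw [h3]
  linarith

theorem eval_zero_rightPoly (c : PeakonPair) (x : ℝ) : (c.rightPoly x).eval 0 = 1 := by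
  rw [eval_rightPoly_eq]
  simp [kap]

theorem eval_zero_wronskian (c : PeakonPair) : c.wronskian.eval 0 = 1 := by
  rw [eval_wronskian]
  simp [kap]

end PeakonPair

/-! ### Polynomials with simple real roots, normalized at `0`. -/

section RootProd

open Polynomial

theorem eq_C_mul_prod_of_simple_real_roots {p : ℝ[X]} (hp : p ≠ 0)
    (hreal : ∀ z : ℂ, aeval z p = 0 → z.im = 0)
    (hsimple : ∀ x, p.eval x = 0 → p.derivative.eval x ≠ 0) :
    p = C p.leadingCoeff * ∏ b ∈ p.roots.toFinset, (X - C b) := by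
  have hs : p.Splits := by
    refine Splits.of_splits_map (algebraMap ℝ ℂ) (IsAlgClosed.splits _) fun z hz => ?_
    rw [mem_roots_map hp, ← aeval_def] at hz
    refine ⟨z.re, ?_⟩
    apply Complex.ext <;> simp [hreal z hz]
  have hn : p.roots.Nodup := by
    rw [Multiset.nodup_iff_count_le_one]
    intro x
    rw [count_roots]
    by_contra h
    have := (one_lt_rootMultiplicity_iff_isRoot hp).1 (not_le.1 h)
    exact hsimple x this.1 this.2
  conv_lhs => rw [hs.eq_prod_roots]
  congr 1
  rw [Finset.prod_multiset_map_count]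
  refine Finset.prod_congr rfl fun b hb => ?_
  rw [Multiset.count_eq_one_of_mem hn (Multiset.mem_toFinset.1 hb), pow_one]

/-- The polynomial with the roots `S` and the value `1` at `0`. -/
noncomputable def rootProd (S : Finset ℝ) : ℝ[X] := ∏ b ∈ S, (1 - C b⁻¹ * X)

theorem eval_rootProd (S : Finset ℝ) (z : ℝ) : (rootProd S).eval z = ∏ b ∈ S, (1 - b⁻¹ * z) := by
  simp [rootProd, eval_prod]

theorem eval_zero_rootProd (S : Finset ℝ) : (rootProd S).eval 0 = 1 := by
  simp [eval_rootProd]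

theorem rootProd_ne_zero (S : Finset ℝ) : rootProd S ≠ 0 := fun h => by
  have := eval_zero_rootProd S
  simp [h] at this

theorem eval_rootProd_eq_zero {S : Finset ℝ} (hS : (0 : ℝ) ∉ S) {z : ℝ} :
    (rootProd S).eval z = 0 ↔ z ∈ S := by
  rw [eval_rootProd, Finset.prod_eq_zero_iff]
  constructor
  · rintro ⟨b, hb, h⟩
    have hb0 : b ≠ 0 := fun h => hS (h ▸ hb)
    have : z = b := by field_simp at h; linarith
    rwa [this]
  · intro h
    have hb0 : z ≠ 0 := fun h' => hS (h' ▸ h)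
    exact ⟨z, h, by field_simp; simp⟩

theorem natDegree_rootProd {S : Finset ℝ} (hS : (0 : ℝ) ∉ S) : (rootProd S).natDegree = S.card := by
  have h : ∀ b ∈ S, (1 - C b⁻¹ * X : ℝ[X]).natDegree = 1 := by
    intro b hb
    have hb0 : -b⁻¹ ≠ 0 := neg_ne_zero.2 (inv_ne_zero fun h => hS (h ▸ hb))
    rw [show (1 - C b⁻¹ * X : ℝ[X]) = C (-b⁻¹) * X + C 1 by rw [C_neg, C_1]; ring]
    exact natDegree_linear hb0
  rw [rootProd, natDegree_prod _ _ fun b hb h0 => by simpa [h0] using h b hb,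
    Finset.sum_congr rfl h]
  simp

theorem rootProd_eq_mul_erase {S : Finset ℝ} {b : ℝ} (hb : b ∈ S) :
    rootProd S = (1 - C b⁻¹ * X) * rootProd (S.erase b) :=
  (Finset.mul_prod_erase S _ hb).symm

theorem neg_mul_derivative_rootProd {S : Finset ℝ} {b : ℝ} (hb : b ∈ S) (hb0 : b ≠ 0) :
    -b * (rootProd S).derivative.eval b = (rootProd (S.erase b)).eval b := by
  rw [rootProd_eq_mul_erase hb]
  simp [hb0]

theorem prod_X_sub_C_eq {S : Finset ℝ} (hS : (0 : ℝ) ∉ S) :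
    ∏ b ∈ S, (X - C b) = C (∏ b ∈ S, (-b)) * rootProd S := by
  rw [map_prod, rootProd, ← Finset.prod_mul_distrib]
  refine Finset.prod_congr rfl fun b hb => ?_
  have hb0 : b ≠ 0 := fun h => hS (h ▸ hb)
  have : C b * C b⁻¹ = (1 : ℝ[X]) := by rw [← C_mul, mul_inv_cancel₀ hb0, C_1]
  rw [C_neg]
  linear_combination -X * this

end RootProd

/-! ### Product formula for the Wronskian and residues of the Green's function. -/

namespace PeakonPair

open Polynomial

/-- The zeros are simple by `-z W' = B τ`: `τ` is positive, and `B ≠ 0` since the left solution is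
`e^x` to the left of all nodes. The value `1` at `0` fixes the constant factor. -/
theorem wronskian_eq_rootProd {c : PeakonPair} {N : ℕ} {lam : Fin N → ℝ} (h : c.IsSpectrum lam) :
    c.wronskian = rootProd (Finset.univ.image lam) := by
  have h2 := (isSpectrum_iff.1 h).2
  have h3 : ∀ x : ℝ, c.wronskian.eval x = 0 ↔ ∃ i, x = lam i := by
    intro x
    have := h2 x
    rw [show ((x : ℝ) : ℂ) = algebraMap ℝ ℂ x from rfl, aeval_algebraMap_apply] at this
    simpa using this
  have h0 : c.wronskian ≠ 0 := fun h => by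
    have := c.eval_zero_wronskian
    simp [h] at this
  have h4 := eq_C_mul_prod_of_simple_real_roots h0 (fun z hz => by
    obtain ⟨i, rfl⟩ := (h2 z).1 hz
    simp) (fun x hx h => by
      obtain ⟨B, hB⟩ := exists_leftPoly_eq hx
      have h5 := neg_mul_derivative_wronskian hx hB
      rw [h, mul_zero, eq_comm, mul_eq_zero] at h5
      rcases h5 with h5 | h5
      · obtain ⟨m, hm⟩ := exists_le_finset c.pts
        have h6 := hB m
        have h7 : c.pts.filter (· < m) = ∅ := Finset.filter_false_of_mem fun t ht => (hm t ht).not_gt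
        rw [h5, zero_mul, eval_leftPoly_eq, h7] at h6
        simp [(Real.exp_pos m).ne'] at h6
      · exact (tau_pos hx).ne' h5)
  have h5 : c.wronskian.roots.toFinset = Finset.univ.image lam := by
    ext x
    simp only [Multiset.mem_toFinset, mem_roots h0, IsRoot, h3, Finset.mem_image, Finset.mem_univ,
      true_and, eq_comm]
  have hS : (0 : ℝ) ∉ Finset.univ.image lam := by
    rw [← h5, Multiset.mem_toFinset, mem_roots h0, IsRoot, eval_zero_wronskian]
    exact one_ne_zero
  rw [h5, prod_X_sub_C_eq hS, ← mul_assoc, ← C_mul] at h4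
  have h6 := congrArg (eval 0) h4
  rw [eval_zero_wronskian, eval_mul, eval_C, eval_zero_rootProd, mul_one] at h6
  rw [← h6, C_1, one_mul] at h4
  exact h4

theorem zero_notMem_spectrum {c : PeakonPair} {N : ℕ} {lam : Fin N → ℝ} (h : c.IsSpectrum lam) :
    (0 : ℝ) ∉ Finset.univ.image lam := by
  intro h0
  obtain ⟨i, _, hi⟩ := Finset.mem_image.1 h0
  have := ((isSpectrum_iff.1 h).2 ((0 : ℝ) : ℂ)).2 ⟨i, by rw [hi]⟩
  rw [show ((0 : ℝ) : ℂ) = algebraMap ℝ ℂ 0 from rfl, aeval_algebraMap_apply] at this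
  simp [eval_zero_wronskian] at this

theorem isSpectrum_of_wronskian_eq {c : PeakonPair} {N : ℕ} {lam : Fin N → ℝ} (hm : StrictMono lam)
    (h0 : (0 : ℝ) ∉ Finset.univ.image lam) (h : c.wronskian = rootProd (Finset.univ.image lam)) :
    c.IsSpectrum lam := by
  refine isSpectrum_iff.2 ⟨hm, fun z => ?_⟩
  rw [h, rootProd]
  simp only [map_prod, map_sub, map_one, map_mul, aeval_C, aeval_X, Finset.prod_eq_zero_iff,
    Finset.mem_image, Finset.mem_univ, true_and, exists_exists_eq_and]
  refine exists_congr fun i => ?_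
  have : (lam i : ℂ) ≠ 0 := fun h => h0 (Finset.mem_image.2 ⟨i, Finset.mem_univ _, by exact_mod_cast h⟩)
  rw [Complex.coe_algebraMap, Complex.ofReal_inv]
  field_simp
  rw [mul_zero]
  exact ⟨fun h => (sub_eq_zero.1 h).symm, fun h => by rw [h, sub_self]⟩

theorem phi_sq (c : PeakonPair) (z a : ℝ) :
    c.phi z a ^ 2 = Real.exp (-a) * (c.rightPoly a).eval z ^ 2 := by
  rw [phi, coe_aeval_eq_eval, smul_eq_mul, mul_pow, ← Real.exp_nat_mul]
  congr 2
  push_cast; ring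

/-- The proportionality constant of the two solutions occurs both in the product of their values and
in `-b W'(b)`. It cancels, leaving the square of the normalized eigenfunction. -/
theorem eval_mul_refl {c : PeakonPair} {L : Finset ℝ} (hL : (0 : ℝ) ∉ L)
    (hW : c.wronskian = rootProd L) (a : ℝ) {b : ℝ} (hb : b ∈ L) :
    (c.rightPoly a * c.refl.rightPoly (-a)).eval b =
      c.phi b a ^ 2 / c.tau b * (rootProd (L.erase b)).eval b := by
  have hz : c.wronskian.eval b = 0 := by rw [hW, eval_rootProd_eq_zero hL]; exact hb
  obtain ⟨B, hB⟩ := exists_leftPoly_eq hz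
  have h1 := neg_mul_derivative_wronskian hz hB
  rw [hW, neg_mul_derivative_rootProd hb (fun h => hL (h ▸ hb))] at h1
  have h2 := hB a
  rw [leftPoly, eval_mul, eval_C] at h2
  have h3 := tau_pos hz
  rw [h1, phi_sq, eval_mul, Real.exp_neg]
  have := Real.exp_pos a
  field_simp
  linear_combination (eval b (c.rightPoly a)) * h2

end PeakonPair

/-! ### Degrees, partial fractions of the Green's function, and the sign of `α`. -/

namespace PeakonPair

open Polynomial

theorem kap_eq_zero {c : PeakonPair} {t : ℝ} (h : t ∉ c.pts) : c.kap t = 0 := by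
  rw [mem_pts_iff] at h
  push Not at h
  simp [kap, h.1, h.2]

theorem kap_ne_zero {c : PeakonPair} {t : ℝ} (h : t ∈ c.pts) : c.kap t ≠ 0 := by
  intro h0
  rw [kap, mul_eq_zero, C_eq_zero] at h0
  have h1 := h0.resolve_left (Real.exp_pos _).ne'
  have h2 := congrArg (coeff · 1) h1
  have h3 := congrArg (coeff · 2) h1
  simp at h2 h3
  rw [mem_pts_iff] at h
  tauto

theorem one_le_natDegree_kap {c : PeakonPair} {t : ℝ} (h : t ∈ c.pts) :
    1 ≤ (c.kap t).natDegree := by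
  by_contra h0
  have h1 := eq_C_of_natDegree_eq_zero (Nat.lt_one_iff.1 (not_le.1 h0))
  have h2 : (c.kap t).coeff 0 = 0 := by
    rw [coeff_zero_eq_eval_zero]; simp [kap]
  rw [h2, C_0] at h1
  exact kap_ne_zero h h1

theorem rightPoly_gap {c : PeakonPair} {x y : ℝ} (hxy : x ≤ y) (h : ∀ t ∈ c.pts, x < t → y ≤ t) :
    c.rightPoly x = c.rightPoly y + (Real.exp x - Real.exp y) • c.slope x := by
  rw [rightPoly_eq c x, rightPoly_eq c y, slope, add_assoc, Finset.smul_sum]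
  congr 1
  simp only [Finset.sum_filter]
  rw [← Finset.sum_add_distrib]
  refine Finset.sum_congr rfl fun t ht => ?_
  by_cases h1 : x < t
  · rcases (h t ht h1).eq_or_lt with h2 | h2
    · simp [h1, h2]
    · rw [if_pos h1, if_pos h1, if_pos h2, ← add_smul]
      congr 1
      ring
  · rw [if_neg h1, if_neg h1, if_neg fun h' => h1 (hxy.trans_lt h'), add_zero]

theorem slope_gap {c : PeakonPair} {x y : ℝ} (hxy : x < y) (h : ∀ t ∈ c.pts, x < t → y ≤ t) :
    c.slope x = c.kap y * c.rightPoly y + c.slope y := by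
  have h1 : c.pts.filter (x < ·) = c.pts.filter (y ≤ ·) :=
    Finset.filter_congr fun t ht => ⟨h t ht, fun h => hxy.trans_le h⟩
  rw [slope, h1]
  by_cases hy : y ∈ c.pts
  · rw [filter_le_eq_insert hy, Finset.sum_insert (by simp), slope]
  · rw [filter_le_eq_filter_lt hy, kap_eq_zero hy, zero_mul, zero_add, slope]

/-- The degree of `rightPoly x`. -/
noncomputable def degRight (c : PeakonPair) (x : ℝ) : ℕ :=
  ∑ t ∈ c.pts with x < t, (c.kap t).natDegree

theorem degRight_gap {c : PeakonPair} {x y : ℝ} (hxy : x < y) (h : ∀ t ∈ c.pts, x < t → y ≤ t)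
    (hy : y ∈ c.pts) : c.degRight x = (c.kap y).natDegree + c.degRight y := by
  have h1 : c.pts.filter (x < ·) = c.pts.filter (y ≤ ·) :=
    Finset.filter_congr fun t ht => ⟨h t ht, fun h => hxy.trans_le h⟩
  rw [degRight, h1, filter_le_eq_insert hy, Finset.sum_insert (by simp), degRight]

theorem rightPoly_of_right {c : PeakonPair} {x : ℝ} (h : ∀ t ∈ c.pts, t ≤ x) :
    c.rightPoly x = 1 ∧ c.slope x = 0 ∧ c.degRight x = 0 := by
  have h1 : c.pts.filter (x < ·) = ∅ := Finset.filter_false_of_mem fun t ht => (h t ht).not_gt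
  exact ⟨by rw [rightPoly_eq, h1]; simp, by rw [slope, h1]; simp, by rw [degRight, h1]; simp⟩

/-- Moving left across a node `y`, the new top term of the slope comes from `kap y * rightPoly y`,
because `kap y` has positive degree. Across the gap the value acquires `e^x - e^y < 0` times this
term, so `r = 1 / (e^y - e^x)`; to the right of all nodes `r = 0`. -/
theorem rightPoly_leading (c : PeakonPair) (x : ℝ) :
    (c.rightPoly x).natDegree ≤ c.degRight x ∧ (c.slope x).natDegree ≤ c.degRight x ∧
      (c.rightPoly x).coeff (c.degRight x) ≠ 0 ∧ ∃ r : ℝ, 0 ≤ r ∧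
        (c.slope x).coeff (c.degRight x) = -r * (c.rightPoly x).coeff (c.degRight x) := by
  have : ∀ n x, (c.pts.filter (x < ·)).card < n →
    (c.rightPoly x).natDegree ≤ c.degRight x ∧ (c.slope x).natDegree ≤ c.degRight x ∧
      (c.rightPoly x).coeff (c.degRight x) ≠ 0 ∧ ∃ r : ℝ, 0 ≤ r ∧
        (c.slope x).coeff (c.degRight x) = -r * (c.rightPoly x).coeff (c.degRight x) := by
    intro n
    induction n with
    | zero => intro x hx; omega
    | succ n ih =>
      intro x hx
      rcases (c.pts.filter (x < ·)).eq_empty_or_nonempty with he | hne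
      · have h1 := rightPoly_of_right (c := c) (x := x) fun t ht => by
          by_contra h
          have : t ∈ c.pts.filter (x < ·) := Finset.mem_filter.2 ⟨ht, not_le.1 h⟩
          simp [he] at this
        rw [h1.1, h1.2.1, h1.2.2]
        exact ⟨by simp, by simp, by simp, 0, le_rfl, by simp⟩
      · set y := (c.pts.filter (x < ·)).min' hne with hy
        have hym := Finset.mem_filter.1 (Finset.min'_mem _ hne)
        rw [← hy] at hym
        have hmin : ∀ t ∈ c.pts, x < t → y ≤ t := fun t ht h =>
          Finset.min'_le _ _ (Finset.mem_filter.2 ⟨ht, h⟩)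
        have hcard := card_filter_lt_lt c.pts hym.1 hym.2
        obtain ⟨i1, i2, i3, -⟩ := ih y (by omega)
        have hd := degRight_gap hym.2 hmin hym.1
        have hS := slope_gap hym.2 hmin
        have hH := rightPoly_gap hym.2.le hmin
        have hk := one_le_natDegree_kap hym.1
        have hSd : (c.slope x).natDegree ≤ c.degRight x := by
          rw [hS, hd]
          refine natDegree_add_le_of_le (natDegree_mul_le_of_le le_rfl i1) ?_ |>.trans (max_self _).le
          omega
        have hSc : (c.slope x).coeff (c.degRight x) ≠ 0 := by
          rw [hS, coeff_add, coeff_eq_zero_of_natDegree_lt (p := c.slope y) (by omega), add_zero, hd,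
            coeff_mul_add_eq_of_natDegree_le le_rfl i1, coeff_natDegree]
          exact mul_ne_zero (leadingCoeff_ne_zero.2 (kap_ne_zero hym.1)) i3
        have hexp : Real.exp x < Real.exp y := Real.exp_lt_exp.2 hym.2
        have hHc : (c.rightPoly x).coeff (c.degRight x) =
            (Real.exp x - Real.exp y) * (c.slope x).coeff (c.degRight x) := by
          rw [hH, coeff_add, coeff_eq_zero_of_natDegree_lt (p := c.rightPoly y) (by omega),
            zero_add, coeff_smul, smul_eq_mul]
        refine ⟨?_, hSd, ?_, (Real.exp y - Real.exp x)⁻¹, by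
          rw [inv_nonneg]; linarith, ?_⟩
        · rw [hH]
          refine natDegree_add_le_of_le (by omega) ((natDegree_smul_le _ _).trans hSd) |>.trans
            (max_self _).le
        · rw [hHc]
          exact mul_ne_zero (sub_neg.2 hexp).ne hSc
        · rw [hHc]
          have : Real.exp y - Real.exp x ≠ 0 := (sub_pos.2 hexp).ne'
          field_simp
          ring
  exact this _ x (Nat.lt_succ_self _)

theorem natDegree_wronskian (c : PeakonPair) :
    c.wronskian.natDegree = ∑ t ∈ c.pts, (c.kap t).natDegree := by
  obtain ⟨m, hm⟩ := exists_le_finset c.pts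
  have hma : m ∉ c.pts := fun h => lt_irrefl _ (hm m h)
  have h1 := wronskian_eq hma
  have h2 := rightPoly_of_right (c := c.refl) (x := -m) fun t ht => by
    have := hm _ (mem_pts_refl.1 ht); linarith
  rw [h2.1, h2.2.1, mul_zero, mul_one, mul_one, sub_zero] at h1
  obtain ⟨h3, h4, h5, r, hr, h6⟩ := c.rightPoly_leading m
  have h7 : c.degRight m = ∑ t ∈ c.pts, (c.kap t).natDegree := by
    rw [degRight, Finset.filter_true_of_mem hm]
  rw [← h7, h1]
  refine le_antisymm ?_ (le_natDegree_of_ne_zero ?_)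
  · refine (natDegree_sub_le_of_le h3 ((natDegree_C_mul_le _ _).trans h4)).trans (max_self _).le
  · rw [coeff_sub, coeff_C_mul, h6]
    have h8 : 0 < 1 + Real.exp m * r := by have := Real.exp_pos m; positivity
    have : (c.rightPoly m).coeff (c.degRight m) - Real.exp m *
      (-r * (c.rightPoly m).coeff (c.degRight m)) =
        (1 + Real.exp m * r) * (c.rightPoly m).coeff (c.degRight m) := by ring
    rw [this]
    exact mul_ne_zero h8.ne' h5

theorem degRight_refl (c : PeakonPair) (a : ℝ) :
    c.refl.degRight (-a) = ∑ t ∈ c.pts with t < a, (c.kap t).natDegree := by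
  rw [degRight, sum_pts_refl]
  refine Finset.sum_congr rfl fun t _ => ?_
  rw [kap_refl, natDegree_C_mul (Real.exp_pos _).ne']

/-- A node at `a` is counted in neither half, so in that case the product of the two values at `a`
has smaller degree than `W`. -/
theorem degRight_add (c : PeakonPair) (a : ℝ) :
    c.degRight a + c.refl.degRight (-a) + (c.kap a).natDegree = c.wronskian.natDegree := by
  rw [natDegree_wronskian, degRight_refl, degRight]
  by_cases ha : a ∈ c.pts
  · rw [← Finset.add_sum_erase _ _ ha, ← Finset.sum_filter_add_sum_filter_not (c.pts.erase a) (a < ·),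
      add_comm]
    congr 2 <;> refine Finset.sum_congr ?_ fun _ _ => rfl
    · ext t; simp only [Finset.mem_filter, Finset.mem_erase]
      exact ⟨fun h => ⟨⟨h.2.ne', h.1⟩, h.2⟩, fun h => ⟨h.1.2, h.2⟩⟩
    · ext t; simp only [Finset.mem_filter, Finset.mem_erase, not_lt]
      exact ⟨fun h => ⟨⟨h.2.ne, h.1⟩, h.2.le⟩, fun h => ⟨h.1.2, h.2.lt_of_ne h.1.1⟩⟩
  · rw [kap_eq_zero ha, natDegree_zero, add_zero,
      ← Finset.sum_filter_add_sum_filter_not c.pts (a < ·)]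
    congr 1
    refine Finset.sum_congr ?_ fun _ _ => rfl
    ext t; simp only [Finset.mem_filter, not_lt]
    exact ⟨fun h => ⟨h.1, h.2.le⟩, fun h => ⟨h.1, h.2.lt_of_ne fun e => ha (e ▸ h.1)⟩⟩

/-- Both sides have degree at most `L.card` and agree at the points of `L` and at `0`, where both
equal `1`. -/
theorem green_identity {c : PeakonPair} {L : Finset ℝ} (hL : (0 : ℝ) ∉ L)
    (hW : c.wronskian = rootProd L) (a : ℝ) :
    c.rightPoly a * c.refl.rightPoly (-a) =
      C (1 - ∑ b ∈ L, c.phi b a ^ 2 / c.tau b) * rootProd L +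
        ∑ b ∈ L, C (c.phi b a ^ 2 / c.tau b) * rootProd (L.erase b) := by
  have hd := c.degRight_add a
  rw [hW, natDegree_rootProd hL] at hd
  have hLe : ∀ b, (0 : ℝ) ∉ L.erase b := fun b h => hL (Finset.mem_of_mem_erase h)
  refine eq_of_natDegree_lt_card_of_eval_eq' _ _ (insert 0 L) ?_ ?_
  · intro z hz
    rcases Finset.mem_insert.1 hz with rfl | hz
    · simp [eval_zero_rightPoly, eval_zero_rootProd, eval_finsetSum]
    · rw [eval_mul_refl hL hW a hz, eval_add, eval_mul, (eval_rootProd_eq_zero hL).2 hz, mul_zero,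
        zero_add, eval_finsetSum, Finset.sum_eq_single z]
      · simp
      · intro b _ hb
        rw [eval_mul, (eval_rootProd_eq_zero (hLe b)).2 (Finset.mem_erase.2 ⟨hb.symm, hz⟩), mul_zero]
      · exact fun h => absurd hz h
  · rw [Finset.card_insert_of_notMem hL, Nat.lt_succ_iff]
    refine max_le ?_ ?_
    · have h1 := (c.rightPoly_leading a).1
      have h2 := (c.refl.rightPoly_leading (-a)).1
      refine natDegree_mul_le.trans ?_
      omega
    · refine (natDegree_add_le_of_le (m := L.card) ((natDegree_C_mul_le _ _).trans
        (natDegree_rootProd hL).le) ?_).trans (max_self _).le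
      refine natDegree_sum_le_of_forall_le _ _ fun b hb => (natDegree_C_mul_le _ _).trans ?_
      rw [natDegree_rootProd (hLe b)]
      exact Finset.card_erase_le

/-- `α` is the ratio of the coefficients of degree `L.card` of `P Q` and `W`. If `a` is a node it
vanishes by the degree count; otherwise it equals `1 / (1 + e^{-a} s + e^a r)` with `r, s ≥ 0` from
`rightPoly_leading`. -/
theorem one_sub_sum_nonneg {c : PeakonPair} {L : Finset ℝ} (hL : (0 : ℝ) ∉ L)
    (hW : c.wronskian = rootProd L) (a : ℝ) : 0 ≤ 1 - ∑ b ∈ L, c.phi b a ^ 2 / c.tau b := by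
  set α := 1 - ∑ b ∈ L, c.phi b a ^ 2 / c.tau b with hα
  have hd := c.degRight_add a
  rw [hW, natDegree_rootProd hL] at hd
  have hLe : ∀ b, (0 : ℝ) ∉ L.erase b := fun b h => hL (Finset.mem_of_mem_erase h)
  obtain ⟨p1, p2, p3, r, hr, p4⟩ := c.rightPoly_leading a
  obtain ⟨q1, q2, q3, s, hs, q4⟩ := c.refl.rightPoly_leading (-a)
  have h1 := congrArg (coeff · L.card) (green_identity hL hW a)
  simp only [coeff_add, finsetSum_coeff, coeff_C_mul] at h1
  have h0 : ∑ b ∈ L, c.phi b a ^ 2 / c.tau b * (rootProd (L.erase b)).coeff L.card = 0 := by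
    refine Finset.sum_eq_zero fun b hb => ?_
    rw [coeff_eq_zero_of_natDegree_lt, mul_zero]
    rw [natDegree_rootProd (hLe b)]
    exact Finset.card_erase_lt_of_mem hb
  rw [h0, add_zero, ← hα] at h1
  have h2 : (rootProd L).coeff L.card ≠ 0 := by
    rw [← natDegree_rootProd hL, coeff_natDegree, leadingCoeff_ne_zero]
    exact rootProd_ne_zero L
  by_cases ha : a ∈ c.pts
  · have hk := one_le_natDegree_kap ha
    rw [coeff_eq_zero_of_natDegree_lt] at h1
    · rcases mul_eq_zero.1 h1.symm with h | h
      · exact h.ge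
      · exact absurd h h2
    · refine natDegree_mul_le.trans_lt ?_
      omega
  · have hdd : L.card = c.degRight a + c.refl.degRight (-a) := by
      rw [kap_eq_zero ha, natDegree_zero] at hd; omega
    have h3 := congrArg (coeff · L.card) (wronskian_eq ha)
    simp only [hW, coeff_sub, mul_assoc, coeff_C_mul] at h3
    rw [hdd] at h1 h2 h3
    rw [coeff_mul_add_eq_of_natDegree_le p1 q1] at h1
    rw [coeff_mul_add_eq_of_natDegree_le p1 q1, coeff_mul_add_eq_of_natDegree_le p1 q2,
      coeff_mul_add_eq_of_natDegree_le p2 q1, p4, q4] at h3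
    set η := (c.rightPoly a).coeff (c.degRight a)
    set η' := (c.refl.rightPoly (-a)).coeff (c.refl.degRight (-a))
    have h4 : 0 < 1 + Real.exp (-a) * s + Real.exp a * r := by
      have := Real.exp_pos a
      have := Real.exp_pos (-a)
      positivity
    have h5 : α * (1 + Real.exp (-a) * s + Real.exp a * r) = 1 := by
      have h6 : η * η' ≠ 0 := mul_ne_zero p3 q3
      have h7 : α * (1 + Real.exp (-a) * s + Real.exp a * r) * (η * η') = 1 * (η * η') := by
        linear_combination -α * h3 - h1
      exact mul_right_cancel₀ h6 h7
    by_contra h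
    nlinarith

end PeakonPair

/-! ### Rational Nevanlinna functions as quotients of polynomials. -/

section Nevanlinna

open Polynomial

/-- The monic polynomial with the simple roots `A`. -/
noncomputable def nodPoly (A : Finset ℝ) : ℝ[X] := ∏ a ∈ A, (X - C a)

/-- The numerator over `nodPoly A` of the Nevanlinna function `l z + c - ∑ ρ a / (z - a)`. -/
noncomputable def nevNum (l c : ℝ) (A : Finset ℝ) (ρ : ℝ → ℝ) : ℝ[X] :=
  (C l * X + C c) * nodPoly A - ∑ a ∈ A, C (ρ a) * nodPoly (A.erase a)

theorem monic_nodPoly (A : Finset ℝ) : (nodPoly A).Monic :=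
  monic_prod_of_monic _ _ fun a _ => monic_X_sub_C a

theorem natDegree_nodPoly (A : Finset ℝ) : (nodPoly A).natDegree = A.card := by
  rw [nodPoly, natDegree_prod_of_monic _ _ fun a _ => monic_X_sub_C a]
  simp

theorem eval_nodPoly (A : Finset ℝ) (z : ℝ) : (nodPoly A).eval z = ∏ a ∈ A, (z - a) := by
  simp [nodPoly, eval_prod]

theorem eval_nodPoly_eq_zero {A : Finset ℝ} {z : ℝ} : (nodPoly A).eval z = 0 ↔ z ∈ A := by
  simp [eval_nodPoly, Finset.prod_eq_zero_iff, sub_eq_zero]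

theorem aeval_nodPoly (A : Finset ℝ) (z : ℂ) : aeval z (nodPoly A) = ∏ a ∈ A, (z - a) := by
  simp [nodPoly]

theorem nodPoly_eq_mul_erase {A : Finset ℝ} {a : ℝ} (ha : a ∈ A) :
    nodPoly A = (X - C a) * nodPoly (A.erase a) :=
  (Finset.mul_prod_erase A _ ha).symm

/-- Interpolation in the basis `nodPoly (B.erase b)`. -/
theorem eq_sum_nodPoly_erase {B : Finset ℝ} {r : ℝ[X]} (hr : r.degree < B.card) :
    r = ∑ b ∈ B, C (r.eval b / (nodPoly (B.erase b)).eval b) * nodPoly (B.erase b) := by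
  refine eq_of_degrees_lt_of_eval_finset_eq B hr ?_ fun b hb => ?_
  · refine (degree_sum_le _ _).trans_lt ((Finset.sup_lt_iff (WithBot.bot_lt_coe _)).2 fun b hb => ?_)
    refine degree_le_natDegree.trans_lt (Nat.cast_lt.2 ((natDegree_C_mul_le _ _).trans_lt ?_))
    rw [natDegree_nodPoly]
    exact Finset.card_erase_lt_of_mem hb
  · rw [eval_finsetSum, Finset.sum_eq_single b]
    · have : (nodPoly (B.erase b)).eval b ≠ 0 := by simp [eval_nodPoly_eq_zero]
      rw [eval_mul, eval_C, div_mul_cancel₀ _ this]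
    · intro b' _ hb'
      rw [eval_mul, eval_nodPoly_eq_zero.2 (Finset.mem_erase.2 ⟨hb'.symm, hb⟩), mul_zero]
    · exact fun h => absurd hb h

variable {l c : ℝ} {A : Finset ℝ} {ρ : ℝ → ℝ}

theorem eval_nevNum {z : ℝ} (hz : z ∉ A) : (nevNum l c A ρ).eval z =
    (nodPoly A).eval z * (l * z + c - ∑ a ∈ A, ρ a / (z - a)) := by
  rw [nevNum, eval_sub, eval_finsetSum, mul_sub, Finset.mul_sum]
  congr 1
  · simp; ring
  · refine Finset.sum_congr rfl fun a ha => ?_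
    have : z - a ≠ 0 := sub_ne_zero.2 fun h => hz (h ▸ ha)
    rw [nodPoly_eq_mul_erase ha]
    simp
    field_simp

theorem eval_nevNum_of_mem {a : ℝ} (ha : a ∈ A) : (nevNum l c A ρ).eval a =
    -ρ a * (nodPoly (A.erase a)).eval a := by
  rw [nevNum, eval_sub, eval_finsetSum, eval_mul, eval_nodPoly_eq_zero.2 ha, mul_zero, zero_sub,
    Finset.sum_eq_single a]
  · simp
  · intro b _ hb
    rw [eval_mul, eval_nodPoly_eq_zero.2 (Finset.mem_erase.2 ⟨hb.symm, ha⟩), mul_zero]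
  · exact fun h => absurd ha h

theorem nevNum_root_notMem (hρ : ∀ a ∈ A, 0 < ρ a) {z : ℝ} (hz : (nevNum l c A ρ).eval z = 0) :
    z ∉ A := by
  intro h
  rw [eval_nevNum_of_mem h, mul_eq_zero, neg_eq_zero, eval_nodPoly_eq_zero] at hz
  rcases hz with hz | hz
  · exact (hρ z h).ne' hz
  · simp at hz

theorem aeval_nevNum {z : ℂ} (hz : z.im ≠ 0) : aeval z (nevNum l c A ρ) =
    aeval z (nodPoly A) * (l * z + c - ∑ a ∈ A, (ρ a : ℂ) / (z - a)) := by
  rw [nevNum, map_sub, map_sum, mul_sub, Finset.mul_sum]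
  congr 1
  · simp; ring
  · refine Finset.sum_congr rfl fun a ha => ?_
    have : z - a ≠ 0 := fun h => hz (by rw [sub_eq_zero.1 h, Complex.ofReal_im])
    rw [nodPoly_eq_mul_erase ha]
    simp
    field_simp

/-- The imaginary part of the function at `z` is `Im z` times `l + ∑ ρ a / |z - a|²`. At a nonreal
root this sum vanishes, so the function is constant, and then identically zero. -/
theorem nevNum_root_real (hl : 0 ≤ l) (hρ : ∀ a ∈ A, 0 < ρ a) (h0 : nevNum l c A ρ ≠ 0) {z : ℂ}
    (hz : aeval z (nevNum l c A ρ) = 0) : z.im = 0 := by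
  by_contra hi
  rw [aeval_nevNum hi, mul_eq_zero] at hz
  have h1 : aeval z (nodPoly A) ≠ 0 := by
    rw [aeval_nodPoly, Finset.prod_ne_zero_iff]
    exact fun a _ h => hi (by rw [sub_eq_zero.1 h, Complex.ofReal_im])
  have h2 := hz.resolve_left h1
  have h3 : (l * z + c - ∑ a ∈ A, (ρ a : ℂ) / (z - a)).im =
      z.im * (l + ∑ a ∈ A, ρ a / Complex.normSq (z - a)) := by
    rw [Complex.sub_im, Complex.im_sum, mul_add, Finset.mul_sum, sub_eq_add_neg,
      ← Finset.sum_neg_distrib]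
    congr 1
    · simp; ring
    · refine Finset.sum_congr rfl fun a _ => ?_
      rw [Complex.div_im]
      simp
      ring
  rw [h2, Complex.zero_im, eq_comm, mul_eq_zero] at h3
  have h4 := h3.resolve_left hi
  have h5 : ∀ a ∈ A, 0 < ρ a / Complex.normSq (z - a) := fun a ha =>
    div_pos (hρ a ha) (Complex.normSq_pos.2 fun h => hi (by rw [sub_eq_zero.1 h, Complex.ofReal_im]))
  have h6 : 0 ≤ ∑ a ∈ A, ρ a / Complex.normSq (z - a) := Finset.sum_nonneg fun a ha => (h5 a ha).le
  have h7 : l = 0 := by linarith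
  have h8 : A = ∅ := by
    by_contra hA
    have := Finset.sum_pos h5 (Finset.nonempty_iff_ne_empty.2 hA)
    linarith
  subst h7 h8
  simp at h2
  apply h0
  simp [nevNum, h2]

theorem nevNum_derivative (hρ : ∀ a ∈ A, 0 < ρ a) {x : ℝ} (hx : (nevNum l c A ρ).eval x = 0) :
    (nevNum l c A ρ).derivative.eval x =
      (nodPoly A).eval x * (l + ∑ a ∈ A, ρ a / (x - a) ^ 2) := by
  have hxA := nevNum_root_notMem hρ hx
  have h1 : HasDerivAt (fun y => l * y + c - ∑ a ∈ A, ρ a / (y - a))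
      (l + ∑ a ∈ A, ρ a / (x - a) ^ 2) x := by
    have h2 : HasDerivAt (fun y => ∑ a ∈ A, ρ a / (y - a)) (∑ a ∈ A, -(ρ a / (x - a) ^ 2)) x := by
      refine HasDerivAt.fun_sum fun a ha => ?_
      have hxa : x - a ≠ 0 := sub_ne_zero.2 fun h => hxA (h ▸ ha)
      refine ((hasDerivAt_const x (ρ a)).div ((hasDerivAt_id x).sub_const a) hxa).congr_deriv ?_
      simp
      ring
    refine ((((hasDerivAt_id x).const_mul l).add_const c).sub h2).congr_deriv ?_
    simp
  have h3 : (fun y => (nevNum l c A ρ).eval y) =ᶠ[𝓝 x]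
      fun y => (nodPoly A).eval y * (l * y + c - ∑ a ∈ A, ρ a / (y - a)) := by
    have : (A : Set ℝ)ᶜ ∈ 𝓝 x := A.finite_toSet.isClosed.isOpen_compl.mem_nhds hxA
    filter_upwards [this] with y hy
    exact eval_nevNum hy
  have h4 := (((nodPoly A).hasDerivAt x).mul h1).congr_of_eventuallyEq h3
  have h5 := h4.unique ((nevNum l c A ρ).hasDerivAt x)
  rw [eval_nevNum hxA, mul_eq_zero, eval_nodPoly_eq_zero] at hx
  rw [← h5, hx.resolve_left hxA, mul_zero, zero_add]

theorem nevNum_deriv_pos (hl : 0 ≤ l) (hρ : ∀ a ∈ A, 0 < ρ a) (h0 : nevNum l c A ρ ≠ 0) {x : ℝ}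
    (hx : (nevNum l c A ρ).eval x = 0) : 0 < l + ∑ a ∈ A, ρ a / (x - a) ^ 2 := by
  have hxA := nevNum_root_notMem hρ hx
  have h5 : ∀ a ∈ A, 0 < ρ a / (x - a) ^ 2 := fun a ha =>
    div_pos (hρ a ha) (sq_pos_iff.2 (sub_ne_zero.2 fun h => hxA (h ▸ ha)))
  rcases A.eq_empty_or_nonempty with rfl | hA
  · rcases hl.eq_or_lt with rfl | hl
    · simp [nevNum, nodPoly] at hx
      simp [nevNum, hx] at h0
    · simpa using hl
  · have := Finset.sum_pos h5 hA
    linarith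

/-- Two zeros of a Nevanlinna function are separated by a pole. -/
theorem exists_pole_between (hl : 0 ≤ l) (hρ : ∀ a ∈ A, 0 < ρ a) (h0 : nevNum l c A ρ ≠ 0)
    {x y : ℝ} (hxy : x < y) (hx : (nevNum l c A ρ).eval x = 0)
    (hy : (nevNum l c A ρ).eval y = 0) : ∃ a ∈ A, x < a ∧ a < y := by
  by_contra! h
  have hxA := nevNum_root_notMem hρ hx
  have hyA := nevNum_root_notMem hρ hy
  have hpos := nevNum_deriv_pos hl hρ h0 hx
  rw [eval_nevNum hxA, mul_eq_zero, eval_nodPoly_eq_zero] at hx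
  rw [eval_nevNum hyA, mul_eq_zero, eval_nodPoly_eq_zero] at hy
  have hx' := hx.resolve_left hxA
  have hy' := hy.resolve_left hyA
  have hpp : ∀ a ∈ A, 0 < (x - a) * (y - a) := by
    intro a ha
    rcases lt_trichotomy a x with h1 | h1 | h1
    · exact mul_pos (by linarith) (by linarith)
    · exact absurd (h1 ▸ ha) hxA
    · have := (h a ha h1).lt_of_ne fun e => hyA (e ▸ ha)
      exact mul_pos_of_neg_of_neg (by linarith) (by linarith)
  -- The difference quotient of the function between `x` and `y`; it is positive when no pole
  -- separates them.
  have h1 : (y - x) * (l + ∑ a ∈ A, ρ a / ((x - a) * (y - a))) =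
      (l * y + c - ∑ a ∈ A, ρ a / (y - a)) - (l * x + c - ∑ a ∈ A, ρ a / (x - a)) := by
    have : ∑ a ∈ A, ρ a / (x - a) = ∑ a ∈ A, ρ a / (y - a) +
        ∑ a ∈ A, (y - x) * (ρ a / ((x - a) * (y - a))) := by
      rw [← Finset.sum_add_distrib]
      refine Finset.sum_congr rfl fun a ha => ?_
      have h1 : x - a ≠ 0 := sub_ne_zero.2 fun h => hxA (h ▸ ha)
      have h2 : y - a ≠ 0 := sub_ne_zero.2 fun h => hyA (h ▸ ha)
      field_simp
      ring
    rw [this, ← Finset.mul_sum]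
    ring
  rw [hx', hy', sub_zero, mul_eq_zero] at h1
  have h2 := h1.resolve_left (sub_pos.2 hxy).ne'
  have h3 : ∀ a ∈ A, 0 < ρ a / ((x - a) * (y - a)) := fun a ha => div_pos (hρ a ha) (hpp a ha)
  have h4 := Finset.sum_nonneg fun a ha => (h3 a ha).le
  rcases A.eq_empty_or_nonempty with rfl | hA
  · simp at h2 hpos
    linarith
  · have := Finset.sum_pos h3 hA
    linarith

theorem natDegree_sum_nodPoly_erase_le :
    (∑ a ∈ A, C (ρ a) * nodPoly (A.erase a)).natDegree ≤ A.card - 1 := by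
  refine natDegree_sum_le_of_forall_le _ _ fun a ha => (natDegree_C_mul_le _ _).trans ?_
  rw [natDegree_nodPoly, Finset.card_erase_of_mem ha]

theorem coeff_sum_nodPoly_erase {n : ℕ} (hn : A.card ≤ n) :
    (∑ a ∈ A, C (ρ a) * nodPoly (A.erase a)).coeff n = 0 := by
  rcases A.eq_empty_or_nonempty with rfl | hA
  · simp
  · refine coeff_eq_zero_of_natDegree_lt (natDegree_sum_nodPoly_erase_le.trans_lt ?_)
    have := hA.card_pos
    omega

theorem coeff_nevNum_succ : (nevNum l c A ρ).coeff (A.card + 1) = l := by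
  rw [nevNum, coeff_sub, coeff_sum_nodPoly_erase (by omega), sub_zero, add_mul, coeff_add, mul_assoc,
    coeff_C_mul, coeff_C_mul, coeff_X_mul, ← natDegree_nodPoly, coeff_natDegree,
    (monic_nodPoly A).leadingCoeff, coeff_eq_zero_of_natDegree_lt (Nat.lt_succ_self _)]
  simp

theorem coeff_nevNum_card : (nevNum 0 c A ρ).coeff A.card = c := by
  rw [nevNum, coeff_sub, coeff_sum_nodPoly_erase le_rfl, C_0, zero_mul, zero_add,
    coeff_C_mul, ← natDegree_nodPoly, coeff_natDegree, (monic_nodPoly A).leadingCoeff]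
  simp

theorem natDegree_nevNum_le : (nevNum 0 c A ρ).natDegree ≤ A.card := by
  rw [nevNum, C_0, zero_mul, zero_add]
  refine (natDegree_sub_le_of_le (m := A.card) ((natDegree_C_mul_le _ _).trans
    (natDegree_nodPoly A).le) ?_).trans (max_self _).le
  exact natDegree_sum_le_of_forall_le _ _ fun a ha => (natDegree_C_mul_le _ _).trans
    ((natDegree_nodPoly _).trans_le Finset.card_erase_le)

theorem natDegree_nevNum_zero_le : (nevNum 0 0 A ρ).natDegree ≤ A.card - 1 := by
  rw [nevNum, C_0, zero_mul, zero_add, zero_mul, zero_sub, natDegree_neg]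
  exact natDegree_sum_nodPoly_erase_le

theorem coeff_nevNum_zero : (nevNum 0 0 A ρ).coeff (A.card - 1) = -∑ a ∈ A, ρ a := by
  rw [nevNum, C_0, zero_mul, zero_add, zero_mul, zero_sub, coeff_neg, finsetSum_coeff]
  congr 1
  refine Finset.sum_congr rfl fun a ha => ?_
  rw [coeff_C_mul, ← Finset.card_erase_of_mem ha, ← natDegree_nodPoly, coeff_natDegree,
    (monic_nodPoly _).leadingCoeff, mul_one]

/-- The negative reciprocal of a nonzero rational Nevanlinna function is one again. -/
theorem nevNum_inverse (hl : 0 ≤ l) (hρ : ∀ a ∈ A, 0 < ρ a) (h0 : nevNum l c A ρ ≠ 0) :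
    ∃ (κ l' c' : ℝ) (B : Finset ℝ) (σ : ℝ → ℝ), κ ≠ 0 ∧ 0 ≤ l' ∧ (∀ b ∈ B, 0 < σ b) ∧
      nevNum l c A ρ = C κ * nodPoly B ∧ -nodPoly A = C κ * nevNum l' c' B σ := by
  have hfac := eq_C_mul_prod_of_simple_real_roots h0 (fun z hz => nevNum_root_real hl hρ h0 hz)
    fun x hx => by
      rw [nevNum_derivative hρ hx]
      refine mul_ne_zero ?_ (nevNum_deriv_pos hl hρ h0 hx).ne'
      rw [Ne, eval_nodPoly_eq_zero]
      exact nevNum_root_notMem hρ hx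
  set κ := (nevNum l c A ρ).leadingCoeff with hκ
  set B := (nevNum l c A ρ).roots.toFinset
  have hκ0 : κ ≠ 0 := leadingCoeff_ne_zero.2 h0
  change nevNum l c A ρ = C κ * nodPoly B at hfac
  have hdeg : (nevNum l c A ρ).natDegree = B.card := by
    rw [hfac, natDegree_C_mul hκ0, natDegree_nodPoly]
  -- With `m` the given function, `g / nodPoly B` is `-1 / m`. Division with remainder separates its
  -- polynomial part `q` from its partial fractions.
  set g : ℝ[X] := C (-κ⁻¹) * nodPoly A with hg
  have hgA : -nodPoly A = C κ * g := by
    rw [hg, ← mul_assoc, ← C_mul, mul_neg, mul_inv_cancel₀ hκ0]; simp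
  have hgd : g.natDegree = A.card := by
    rw [hg, natDegree_C_mul (by simpa using hκ0), natDegree_nodPoly]
  have hBm := monic_nodPoly B
  set q := g /ₘ nodPoly B with hq
  set r := g %ₘ nodPoly B with hr
  have hqr : r + nodPoly B * q = g := modByMonic_add_div g (nodPoly B)
  have hqd : q.natDegree = A.card - B.card := by
    rw [hq, natDegree_divByMonic _ hBm, hgd, natDegree_nodPoly]
  have hrd : r.degree < B.card := by
    rw [← natDegree_nodPoly, ← degree_eq_natDegree hBm.ne_zero]
    exact degree_modByMonic_lt _ hBm
  -- `q` has degree `1` only if `m` vanishes at infinity, that is `l = c = 0`. Then `κ = -∑ ρ < 0`,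
  -- and the leading coefficient `-1 / κ` is positive.
  have hq1 : A.card - B.card ≤ 1 ∧ 0 ≤ q.coeff 1 := by
    by_cases hlc : l = 0 ∧ c = 0
    · obtain ⟨rfl, rfl⟩ := hlc
      have hA : A.Nonempty := by
        rw [Finset.nonempty_iff_ne_empty]
        rintro rfl
        simp [nevNum] at h0
      have hs := Finset.sum_pos hρ hA
      have hc := coeff_nevNum_zero (A := A) (ρ := ρ)
      have hBA : B.card = A.card - 1 := by
        rw [← hdeg]
        exact le_antisymm natDegree_nevNum_zero_le (le_natDegree_of_ne_zero (by rw [hc]; linarith))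
      have hκn : κ < 0 := by
        rw [hκ, leadingCoeff, hdeg, hBA, hc]; linarith
      have hAc := hA.card_pos
      refine ⟨by omega, ?_⟩
      have h1 : q.natDegree = 1 := by omega
      have h2 : q.leadingCoeff = g.leadingCoeff :=
        leadingCoeff_divByMonic_of_monic hBm (by
          rw [degree_eq_natDegree hBm.ne_zero, degree_eq_natDegree, hgd, natDegree_nodPoly]
          · exact_mod_cast (by omega : B.card ≤ A.card)
          · rintro h; rw [h] at hgd; simp at hgd; omega)
      rw [leadingCoeff, h1] at h2
      rw [h2, hg, leadingCoeff_mul, (monic_nodPoly A).leadingCoeff, leadingCoeff_C, mul_one]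
      exact (neg_pos.2 (inv_neg''.2 hκn)).le
    · have : A.card ≤ B.card := by
        rw [← hdeg]
        by_cases h : l = 0
        · subst h
          refine le_natDegree_of_ne_zero ?_
          rw [coeff_nevNum_card]
          tauto
        · refine (Nat.le_succ _).trans (le_natDegree_of_ne_zero ?_)
          rw [Nat.succ_eq_add_one, coeff_nevNum_succ]
          exact h
      refine ⟨by omega, ?_⟩
      rw [coeff_eq_zero_of_natDegree_lt (by omega)]
  have hqe : q = C (q.coeff 1) * X + C (q.coeff 0) :=
    eq_X_add_C_of_natDegree_le_one (by omega)
  set σ : ℝ → ℝ := fun b => -(r.eval b / (nodPoly (B.erase b)).eval b) with hσ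
  refine ⟨κ, q.coeff 1, q.coeff 0, B, σ, hκ0, hq1.2, fun b hb => ?_, hfac, ?_⟩
  · have hb0 : (nevNum l c A ρ).eval b = 0 := by
      rw [hfac, eval_mul, eval_nodPoly_eq_zero.2 hb, mul_zero]
    have hpos := nevNum_deriv_pos hl hρ h0 hb0
    have hd := nevNum_derivative hρ hb0
    have hrb : r.eval b = -κ⁻¹ * (nodPoly A).eval b := by
      have := congrArg (eval b) hqr
      rw [eval_add, eval_mul, eval_nodPoly_eq_zero.2 hb, zero_mul, add_zero, hg, eval_mul,
        eval_C] at this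
      exact this
    rw [hfac, nodPoly_eq_mul_erase hb] at hd
    simp only [derivative_mul, derivative_C, derivative_sub, derivative_X, eval_add, eval_mul,
      eval_C, eval_sub, eval_X, sub_self, zero_mul, add_zero, zero_add, sub_zero,
      one_mul] at hd
    have hAb : (nodPoly A).eval b ≠ 0 := by
      rw [Ne, eval_nodPoly_eq_zero]
      exact nevNum_root_notMem hρ hb0
    have hBb : (nodPoly (B.erase b)).eval b ≠ 0 := by simp [eval_nodPoly_eq_zero]
    -- The residue of `-1 / m` at a zero `b` is `-1 / m'(b)`, and `m'(b) > 0`.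
    have : σ b = (l + ∑ a ∈ A, ρ a / (b - a) ^ 2)⁻¹ := by
      rw [hσ]
      simp only [hrb]
      rw [neg_mul, neg_div, neg_neg, ← div_eq_inv_mul, div_div, hd]
      field_simp
    rw [this]
    exact inv_pos.2 hpos
  · rw [hgA, nevNum, ← hqe, ← hqr]
    congr 1
    conv_lhs => rw [eq_sum_nodPoly_erase hrd]
    simp only [hσ, map_neg, neg_mul, Finset.sum_neg_distrib]
    ring

theorem nevNum_eq_add (l c : ℝ) (A : Finset ℝ) (ρ : ℝ → ℝ) :
    nevNum l c A ρ = C l * X * nodPoly A + nevNum 0 c A ρ := by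
  simp only [nevNum, C_0]; ring

theorem nevNum_eq_add' (l c : ℝ) (A : Finset ℝ) (ρ : ℝ → ℝ) :
    nevNum l c A ρ = (C l * X + C c) * nodPoly A + nevNum 0 0 A ρ := by
  simp only [nevNum, C_0]; ring

theorem natDegree_nevNum_le_succ : (nevNum l c A ρ).natDegree ≤ A.card + 1 := by
  rw [nevNum_eq_add]
  refine (natDegree_add_le_of_le (m := A.card + 1) ?_
    (natDegree_nevNum_le.trans (Nat.le_succ _))).trans (max_self _).le
  refine natDegree_mul_le.trans ?_
  rw [natDegree_nodPoly, add_comm]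
  exact Nat.add_le_add_left ((natDegree_C_mul_le l X).trans natDegree_X_le) _

/-- The factor relating `rootProd` to `nodPoly`. -/
noncomputable def rootScale (S : Finset ℝ) : ℝ := (∏ b ∈ S, (-b))⁻¹

theorem rootScale_ne_zero {S : Finset ℝ} (hS : (0 : ℝ) ∉ S) : rootScale S ≠ 0 :=
  inv_ne_zero (Finset.prod_ne_zero_iff.2 fun _ hb => neg_ne_zero.2 fun h => hS (h ▸ hb))

theorem rootScale_mul_nodPoly {S : Finset ℝ} (hS : (0 : ℝ) ∉ S) :
    C (rootScale S) * nodPoly S = rootProd S := by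
  have h : ∏ b ∈ S, (-b) ≠ 0 :=
    Finset.prod_ne_zero_iff.2 fun b hb => neg_ne_zero.2 fun h => hS (h ▸ hb)
  rw [nodPoly, prod_X_sub_C_eq hS, ← mul_assoc, ← C_mul, rootScale, inv_mul_cancel₀ h, C_1, one_mul]

/-- The slope belonging to the function `∑ β b z / (b - z)`. -/
noncomputable def rootSlope (S : Finset ℝ) (β : ℝ → ℝ) : ℝ[X] :=
  X * (C (rootScale S) * nevNum 0 0 S β)

theorem eval_rootSlope {S : Finset ℝ} (hS : (0 : ℝ) ∉ S) {β : ℝ → ℝ} {z : ℝ} (hz : z ∉ S) :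
    (rootSlope S β).eval z = -z * (rootProd S).eval z * ∑ b ∈ S, β b / (z - b) := by
  rw [rootSlope, eval_mul, eval_mul, eval_nevNum hz, ← rootScale_mul_nodPoly hS]
  simp
  ring

theorem eval_rootSlope_of_mem {S : Finset ℝ} (hS : (0 : ℝ) ∉ S) {β : ℝ → ℝ} {b : ℝ} (hb : b ∈ S) :
    (rootSlope S β).eval b = β b * (rootProd (S.erase b)).eval b := by
  have hb0 : b ≠ 0 := fun h => hS (h ▸ hb)
  rw [rootSlope, eval_mul, eval_mul, eval_nevNum_of_mem hb,
    ← rootScale_mul_nodPoly fun h => hS (Finset.mem_of_mem_erase h)]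
  have : rootScale S = (-b)⁻¹ * rootScale (S.erase b) := by
    rw [rootScale, rootScale, ← mul_inv, Finset.mul_prod_erase S _ hb]
  rw [this]
  simp
  field_simp

theorem rootSlope_smul (S : Finset ℝ) (β : ℝ → ℝ) (r : ℝ) :
    rootSlope S (fun b => r * β b) = C r * rootSlope S β := by
  simp only [rootSlope, nevNum, C_0, C_mul]
  simp only [mul_assoc, ← Finset.mul_sum]
  ring

end Nevanlinna

/-! ### The inverse problem on a half-line, and gluing at `a`. -/

namespace PeakonPair

open Polynomial

theorem kap_congr {c c' : PeakonPair} {t : ℝ} (hw : c.w t = c'.w t) (hv : c.v t = c'.v t) :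
    c.kap t = c'.kap t := by rw [kap, kap, hw, hv]

theorem rightPoly_congr {c c' : PeakonPair} {x : ℝ}
    (h : ∀ t, x < t → c.w t = c'.w t ∧ c.v t = c'.v t) :
    c.rightPoly x = c'.rightPoly x ∧ c.slope x = c'.slope x := by
  have hf : ∀ y, x ≤ y → c.pts.filter (y < ·) = c'.pts.filter (y < ·) := by
    intro y hy
    ext t
    simp only [Finset.mem_filter, mem_pts_iff]
    refine and_congr_left fun ht => ?_
    rw [(h t (hy.trans_lt ht)).1, (h t (hy.trans_lt ht)).2]
  have hr : ∀ n y, x ≤ y → (c.pts.filter (y < ·)).card < n → c.rightPoly y = c'.rightPoly y := by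
    intro n
    induction n with
    | zero => intro y _ hy; omega
    | succ n ih =>
      intro y hxy hy
      rw [rightPoly_eq c, rightPoly_eq c', ← hf y hxy]
      refine congrArg (1 + ·) (Finset.sum_congr rfl fun t ht => ?_)
      rw [Finset.mem_filter] at ht
      have := card_filter_lt_lt c.pts ht.1 ht.2
      have hxt := hxy.trans_lt ht.2
      rw [ih t hxt.le (by omega), kap_congr (h t hxt).1 (h t hxt).2]
  refine ⟨hr _ x le_rfl (Nat.lt_succ_self _), ?_⟩
  rw [slope, slope, ← hf x le_rfl]
  refine Finset.sum_congr rfl fun t ht => ?_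
  have hxt := (Finset.mem_filter.1 ht).2
  rw [hr _ t hxt.le (Nat.lt_succ_self _), kap_congr (h t hxt).1 (h t hxt).2]

/-- The sum of two pairs of measures. -/
noncomputable def add (c c' : PeakonPair) : PeakonPair where
  w := c.w + c'.w
  v := c.v + c'.v
  v_nonneg x := add_nonneg (c.v_nonneg x) (c'.v_nonneg x)

/-- A pair of point masses at the same point. -/
noncomputable def single (x w v : ℝ) (hv : 0 ≤ v) : PeakonPair where
  w := Finsupp.single x w
  v := Finsupp.single x v
  v_nonneg y := by
    rw [Finsupp.single_apply]
    split_ifs <;> simp [hv]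

theorem eq_zero_of_notMem_pts {c : PeakonPair} {t : ℝ} (h : t ∉ c.pts) :
    c.w t = 0 ∧ c.v t = 0 := by
  rw [mem_pts_iff] at h
  push Not at h
  exact h

theorem add_apply_of_notMem_right {c c' : PeakonPair} {t : ℝ} (h : t ∉ c'.pts) :
    (c.add c').w t = c.w t ∧ (c.add c').v t = c.v t := by
  simp [add, eq_zero_of_notMem_pts h]

theorem add_apply_of_notMem_left {c c' : PeakonPair} {t : ℝ} (h : t ∉ c.pts) :
    (c.add c').w t = c'.w t ∧ (c.add c').v t = c'.v t := by
  simp [add, eq_zero_of_notMem_pts h]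

theorem mem_pts_of_add {c c' : PeakonPair} {t : ℝ} (h : t ∈ (c.add c').pts) :
    t ∈ c.pts ∨ t ∈ c'.pts := by
  by_contra! h'
  have h1 := add_apply_of_notMem_right (c := c) h'.2
  have h2 := eq_zero_of_notMem_pts h'.1
  rw [mem_pts_iff, h1.1, h1.2, h2.1, h2.2] at h
  simp at h

theorem mem_pts_single {x w v : ℝ} {hv : 0 ≤ v} {t : ℝ} (h : t ∈ (single x w v hv).pts) :
    t = x := by
  rw [mem_pts_iff] at h
  by_contra hne
  simp [single, Ne.symm hne] at h

/-- The inverse problem on a half-line. -/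
theorem exists_pair_half_line (n : ℕ) : ∀ (A : Finset ℝ) (ρ : ℝ → ℝ) (κ x₀ : ℝ), A.card < n →
    (∀ a ∈ A, 0 < ρ a) → (C κ * nodPoly A).eval 0 = 1 →
    ∃ c : PeakonPair, (∀ t ∈ c.pts, x₀ < t) ∧ c.rightPoly x₀ = C κ * nodPoly A ∧
      c.slope x₀ = X * (C κ * nevNum 0 0 A ρ) := by
  induction n with
  | zero => intro A ρ κ x₀ h; omega
  | succ n ih =>
    intro A ρ κ x₀ hn hρ hκ
    rcases A.eq_empty_or_nonempty with rfl | hA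
    · have hz : (⟨0, 0, fun _ => le_rfl⟩ : PeakonPair).pts = ∅ := by simp [pts]
      have h1 := rightPoly_of_right (c := ⟨0, 0, fun _ => le_rfl⟩) (x := x₀) (by simp [hz])
      refine ⟨⟨0, 0, fun _ => le_rfl⟩, by simp [hz], ?_, ?_⟩
      · rw [h1.1]
        simp [nodPoly] at hκ ⊢
        simp [hκ]
      · rw [h1.2.1]
        simp [nevNum]
    have hκ0 : κ ≠ 0 := by rintro rfl; simp at hκ
    have hAc := hA.card_pos
    have hQ0 : nevNum 0 0 A ρ ≠ 0 := by
      obtain ⟨a, ha⟩ := hA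
      intro h
      have h1 := eval_nevNum_of_mem (l := 0) (c := 0) (ρ := ρ) ha
      rw [h, eval_zero, eq_comm, mul_eq_zero, neg_eq_zero, eval_nodPoly_eq_zero] at h1
      rcases h1 with h1 | h1
      · exact (hρ a ha).ne' h1
      · simp at h1
    -- One step of a continued fraction. The ratio of slope to value is `z m` with `m = -∑ ρ a / (z
    -- - a)`, and the linear coefficient `l` of `-1 / m` is the distance to the first node in the
    -- variable `e^x`.
    obtain ⟨κ₁, l, c₁, B, σ, hκ₁, hl, hσ, e1, e2⟩ := nevNum_inverse le_rfl hρ hQ0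
    have hBA : B.card < A.card := by
      have h1 := natDegree_nevNum_zero_le (A := A) (ρ := ρ)
      rw [e1, natDegree_C_mul hκ₁, natDegree_nodPoly] at h1
      omega
    have hl0 : 0 < l := by
      refine hl.lt_of_ne fun h => ?_
      subst h
      have h1 := congrArg natDegree e2
      rw [natDegree_neg, natDegree_nodPoly, natDegree_C_mul hκ₁] at h1
      have h2 := natDegree_nevNum_le (A := B) (c := c₁) (ρ := σ)
      omega
    have eP : C κ * nodPoly A =
        -C (κ * κ₁) * nevNum 0 c₁ B σ - C l * (X * (C κ * nevNum 0 0 A ρ)) := by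
      rw [nevNum_eq_add] at e2
      rw [e1, C_mul]
      linear_combination (-C κ) * e2
    have hR0 : nevNum 0 c₁ B σ ≠ 0 := by
      intro h
      rw [eP, h] at hκ
      simp at hκ
    -- Inverting the remainder of `-1 / m` gives `v z + w` plus the function `m` of the half-line
    -- beyond the first node; `v` and `w` are the masses there up to the factor `e^{x₁}`, which
    -- cancels the factor in `kap`.
    obtain ⟨κ₂, v, w, B', σ', hκ₂, hv, hσ', e3, e4⟩ := nevNum_inverse le_rfl hσ hR0
    have hB' : B'.card ≤ B.card := by
      have h1 := natDegree_nevNum_le (A := B) (c := c₁) (ρ := σ)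
      rwa [e3, natDegree_C_mul hκ₂, natDegree_nodPoly] at h1
    have eP' : C κ * nodPoly A =
        C (-(κ * κ₁ * κ₂)) * nodPoly B' - C l * (X * (C κ * nevNum 0 0 A ρ)) := by
      rw [eP, e3]
      simp only [C_neg, C_mul]
      ring
    have hexp : 0 < Real.exp x₀ + l := by have := Real.exp_pos x₀; linarith
    set x₁ := Real.log (Real.exp x₀ + l) with hx₁
    have hex : Real.exp x₁ = Real.exp x₀ + l := Real.exp_log hexp
    have hx : x₀ < x₁ := by rw [← Real.exp_lt_exp, hex]; linarith
    obtain ⟨c', hc1, hc2, hc3⟩ := ih B' σ' (-(κ * κ₁ * κ₂)) x₁ (by omega) hσ' (by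
      rw [← hκ, eP']; simp)
    have hV : 0 ≤ Real.exp x₁ * v := mul_nonneg (Real.exp_pos _).le hv
    set c := c'.add (single x₁ (Real.exp x₁ * w) (Real.exp x₁ * v) hV) with hc
    have hx₁c : x₁ ∉ c'.pts := fun h => lt_irrefl _ (hc1 _ h)
    have hge : ∀ t ∈ c.pts, x₁ ≤ t := by
      intro t ht
      rcases mem_pts_of_add ht with h | h
      · exact (hc1 t h).le
      · exact (mem_pts_single h).ge
    have hcc := rightPoly_congr (c := c) (c' := c') (x := x₁) fun t ht =>
      add_apply_of_notMem_right fun h => ht.ne' (mem_pts_single h)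
    have hk : c.kap x₁ = X * (C w + C v * X) := by
      have h1 := add_apply_of_notMem_left (c := c')
        (c' := single x₁ (Real.exp x₁ * w) (Real.exp x₁ * v) hV) hx₁c
      have h2 : C (Real.exp x₁) * C (Real.exp x₁)⁻¹ = (1 : ℝ[X]) := by
        rw [← C_mul, mul_inv_cancel₀ (Real.exp_pos x₁).ne', C_1]
      rw [kap, hc, h1.1, h1.2, Real.exp_neg]
      simp only [single, Finsupp.single_eq_same, C_mul]
      linear_combination (X * (C w + C v * X)) * h2
    have hS : c.slope x₀ = X * (C κ * nevNum 0 0 A ρ) := by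
      rw [slope_gap hx fun t ht _ => hge t ht, hcc.1, hcc.2, hc2, hc3, hk, e1]
      rw [nevNum_eq_add'] at e4
      simp only [C_neg, C_mul]
      linear_combination (X * C κ * C κ₁) * e4
    refine ⟨c, fun t ht => hx.trans_le (hge t ht), ?_, hS⟩
    rw [rightPoly_gap hx.le fun t ht _ => hge t ht, hS, hcc.1, hc2, eP', hex, Algebra.smul_def,
      algebraMap_eq]
    simp only [C_add, C_sub]
    ring

/-- The right half and the reflected left half are solved separately and added; each half polynomial
sees only the nodes on its own side. The residues are scaled by `e^{-x}` to absorb the factor in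
front of the slope. -/
theorem exists_pair_glue (a : ℝ) {S S' : Finset ℝ} {β β' : ℝ → ℝ} (hS : (0 : ℝ) ∉ S)
    (hS' : (0 : ℝ) ∉ S') (hβ : ∀ b ∈ S, 0 < β b) (hβ' : ∀ b ∈ S', 0 < β' b) :
    ∃ c : PeakonPair, a ∉ c.pts ∧ c.rightPoly a = rootProd S ∧
      C (Real.exp a) * c.slope a = rootSlope S β ∧ c.refl.rightPoly (-a) = rootProd S' ∧
      C (Real.exp (-a)) * c.refl.slope (-a) = rootSlope S' β' := by
  have key : ∀ (x : ℝ) {S : Finset ℝ} {β : ℝ → ℝ}, (0 : ℝ) ∉ S → (∀ b ∈ S, 0 < β b) →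
      ∃ c : PeakonPair, (∀ t ∈ c.pts, x < t) ∧ c.rightPoly x = rootProd S ∧
        C (Real.exp x) * c.slope x = rootSlope S β := by
    intro x S β hS hβ
    obtain ⟨c, h1, h2, h3⟩ := exists_pair_half_line (S.card + 1) S
      (fun b => Real.exp (-x) * β b) (rootScale S) x (Nat.lt_succ_self _)
      (fun b hb => mul_pos (Real.exp_pos _) (hβ b hb))
      (by rw [rootScale_mul_nodPoly hS, eval_zero_rootProd])
    refine ⟨c, h1, by rw [h2, rootScale_mul_nodPoly hS], ?_⟩
    rw [h3, ← rootSlope, rootSlope_smul, ← mul_assoc, ← C_mul, ← Real.exp_add]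
    simp
  obtain ⟨c, h1, h2, h3⟩ := key a hS hβ
  obtain ⟨c', h1', h2', h3'⟩ := key (-a) hS' hβ'
  have e1 := rightPoly_congr (c := c.add c'.refl) (c' := c) (x := a) fun t ht =>
    add_apply_of_notMem_right fun h => by
      have := h1' _ (mem_pts_refl.1 h); linarith
  have e2 := rightPoly_congr (c := (c.add c'.refl).refl) (c' := c') (x := -a) fun t ht => by
    have : -t ∉ c.pts := fun h => by have := h1 _ h; linarith
    rw [refl_w, refl_v, (add_apply_of_notMem_left this).1, (add_apply_of_notMem_left this).2,
      refl_w, refl_v, neg_neg]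
    exact ⟨rfl, rfl⟩
  refine ⟨c.add c'.refl, fun h => ?_, by rw [e1.1, h2], by rw [e1.2, h3], by rw [e2.1, h2'],
    by rw [e2.2, h3']⟩
  rcases mem_pts_of_add h with h | h
  · exact lt_irrefl _ (h1 _ h)
  · exact lt_irrefl _ (h1' _ (mem_pts_refl.1 h))

end PeakonPair

/-! ### Zeros and reciprocal of the diagonal Green's function. -/

section GreenFunction

open Polynomial

/-- The numerator of the diagonal Green's function with the poles `b ∈ L` and the weights `q b`. -/
noncomputable def greenNum (L : Finset ℝ) (q : ℝ → ℝ) : ℝ[X] :=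
  C (1 - ∑ b ∈ L, q b) * rootProd L + ∑ b ∈ L, C (q b) * rootProd (L.erase b)

/-- The actual poles. -/
noncomputable def poleSet (L : Finset ℝ) (q : ℝ → ℝ) : Finset ℝ := L.filter (q · ≠ 0)

/-- The cancelled poles. -/
noncomputable def nullSet (L : Finset ℝ) (q : ℝ → ℝ) : Finset ℝ := L.filter (q · = 0)

/-- `B` is the set of the zeros of the diagonal Green's function `G`, and `σ b` are the residues of
`-1 / (z G)`. -/
structure GreenZeros (L : Finset ℝ) (q : ℝ → ℝ) (B : Finset ℝ) (σ : ℝ → ℝ) : Prop where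
  zero_notMem : (0 : ℝ) ∉ B
  pos : ∀ b ∈ B, 0 < σ b
  greenNum_eq : greenNum L q = rootProd (nullSet L q) * rootProd B
  eval_eq : ∀ z ∉ insert 0 B, (rootProd L).eval z =
    (greenNum L q).eval z * (1 + z * ∑ b ∈ B, σ b / (z - b))
  separated : ∀ x ∈ insert 0 B, ∀ y ∈ insert 0 B, x < y → ∃ a ∈ poleSet L q, x < a ∧ a < y
  disjoint : ∀ a ∈ poleSet L q, a ∉ insert 0 B
  card_eq : B.card = (poleSet L q).card

theorem eq_of_eval_eq_off_finset {p q : ℝ[X]} (T : Finset ℝ)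
    (h : ∀ z ∉ T, p.eval z = q.eval z) : p = q :=
  eq_of_infinite_eval_eq _ _ ((T.finite_toSet.infinite_compl).mono fun z hz => h z hz)

theorem rootProd_mul_of_disjoint {S T : Finset ℝ} (h : Disjoint S T) :
    rootProd S * rootProd T = rootProd (S ∪ T) :=
  (Finset.prod_union h).symm

theorem rootProd_null_mul_pole (L : Finset ℝ) (q : ℝ → ℝ) :
    rootProd (nullSet L q) * rootProd (poleSet L q) = rootProd L :=
  Finset.prod_filter_mul_prod_filter_not L (q · = 0) _

/-- By `z / (1 - z / b) = -b - b² / (z - b)`, multiplying `G` by `z` makes it a Nevanlinna function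
with linear coefficient `α` and weights `b² q b`. -/
theorem eval_greenNum {L : Finset ℝ} (hL : (0 : ℝ) ∉ L) (q : ℝ → ℝ) {z : ℝ} (hz : z ∉ L) :
    z * (greenNum L q).eval z = (rootProd L).eval z * ((1 - ∑ b ∈ L, q b) * z +
      (-∑ b ∈ poleSet L q, b * q b) - ∑ b ∈ poleSet L q, b ^ 2 * q b / (z - b)) := by
  have h1 : ∀ f : ℝ → ℝ, ∑ b ∈ poleSet L q, f b * q b = ∑ b ∈ L, f b * q b := by
    intro f
    rw [poleSet, Finset.sum_filter_of_ne]
    intro b _ h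
    exact right_ne_zero_of_mul h
  have h2 : ∑ b ∈ poleSet L q, b ^ 2 * q b / (z - b) = ∑ b ∈ L, b ^ 2 * q b / (z - b) := by
    have h := h1 fun b => b ^ 2 / (z - b)
    simp only [div_mul_eq_mul_div] at h
    exact h
  rw [h1 fun b => b, h2, greenNum, eval_add, eval_mul, eval_C, eval_finsetSum, mul_add, mul_sub,
    mul_add, mul_neg, Finset.mul_sum, Finset.mul_sum, Finset.mul_sum]
  have h3 : ∑ b ∈ L, z * (C (q b) * rootProd (L.erase b)).eval z =
      -∑ b ∈ L, (rootProd L).eval z * (b * q b) -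
        ∑ b ∈ L, (rootProd L).eval z * (b ^ 2 * q b / (z - b)) := by
    rw [← Finset.sum_neg_distrib, ← Finset.sum_sub_distrib]
    refine Finset.sum_congr rfl fun b hb => ?_
    have hb0 : b ≠ 0 := fun h => hL (h ▸ hb)
    have hzb : z - b ≠ 0 := sub_ne_zero.2 fun h => hz (h ▸ hb)
    rw [rootProd_eq_mul_erase hb]
    simp
    field_simp
    ring
  rw [h3]
  ring

theorem X_mul_greenNum {L : Finset ℝ} (hL : (0 : ℝ) ∉ L) (q : ℝ → ℝ) : X * greenNum L q =
    C (rootScale (poleSet L q)) * rootProd (nullSet L q) * nevNum (1 - ∑ b ∈ L, q b)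
      (-∑ b ∈ poleSet L q, b * q b) (poleSet L q) fun b => b ^ 2 * q b := by
  refine eq_of_eval_eq_off_finset L fun z hz => ?_
  have hzA : z ∉ poleSet L q := fun h => hz (Finset.mem_of_mem_filter _ h)
  have h0 : (0 : ℝ) ∉ poleSet L q := fun h => hL (Finset.mem_of_mem_filter _ h)
  rw [eval_mul, eval_X, eval_greenNum hL q hz, ← rootProd_null_mul_pole L q,
    ← rootScale_mul_nodPoly h0, eval_mul, eval_mul, eval_mul, eval_mul, eval_nevNum hzA]
  ring

/-- As `α > 0`, `z G` grows linearly and has one zero more than poles, one of them being `0`. Hence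
`-1 / (z G)` vanishes at infinity and has no polynomial part. Its weight at `0` is `1` because `G(0)
= 1`; this produces the summand `1` in `eval_eq`. -/
theorem exists_greenZeros {L : Finset ℝ} (hL : (0 : ℝ) ∉ L) {q : ℝ → ℝ} (hq : ∀ b ∈ L, 0 ≤ q b)
    (hα : 0 < 1 - ∑ b ∈ L, q b) : ∃ B σ, GreenZeros L q B σ := by
  set α := 1 - ∑ b ∈ L, q b with hαdef
  set A := poleSet L q with hA
  set Z := nullSet L q with hZ
  set c := -∑ b ∈ A, b * q b with hc
  set ρ : ℝ → ℝ := fun b => b ^ 2 * q b with hρdef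
  have hAL : ∀ a ∈ A, a ∈ L := fun a h => Finset.mem_of_mem_filter _ h
  have hA0 : (0 : ℝ) ∉ A := fun h => hL (hAL _ h)
  have hρ : ∀ a ∈ A, 0 < ρ a := by
    intro a ha
    have h1 : q a ≠ 0 := (Finset.mem_filter.1 ha).2
    have h2 : a ≠ 0 := fun h => hA0 (h ▸ ha)
    have h3 := (hq a (hAL a ha)).lt_of_ne h1.symm
    positivity
  have hX := X_mul_greenNum hL q
  have h0 : nevNum α c A ρ ≠ 0 := by
    intro h
    have := coeff_nevNum_succ (l := α) (c := c) (A := A) (ρ := ρ)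
    rw [h, coeff_zero] at this
    exact hα.ne this
  obtain ⟨κ, l', c', B₁, σ, hκ, hl', hσ, e1, e2⟩ := nevNum_inverse hα.le hρ h0
  have hroot : ∀ b, b ∈ B₁ ↔ (nevNum α c A ρ).eval b = 0 := by
    intro b
    rw [e1, eval_mul, eval_C, mul_eq_zero, eval_nodPoly_eq_zero]
    tauto
  have hcard : B₁.card = A.card + 1 := by
    have h1 : (nevNum α c A ρ).natDegree = B₁.card := by
      rw [e1, natDegree_C_mul hκ, natDegree_nodPoly]
    have h2 : A.card + 1 ≤ B₁.card := by
      rw [← h1]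
      refine le_natDegree_of_ne_zero ?_
      rw [coeff_nevNum_succ]
      exact hα.ne'
    have h3 : (nevNum α c A ρ).natDegree ≤ A.card + 1 :=
      natDegree_nevNum_le_succ
    omega
  have hl0 : l' = 0 := by
    have h1 := congrArg (coeff · (B₁.card + 1)) e2
    simp only [coeff_neg, coeff_C_mul, coeff_nevNum_succ] at h1
    rw [coeff_eq_zero_of_natDegree_lt (by rw [natDegree_nodPoly]; omega), neg_zero, eq_comm,
      mul_eq_zero] at h1
    exact h1.resolve_left hκ
  subst hl0
  have hc0 : c' = 0 := by
    have h1 := congrArg (coeff · B₁.card) e2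
    simp only [coeff_neg, coeff_C_mul, coeff_nevNum_card] at h1
    rw [coeff_eq_zero_of_natDegree_lt (by rw [natDegree_nodPoly]; omega), neg_zero, eq_comm,
      mul_eq_zero] at h1
    exact h1.resolve_left hκ
  subst hc0
  have h0B : (0 : ℝ) ∈ B₁ := by
    rw [hroot]
    have h1 := congrArg (eval 0) hX
    rw [eval_mul, eval_X, zero_mul, eval_mul, eval_mul, eval_C, eval_zero_rootProd, mul_one,
      eq_comm, mul_eq_zero] at h1
    exact h1.resolve_left (rootScale_ne_zero hA0)
  set B := B₁.erase 0 with hB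
  have hBi : insert 0 B = B₁ := Finset.insert_erase h0B
  have hB0 : (0 : ℝ) ∉ B := Finset.notMem_erase _ _
  have hnod : nodPoly B₁ = X * nodPoly B := by
    rw [nodPoly_eq_mul_erase h0B, C_0, sub_zero]
  have hG : greenNum L q = C (rootScale A * κ) * rootProd Z * nodPoly B := by
    refine mul_left_cancel₀ X_ne_zero ?_
    rw [hX, e1, hnod, C_mul]
    ring
  have hG0 : (greenNum L q).eval 0 = 1 := by
    simp [greenNum, eval_zero_rootProd, eval_finsetSum]
  have hone : rootScale A * κ * (nodPoly B).eval 0 = 1 := by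
    have h1 := congrArg (eval 0) hG
    rw [hG0, eval_mul, eval_mul, eval_C, eval_zero_rootProd, mul_one] at h1
    exact h1.symm
  have hσ0 : σ 0 = 1 := by
    have h1 := congrArg (eval 0) e2
    rw [eval_neg, eval_mul, eval_C, eval_nevNum_of_mem h0B] at h1
    have h2 := congrArg (eval 0) (rootScale_mul_nodPoly hA0)
    rw [eval_mul, eval_C, eval_zero_rootProd] at h2
    linear_combination (-σ 0) * hone + rootScale A * h1 + h2
  refine ⟨B, σ, hB0, fun b hb => hσ b (Finset.mem_of_mem_erase hb), ?_, ?_, ?_, ?_, ?_⟩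
  · rw [hG, ← rootScale_mul_nodPoly hB0]
    have : rootScale A * κ = rootScale B := by
      have h2 := congrArg (eval 0) (rootScale_mul_nodPoly hB0)
      rw [eval_mul, eval_C, eval_zero_rootProd] at h2
      have h3 : (nodPoly B).eval 0 ≠ 0 := by rwa [Ne, eval_nodPoly_eq_zero]
      exact mul_right_cancel₀ h3 (hone.trans h2.symm)
    rw [this]
    ring
  · intro z hz
    rw [hBi] at hz
    have hz0 : z ≠ 0 := fun h => hz (h ▸ h0B)
    have h1 := congrArg (eval z) e2
    rw [eval_neg, eval_mul, eval_C, eval_nevNum hz, hnod, ← Finset.add_sum_erase _ _ h0B, hσ0,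
      eval_mul, eval_X, sub_zero] at h1
    rw [hG, ← rootProd_null_mul_pole L q, ← rootScale_mul_nodPoly hA0]
    simp only [eval_mul, eval_C]
    have h2 : (nodPoly A).eval z = κ * (nodPoly B).eval z * (1 + z * ∑ b ∈ B, σ b / (z - b)) := by
      have h3 : z * (1 / z) = 1 := by field_simp
      linear_combination -h1 + κ * (nodPoly B).eval z * h3
    rw [h2]
    ring
  · intro x hx y hy hxy
    rw [hBi, hroot] at hx hy
    exact exists_pole_between hα.le hρ h0 hxy hx hy
  · intro a ha h
    rw [hBi, hroot] at h
    exact nevNum_root_notMem hρ h ha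
  · rw [hB, Finset.card_erase_of_mem h0B, hcard, Nat.add_sub_cancel]

end GreenFunction

/-! ### Which zeros belong to `φ_+`: signs at the poles and free zeros. -/

section RootSets

open Polynomial

theorem rootProd_simple {T : Finset ℝ} (hT : (0 : ℝ) ∉ T) {x : ℝ} (hx : x ∈ T) :
    (rootProd T).derivative.eval x ≠ 0 := by
  intro h
  have h1 := neg_mul_derivative_rootProd hx fun h => hT (h ▸ hx)
  rw [h, mul_zero, eq_comm, eval_rootProd_eq_zero fun h => hT (Finset.mem_of_mem_erase h)] at h1
  simp at h1

theorem exists_rootProd_of_mul {T : Finset ℝ} (hT : (0 : ℝ) ∉ T) {p r : ℝ[X]}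
    (h : p * r = rootProd T) (hp : p.eval 0 = 1) : ∃ S ⊆ T, p = rootProd S := by
  have hp0 : p ≠ 0 := by rintro rfl; simp at hp
  have hroot : ∀ x, p.eval x = 0 → x ∈ T := fun x hx => by
    rw [← eval_rootProd_eq_zero hT, ← h, eval_mul, hx, zero_mul]
  have h1 := eq_C_mul_prod_of_simple_real_roots hp0 (fun z hz => by
    have h2 : aeval z (rootProd T) = 0 := by rw [← h, map_mul, hz, zero_mul]
    simp only [rootProd, map_prod, map_sub, map_one, map_mul, aeval_C, aeval_X,
      Finset.prod_eq_zero_iff, Complex.coe_algebraMap] at h2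
    obtain ⟨b, hb, h3⟩ := h2
    have hb0 : (b : ℂ) ≠ 0 := by
      intro h; exact hT (by rwa [Complex.ofReal_eq_zero.1 h] at hb)
    have h4 : z = b := by
      rw [Complex.ofReal_inv] at h3
      field_simp at h3
      rw [mul_zero] at h3
      exact (sub_eq_zero.1 h3).symm
    rw [h4, Complex.ofReal_im]) fun x hx hd => by
      apply rootProd_simple hT (hroot x hx)
      rw [← h, derivative_mul, eval_add, eval_mul, eval_mul, hx, hd]
      simp
  have hS : p.roots.toFinset ⊆ T := fun x hx => by
    rw [Multiset.mem_toFinset, mem_roots hp0] at hx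
    exact hroot x hx
  refine ⟨_, hS, ?_⟩
  rw [prod_X_sub_C_eq fun h => hT (hS h), ← mul_assoc, ← C_mul] at h1
  have h2 := congrArg (eval 0) h1
  rw [hp, eval_mul, eval_C, eval_zero_rootProd, mul_one] at h2
  rw [← h2, C_1, one_mul] at h1
  exact h1

theorem rootProd_dvd {Z : Finset ℝ} (hZ : (0 : ℝ) ∉ Z) {p : ℝ[X]} (hp : p ≠ 0)
    (h : ∀ b ∈ Z, p.eval b = 0) : rootProd Z ∣ p := by
  rw [← rootScale_mul_nodPoly hZ,
    (isUnit_C.2 (IsUnit.mk0 _ (rootScale_ne_zero hZ))).mul_left_dvd]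
  refine (Multiset.prod_X_sub_C_dvd_iff_le_roots hp Z.val).2
    ((Multiset.le_iff_subset Z.nodup).2 fun b hb => ?_)
  exact (mem_roots hp).2 (h b hb)

theorem rootProd_injOn {S T : Finset ℝ} (hS : (0 : ℝ) ∉ S) (hT : (0 : ℝ) ∉ T)
    (h : rootProd S = rootProd T) : S = T := by
  ext x
  rw [← eval_rootProd_eq_zero hS, h, eval_rootProd_eq_zero hT]

/-- Toggling the elements of `E` in `S` changes the sign of `rootProd S` at a point exactly by the
sign of `rootProd E` there, away from the roots. -/
theorem rootProd_symmDiff_mul (S E : Finset ℝ) :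
    rootProd (symmDiff S E) * rootProd S = rootProd (S \ E) ^ 2 * rootProd E := by
  have h1 : rootProd (symmDiff S E) = rootProd (S \ E) * rootProd (E \ S) := by
    rw [rootProd_mul_of_disjoint disjoint_sdiff_sdiff]
    rfl
  have h2 : rootProd S = rootProd (S \ E) * rootProd (S ∩ E) := by
    rw [rootProd_mul_of_disjoint (Finset.disjoint_sdiff_inter _ _), Finset.sdiff_union_inter]
  have h3 : rootProd E = rootProd (E \ S) * rootProd (S ∩ E) := by
    rw [Finset.inter_comm, rootProd_mul_of_disjoint (Finset.disjoint_sdiff_inter _ _),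
      Finset.sdiff_union_inter]
  rw [h1, h3]
  conv_lhs => rw [h2]
  ring

/-- The zeros of the Green's function that do not lie between two poles. -/
noncomputable def freeSet (L : Finset ℝ) (q : ℝ → ℝ) (B : Finset ℝ) : Finset ℝ :=
  (B \ nullSet L q).filter fun μ => (∀ a ∈ poleSet L q, μ < a) ∨ ∀ a ∈ poleSet L q, a < μ

variable {L B : Finset ℝ} {q σ : ℝ → ℝ}

namespace GreenZeros

theorem zero_notMem_of_subset (h : GreenZeros L q B σ) {S : Finset ℝ} (hS : S ⊆ B) :
    (0 : ℝ) ∉ S := fun h0 => h.zero_notMem (hS h0)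

theorem eval_rootProd_ne_zero (h : GreenZeros L q B σ) {S : Finset ℝ} (hS : S ⊆ B) {a : ℝ}
    (ha : a ∈ poleSet L q) : (rootProd S).eval a ≠ 0 := by
  rw [Ne, eval_rootProd_eq_zero (h.zero_notMem_of_subset hS)]
  exact fun h' => h.disjoint a ha (Finset.mem_insert_of_mem (hS h'))

/-- A free zero `e` has all poles on one side. Since poles occur on both sides of `0`, the point `0`
lies on that side too, so each factor `(e - a) / e` is positive. -/
theorem eval_free_pos (hneg : ∃ a ∈ poleSet L q, a < 0)
    (hpos : ∃ a ∈ poleSet L q, 0 < a) {E : Finset ℝ} (hE : E ⊆ freeSet L q B) {a : ℝ}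
    (ha : a ∈ poleSet L q) : 0 < (rootProd E).eval a := by
  rw [eval_rootProd]
  refine Finset.prod_pos fun e he => ?_
  have he' := (Finset.mem_filter.1 (hE he)).2
  rcases he' with h1 | h1
  · obtain ⟨n, hn, hn0⟩ := hneg
    have h2 : e < 0 := (h1 n hn).trans hn0
    have h3 := h1 a ha
    have he0 : e ≠ 0 := by rintro rfl; exact lt_irrefl _ h2
    have : 1 - e⁻¹ * a = (e - a) / e := by field_simp
    rw [this]
    exact div_pos_of_neg_of_neg (by linarith) h2
  · obtain ⟨n, hn, hn0⟩ := hpos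
    have h2 : 0 < e := hn0.trans (h1 n hn)
    have h3 := h1 a ha
    have he0 : e ≠ 0 := by rintro rfl; exact lt_irrefl _ h2
    have : 1 - e⁻¹ * a = (e - a) / e := by field_simp
    rw [this]
    exact div_pos (by linarith) h2

/-- If `μ` in the symmetric difference `E` lay between poles, take the neighbouring poles `x < μ <
y`. By separation no other zero lies between them, so `rootProd E` has opposite signs at `x` and
`y`, although it is positive at every pole. -/
theorem symmDiff_subset_freeSet (h : GreenZeros L q B σ) {S S' : Finset ℝ} (hS : S ⊆ B)
    (hS' : S' ⊆ B) (hZ : nullSet L q ⊆ S) (hZ' : nullSet L q ⊆ S')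
    (hsign : ∀ a ∈ poleSet L q, 0 < (rootProd S).eval a * (rootProd S').eval a) :
    symmDiff S S' ⊆ freeSet L q B := by
  set E := symmDiff S S' with hE
  have hEB : E ⊆ B := by
    intro x hx
    rcases Finset.mem_symmDiff.1 hx with h1 | h1
    · exact hS h1.1
    · exact hS' h1.1
  have hEpos : ∀ a ∈ poleSet L q, 0 < (rootProd E).eval a := by
    intro a ha
    have h1 := congrArg (eval a) (rootProd_symmDiff_mul S E)
    rw [hE, symmDiff_symmDiff_cancel_left, ← hE] at h1
    simp only [eval_mul, eval_pow] at h1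
    have h2 := hsign a ha
    rw [mul_comm, h1] at h2
    exact pos_of_mul_pos_right h2 (sq_nonneg _)
  intro μ hμ
  have hμB := hEB hμ
  have hμ0 : μ ≠ 0 := fun h0 => h.zero_notMem (h0 ▸ hμB)
  refine Finset.mem_filter.2 ⟨Finset.mem_sdiff.2 ⟨hμB, fun hz => ?_⟩, ?_⟩
  · rcases Finset.mem_symmDiff.1 hμ with h1 | h1
    · exact h1.2 (hZ' hz)
    · exact h1.2 (hZ hz)
  by_contra! hcon
  obtain ⟨⟨a₁, ha₁, h1⟩, ⟨a₂, ha₂, h2⟩⟩ := hcon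
  have hne : ∀ a ∈ poleSet L q, a ≠ μ := fun a ha e =>
    h.disjoint a ha (e ▸ Finset.mem_insert_of_mem hμB)
  have hlo : ((poleSet L q).filter (· < μ)).Nonempty :=
    ⟨a₁, Finset.mem_filter.2 ⟨ha₁, h1.lt_of_ne (hne _ ha₁)⟩⟩
  have hhi : ((poleSet L q).filter (μ < ·)).Nonempty :=
    ⟨a₂, Finset.mem_filter.2 ⟨ha₂, h2.lt_of_ne (hne _ ha₂).symm⟩⟩
  set x := ((poleSet L q).filter (· < μ)).max' hlo with hx
  set y := ((poleSet L q).filter (μ < ·)).min' hhi with hy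
  have hxm := Finset.mem_filter.1 (Finset.max'_mem _ hlo)
  have hym := Finset.mem_filter.1 (Finset.min'_mem _ hhi)
  rw [← hx] at hxm
  rw [← hy] at hym
  have hprod : (rootProd E).eval x * (rootProd E).eval y < 0 := by
    rw [eval_rootProd, eval_rootProd, ← Finset.prod_mul_distrib, ← Finset.mul_prod_erase E _ hμ]
    refine mul_neg_of_neg_of_pos ?_ (Finset.prod_pos fun e he => ?_)
    · have : (1 - μ⁻¹ * x) * (1 - μ⁻¹ * y) = (μ - x) * (μ - y) / μ ^ 2 := by field_simp
      rw [this]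
      exact div_neg_of_neg_of_pos (mul_neg_of_pos_of_neg (by linarith [hxm.2]) (by linarith [hym.2]))
        (sq_pos_iff.2 hμ0)
    · have heE := Finset.mem_of_mem_erase he
      have heB := hEB heE
      have he0 : e ≠ 0 := fun h0 => h.zero_notMem (h0 ▸ heB)
      have : (1 - e⁻¹ * x) * (1 - e⁻¹ * y) = (e - x) * (e - y) / e ^ 2 := by field_simp
      rw [this]
      refine div_pos ?_ (sq_pos_iff.2 he0)
      rcases lt_or_gt_of_ne (Finset.ne_of_mem_erase he) with h3 | h3
      · obtain ⟨a, ha, h4, h5⟩ := h.separated e (Finset.mem_insert_of_mem heB) μ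
          (Finset.mem_insert_of_mem hμB) h3
        have h6 : a ≤ x := Finset.le_max' _ _ (Finset.mem_filter.2 ⟨ha, h5⟩)
        exact mul_pos_of_neg_of_neg (by linarith) (by linarith [hym.2])
      · obtain ⟨a, ha, h4, h5⟩ := h.separated μ (Finset.mem_insert_of_mem hμB) e
          (Finset.mem_insert_of_mem heB) h3
        have h6 : y ≤ a := Finset.min'_le _ _ (Finset.mem_filter.2 ⟨ha, h4⟩)
        exact mul_pos (by linarith [hxm.2]) (by linarith)
  exact absurd (mul_pos (hEpos x hxm.1) (hEpos y hym.1)) hprod.not_gt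

/-- The degrees are at most `B.card`, the number of poles, and the normalization at `0` supplies one
further point of agreement. -/
theorem eq_of_eval_eq (h : GreenZeros L q B σ) {S S' : Finset ℝ} (hS : S ⊆ B) (hS' : S' ⊆ B)
    (he : ∀ a ∈ poleSet L q, (rootProd S).eval a = (rootProd S').eval a) : S = S' := by
  have h0 : (0 : ℝ) ∉ poleSet L q := fun h0 => h.disjoint 0 h0 (Finset.mem_insert_self _ _)
  refine rootProd_injOn (h.zero_notMem_of_subset hS) (h.zero_notMem_of_subset hS') ?_
  refine eq_of_natDegree_lt_card_of_eval_eq' _ _ (insert 0 (poleSet L q)) ?_ ?_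
  · intro z hz
    rcases Finset.mem_insert.1 hz with rfl | hz
    · rw [eval_zero_rootProd, eval_zero_rootProd]
    · exact he z hz
  · rw [natDegree_rootProd (h.zero_notMem_of_subset hS),
      natDegree_rootProd (h.zero_notMem_of_subset hS'), Finset.card_insert_of_notMem h0,
      ← h.card_eq, Nat.lt_succ_iff]
    exact max_le (Finset.card_le_card hS) (Finset.card_le_card hS')

/-- Otherwise send each element of `insert 0 B` to the largest pole below it. Separation makes this
map injective, but there is one pole too few. The negative pole excludes `0` as the lowest zero. -/
theorem exists_lowest (h : GreenZeros L q B σ) (hneg : ∃ a ∈ poleSet L q, a < 0) :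
    ∃ μ ∈ B, ∀ a ∈ poleSet L q, μ < a := by
  have key : ∃ μ ∈ insert 0 B, ∀ a ∈ poleSet L q, ¬ a < μ := by
    by_contra! hcon
    have hne : ∀ μ ∈ insert 0 B, ((poleSet L q).filter (· < μ)).Nonempty := fun μ hμ => by
      obtain ⟨a, ha, h1⟩ := hcon μ hμ
      exact ⟨a, Finset.mem_filter.2 ⟨ha, h1⟩⟩
    choose! f hf hf' using fun μ hμ => (⟨_, Finset.max'_mem _ (hne μ hμ), fun a ha =>
      Finset.le_max' _ a ha⟩ : ∃ m ∈ (poleSet L q).filter (· < μ),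
        ∀ a ∈ (poleSet L q).filter (· < μ), a ≤ m)
    obtain ⟨x, hx, y, hy, hxy, hfxy⟩ := Finset.exists_ne_map_eq_of_card_lt_of_maps_to
      (s := insert 0 B) (t := poleSet L q) (f := f)
      (by rw [Finset.card_insert_of_notMem h.zero_notMem, h.card_eq]; omega)
      (fun μ hμ => Finset.mem_of_mem_filter _ (hf μ hμ))
    have aux : ∀ x ∈ insert 0 B, ∀ y ∈ insert 0 B, x < y → f x ≠ f y := by
      intro x hx y hy hxy he
      obtain ⟨a, ha, h1, h2⟩ := h.separated x hx y hy hxy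
      have h3 := hf' y hy a (Finset.mem_filter.2 ⟨ha, h2⟩)
      have h4 := (Finset.mem_filter.1 (hf x hx)).2
      linarith
    rcases lt_or_gt_of_ne hxy with h1 | h1
    · exact aux x hx y hy h1 hfxy
    · exact aux y hy x hx h1 hfxy.symm
  obtain ⟨μ, hμ, h1⟩ := key
  obtain ⟨n, hn, hn0⟩ := hneg
  refine ⟨μ, (Finset.mem_insert.1 hμ).resolve_left ?_, fun a ha => (not_lt.1 (h1 a ha)).lt_of_ne ?_⟩
  · rintro rfl
    exact h1 n hn hn0
  · rintro rfl
    exact h.disjoint _ ha hμ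

theorem exists_highest (h : GreenZeros L q B σ) (hpos : ∃ a ∈ poleSet L q, 0 < a) :
    ∃ μ ∈ B, ∀ a ∈ poleSet L q, a < μ := by
  have key : ∃ μ ∈ insert 0 B, ∀ a ∈ poleSet L q, ¬ μ < a := by
    by_contra! hcon
    have hne : ∀ μ ∈ insert 0 B, ((poleSet L q).filter (μ < ·)).Nonempty := fun μ hμ => by
      obtain ⟨a, ha, h1⟩ := hcon μ hμ
      exact ⟨a, Finset.mem_filter.2 ⟨ha, h1⟩⟩
    choose! f hf hf' using fun μ hμ => (⟨_, Finset.min'_mem _ (hne μ hμ), fun a ha =>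
      Finset.min'_le _ a ha⟩ : ∃ m ∈ (poleSet L q).filter (μ < ·),
        ∀ a ∈ (poleSet L q).filter (μ < ·), m ≤ a)
    obtain ⟨x, hx, y, hy, hxy, hfxy⟩ := Finset.exists_ne_map_eq_of_card_lt_of_maps_to
      (s := insert 0 B) (t := poleSet L q) (f := f)
      (by rw [Finset.card_insert_of_notMem h.zero_notMem, h.card_eq]; omega)
      (fun μ hμ => Finset.mem_of_mem_filter _ (hf μ hμ))
    have aux : ∀ x ∈ insert 0 B, ∀ y ∈ insert 0 B, x < y → f x ≠ f y := by
      intro x hx y hy hxy he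
      obtain ⟨a, ha, h1, h2⟩ := h.separated x hx y hy hxy
      have h3 := hf' x hx a (Finset.mem_filter.2 ⟨ha, h1⟩)
      have h4 := (Finset.mem_filter.1 (hf y hy)).2
      linarith
    rcases lt_or_gt_of_ne hxy with h1 | h1
    · exact aux x hx y hy h1 hfxy
    · exact aux y hy x hx h1 hfxy.symm
  obtain ⟨μ, hμ, h1⟩ := key
  obtain ⟨n, hn, hn0⟩ := hpos
  refine ⟨μ, (Finset.mem_insert.1 hμ).resolve_left ?_, fun a ha => (not_lt.1 (h1 a ha)).lt_of_ne ?_⟩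
  · rintro rfl
    exact h1 n hn hn0
  · rintro rfl
    exact h.disjoint _ ha hμ

theorem lowest_unique (h : GreenZeros L q B σ) {μ ν : ℝ} (hμ : μ ∈ B) (hν : ν ∈ B)
    (h1 : ∀ a ∈ poleSet L q, μ < a) (h2 : ∀ a ∈ poleSet L q, ν < a) : μ = ν := by
  by_contra hne
  rcases lt_or_gt_of_ne hne with h3 | h3
  · obtain ⟨a, ha, _, h4⟩ := h.separated μ (Finset.mem_insert_of_mem hμ) ν
      (Finset.mem_insert_of_mem hν) h3
    exact (h2 a ha).not_gt h4
  · obtain ⟨a, ha, _, h4⟩ := h.separated ν (Finset.mem_insert_of_mem hν) μ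
      (Finset.mem_insert_of_mem hμ) h3
    exact (h1 a ha).not_gt h4

theorem highest_unique (h : GreenZeros L q B σ) {μ ν : ℝ} (hμ : μ ∈ B) (hν : ν ∈ B)
    (h1 : ∀ a ∈ poleSet L q, a < μ) (h2 : ∀ a ∈ poleSet L q, a < ν) : μ = ν := by
  by_contra hne
  rcases lt_or_gt_of_ne hne with h3 | h3
  · obtain ⟨a, ha, h4, _⟩ := h.separated μ (Finset.mem_insert_of_mem hμ) ν
      (Finset.mem_insert_of_mem hν) h3
    exact (h1 a ha).not_gt h4
  · obtain ⟨a, ha, h4, _⟩ := h.separated ν (Finset.mem_insert_of_mem hν) μ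
      (Finset.mem_insert_of_mem hμ) h3
    exact (h2 a ha).not_gt h4

/-- The number of free zeros is determined by the extreme points of `L`. -/
theorem card_freeSet (h : GreenZeros L q B σ) (hZB : nullSet L q ⊆ B)
    (hneg : ∃ a ∈ poleSet L q, a < 0) (hpos : ∃ a ∈ poleSet L q, 0 < a) {m M : ℝ} (hm : m ∈ L)
    (hM : M ∈ L) (hmin : ∀ b ∈ L, m ≤ b) (hmax : ∀ b ∈ L, b ≤ M) [Decidable (q m = 0)]
    [Decidable (q M = 0)] :
    (freeSet L q B).card = (if q m = 0 then 0 else 1) + (if q M = 0 then 0 else 1) := by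
  obtain ⟨μ, hμ, hμ'⟩ := h.exists_lowest hneg
  obtain ⟨ν, hν, hν'⟩ := h.exists_highest hpos
  have hAL : ∀ a ∈ poleSet L q, a ∈ L := fun a ha => Finset.mem_of_mem_filter _ ha
  have hne : μ ≠ ν := by
    rintro rfl
    obtain ⟨n, hn, -⟩ := hneg
    exact (hμ' n hn).not_gt (hν' n hn)
  -- If the smallest element `m` of `L` is cancelled, it is a zero below all poles, hence it is `μ`;
  -- if not, it is a pole and `μ` lies below all of `L`.
  have e1 : μ ∈ nullSet L q ↔ q m = 0 := by
    constructor
    · intro hz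
      by_contra h0
      have h1 := hμ' m (Finset.mem_filter.2 ⟨hm, h0⟩)
      exact (hmin μ (Finset.mem_of_mem_filter _ hz)).not_gt h1
    · intro h0
      have hmz : m ∈ nullSet L q := Finset.mem_filter.2 ⟨hm, h0⟩
      have : μ = m := h.lowest_unique hμ (hZB hmz) hμ' fun a ha =>
        (hmin a (hAL a ha)).lt_of_ne fun e => (Finset.mem_filter.1 ha).2 (e ▸ h0)
      rwa [this]
  have e2 : ν ∈ nullSet L q ↔ q M = 0 := by
    constructor
    · intro hz
      by_contra h0
      have h1 := hν' M (Finset.mem_filter.2 ⟨hM, h0⟩)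
      exact (hmax ν (Finset.mem_of_mem_filter _ hz)).not_gt h1
    · intro h0
      have hmz : M ∈ nullSet L q := Finset.mem_filter.2 ⟨hM, h0⟩
      have : ν = M := h.highest_unique hν (hZB hmz) hν' fun a ha =>
        (hmax a (hAL a ha)).lt_of_ne fun e => (Finset.mem_filter.1 ha).2 (e ▸ h0)
      rwa [this]
  have hfree : freeSet L q B = ({μ, ν} : Finset ℝ).filter (· ∉ nullSet L q) := by
    ext x
    simp only [freeSet, Finset.mem_filter, Finset.mem_sdiff, Finset.mem_insert,
      Finset.mem_singleton]
    constructor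
    · rintro ⟨⟨hx, hxz⟩, h1 | h1⟩
      · exact ⟨Or.inl (h.lowest_unique hx hμ h1 hμ'), hxz⟩
      · exact ⟨Or.inr (h.highest_unique hx hν h1 hν'), hxz⟩
    · rintro ⟨rfl | rfl, hxz⟩
      · exact ⟨⟨hμ, hxz⟩, Or.inl hμ'⟩
      · exact ⟨⟨hν, hxz⟩, Or.inr hν'⟩
  rw [hfree, Finset.card_filter, Finset.sum_pair hne]
  simp only [e1, e2, ite_not]

end GreenZeros

end RootSets

/-! ### Factoring the Green's function and splitting its residues. -/

namespace PeakonPair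

open Polynomial

variable {c : PeakonPair} {L B : Finset ℝ} {q σ : ℝ → ℝ}

theorem rightPoly_ne_zero (c : PeakonPair) (x : ℝ) : c.rightPoly x ≠ 0 := fun h => by
  simpa [h] using c.eval_zero_rightPoly x

theorem rightPoly_mul_refl (hL : (0 : ℝ) ∉ L) (hW : c.wronskian = rootProd L) {a : ℝ}
    (hq : ∀ b ∈ L, q b = c.phi b a ^ 2 / c.tau b) :
    c.rightPoly a * c.refl.rightPoly (-a) = greenNum L q := by
  rw [green_identity hL hW a, greenNum, Finset.sum_congr rfl hq]
  congr 1
  exact Finset.sum_congr rfl fun b hb => by rw [hq b hb]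

/-- At a cancelled pole `φ_+` vanishes at `a`, and so does its multiple `φ_-`. Thus `rootProd
(nullSet L q)` divides both factors; one copy is accounted for in `greenNum_eq`, the other must
divide `rootProd B`. The remaining roots are simple and are distributed over the two factors. -/
theorem exists_rightPoly_eq_rootProd (hL : (0 : ℝ) ∉ L) (hW : c.wronskian = rootProd L) {a : ℝ}
    (hq : ∀ b ∈ L, q b = c.phi b a ^ 2 / c.tau b) (h : GreenZeros L q B σ) :
    nullSet L q ⊆ B ∧ ∃ S, nullSet L q ⊆ S ∧ S ⊆ B ∧ c.rightPoly a = rootProd S := by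
  have hPQ := rightPoly_mul_refl hL hW hq
  rw [h.greenNum_eq] at hPQ
  set Z := nullSet L q with hZ
  have hZL : Z ⊆ L := Finset.filter_subset _ _
  have hZ0 : (0 : ℝ) ∉ Z := fun h => hL (hZL h)
  have hev : ∀ b ∈ L, c.wronskian.eval b = 0 := fun b hb => by
    rw [hW]; exact (eval_rootProd_eq_zero hL).2 hb
  have hP : ∀ b ∈ Z, (c.rightPoly a).eval b = 0 := fun b hb => by
    have h1 := hq b (hZL hb)
    rw [(Finset.mem_filter.1 hb).2, eq_comm, div_eq_zero_iff, phi_sq] at h1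
    have h2 := h1.resolve_right (tau_pos (hev b (hZL hb))).ne'
    simpa [(Real.exp_pos _).ne'] using h2
  have hQ : ∀ b ∈ Z, (c.refl.rightPoly (-a)).eval b = 0 := fun b hb => by
    obtain ⟨K, hK⟩ := exists_leftPoly_eq (hev b (hZL hb))
    have h1 := hK a
    rw [hP b hb, mul_zero, leftPoly, eval_mul, eval_C] at h1
    exact (mul_eq_zero.1 h1).resolve_left (Real.exp_pos _).ne'
  obtain ⟨P, hP'⟩ := rootProd_dvd hZ0 (c.rightPoly_ne_zero a) hP
  obtain ⟨Q, hQ'⟩ := rootProd_dvd hZ0 (c.refl.rightPoly_ne_zero (-a)) hQ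
  have hB : rootProd Z * (P * Q) = rootProd B := by
    refine mul_left_cancel₀ (rootProd_ne_zero Z) ?_
    rw [← hPQ, hP', hQ']
    ring
  have hZB : Z ⊆ B := fun b hb => by
    rw [← eval_rootProd_eq_zero h.zero_notMem, ← hB, eval_mul,
      (eval_rootProd_eq_zero hZ0).2 hb, zero_mul]
  refine ⟨hZB, ?_⟩
  have hBZ : P * Q = rootProd (B \ Z) := by
    refine mul_left_cancel₀ (rootProd_ne_zero Z) ?_
    rw [hB, rootProd_mul_of_disjoint Finset.disjoint_sdiff, Finset.union_sdiff_of_subset hZB]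
  have hP0 : P.eval 0 = 1 := by
    have h1 := c.eval_zero_rightPoly a
    rwa [hP', eval_mul, eval_zero_rootProd, one_mul] at h1
  obtain ⟨T, hT, hPT⟩ := exists_rootProd_of_mul
    (fun h0 => h.zero_notMem (Finset.sdiff_subset h0)) hBZ hP0
  refine ⟨Z ∪ T, Finset.subset_union_left, Finset.union_subset hZB (hT.trans Finset.sdiff_subset),
    ?_⟩
  rw [hP', hPT, rootProd_mul_of_disjoint]
  exact Finset.disjoint_sdiff.mono_right hT

theorem eval_greenNum_of_mem (hL : (0 : ℝ) ∉ L) (q : ℝ → ℝ) {b : ℝ} (hb : b ∈ L) :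
    (greenNum L q).eval b = q b * (rootProd (L.erase b)).eval b := by
  rw [greenNum, eval_add, eval_mul, (eval_rootProd_eq_zero hL).2 hb, mul_zero, zero_add,
    eval_finsetSum, Finset.sum_eq_single_of_mem b hb, eval_mul, eval_C]
  intro d _ hd
  rw [eval_mul, (eval_rootProd_eq_zero fun h => hL (Finset.mem_of_mem_erase h)).2
    (Finset.mem_erase.2 ⟨hd.symm, hb⟩), mul_zero]

/-- The residue `σ b` of `1 / G` must be the sum of the half-line residues. A zero of only one
factor hands its whole residue to that half; at a common zero it is shared in the ratio `θ b : 1 - θ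
b`. The last clause relates this ratio to the norming constant. -/
theorem exists_pair_of_split (a : ℝ) (hL : (0 : ℝ) ∉ L) (h : GreenZeros L q B σ)
    (hZB : nullSet L q ⊆ B) {S : Finset ℝ} (hZS : nullSet L q ⊆ S) (hSB : S ⊆ B) {θ : ℝ → ℝ}
    (hθ : ∀ b ∈ nullSet L q, 0 < θ b ∧ θ b < 1) :
    ∃ c : PeakonPair, c.wronskian = rootProd L ∧ c.rightPoly a = rootProd S ∧
      (∀ b ∈ L, c.phi b a ^ 2 / c.tau b = q b) ∧
      ∀ b ∈ nullSet L q, c.tau b * (1 - θ b) * (rootProd ((nullSet L q ∪ B \ S).erase b)).eval b =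
        θ b * -(Real.exp (-a) * (rootProd (S.erase b)).eval b * (rootProd (L.erase b)).eval b) := by
  set Z := nullSet L q with hZ
  have hZL : Z ⊆ L := Finset.filter_subset _ _
  have hS'B : Z ∪ B \ S ⊆ B := Finset.union_subset hZB Finset.sdiff_subset
  have hS0 := h.zero_notMem_of_subset hSB
  have hS'0 := h.zero_notMem_of_subset hS'B
  obtain ⟨c, hac, hP, hPs, hQ, hQs⟩ := exists_pair_glue a
    (β := fun b => if b ∈ Z then σ b * θ b else σ b)
    (β' := fun b => if b ∈ Z then σ b * (1 - θ b) else σ b) hS0 hS'0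
    (fun b hb => by
      have h1 := h.pos b (hSB hb)
      split_ifs with hbZ
      · exact mul_pos h1 (hθ b hbZ).1
      · exact h1)
    (fun b hb => by
      have h1 := h.pos b (hS'B hb)
      split_ifs with hbZ
      · exact mul_pos h1 (sub_pos.2 (hθ b hbZ).2)
      · exact h1)
  set β : ℝ → ℝ := fun b => if b ∈ Z then σ b * θ b else σ b with hβ
  set β' : ℝ → ℝ := fun b => if b ∈ Z then σ b * (1 - θ b) else σ b with hβ'
  have hPQ : c.rightPoly a * c.refl.rightPoly (-a) = greenNum L q := by
    have e1 : S = Z ∪ S \ Z := (Finset.union_sdiff_of_subset hZS).symm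
    have e2 : B = (S \ Z) ∪ (Z ∪ B \ S) := by
      ext x
      have := @hSB x
      have := @hZS x
      simp only [Finset.mem_union, Finset.mem_sdiff]
      tauto
    rw [hP, hQ, h.greenNum_eq]
    conv_lhs => rw [e1]
    conv_rhs => rw [e2]
    have hd : Disjoint (S \ Z) (Z ∪ B \ S) := by
      rw [Finset.disjoint_left]
      intro x
      simp only [Finset.mem_union, Finset.mem_sdiff]
      tauto
    rw [← rootProd_mul_of_disjoint Finset.disjoint_sdiff, ← rootProd_mul_of_disjoint hd, mul_assoc,
      ← e1]
  have hW : c.wronskian = rootProd L := by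
    refine eq_of_eval_eq_off_finset (insert 0 B) fun z hz => ?_
    have hzS : z ∉ S := fun hx => hz (Finset.mem_insert_of_mem (hSB hx))
    have hzS' : z ∉ Z ∪ B \ S := fun hx => hz (Finset.mem_insert_of_mem (hS'B hx))
    have e3 : c.wronskian = c.rightPoly a * c.refl.rightPoly (-a) -
        c.rightPoly a * (C (Real.exp (-a)) * c.refl.slope (-a)) -
        C (Real.exp a) * c.slope a * c.refl.rightPoly (-a) := by
      rw [wronskian_eq hac]
      ring
    have e4 : ∑ b ∈ B, σ b / (z - b) =
        ∑ b ∈ S, β b / (z - b) + ∑ b ∈ Z ∪ B \ S, β' b / (z - b) := by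
      have e5 : ∀ {T : Finset ℝ}, T ⊆ B → ∀ f : ℝ → ℝ,
          ∑ b ∈ T, f b = ∑ b ∈ B, if b ∈ T then f b else 0 := fun hT f => by
        rw [Finset.sum_ite_mem, Finset.inter_eq_right.2 hT]
      rw [e5 hSB, e5 hS'B, ← Finset.sum_add_distrib]
      refine Finset.sum_congr rfl fun b hb => ?_
      have := @hZS b
      simp only [hβ, hβ', Finset.mem_union, Finset.mem_sdiff]
      by_cases h1 : b ∈ Z
      · have h2 := hZS h1
        simp only [h1, h2, hb, true_or, if_true]
        ring
      · by_cases h2 : b ∈ S <;> simp [h1, h2, hb]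
    rw [e3, hPs, hQs, eval_sub, eval_sub, eval_mul (q := rootSlope _ _), eval_mul (p := rootSlope _ _),
      eval_rootSlope hS0 hzS, eval_rootSlope hS'0 hzS', h.eval_eq z hz, e4, hPQ, ← hPQ, hP, hQ,
      eval_mul]
    ring
  have hev : ∀ b ∈ L, c.wronskian.eval b = 0 := fun b hb => by
    rw [hW]; exact (eval_rootProd_eq_zero hL).2 hb
  have hL' : ∀ b ∈ L, (rootProd (L.erase b)).eval b ≠ 0 := fun b _ => by
    rw [Ne, eval_rootProd_eq_zero fun h => hL (Finset.mem_of_mem_erase h)]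
    simp
  refine ⟨c, hW, hP, fun b hb => ?_, fun b hb => ?_⟩
  · have h1 := eval_mul_refl hL hW a hb
    rw [hPQ, eval_greenNum_of_mem hL q hb] at h1
    exact (mul_right_cancel₀ (hL' b hb) h1).symm
  · have hbS := hZS hb
    have hbS' : b ∈ Z ∪ B \ S := Finset.mem_union_left _ hb
    have hbL := hZL hb
    obtain ⟨K, hK⟩ := exists_leftPoly_eq (hev b hbL)
    have h1 := eval_left_slope hac (hev b hbL) hK
    have h2 := neg_mul_derivative_wronskian (hev b hbL) hK
    have h3 := congrArg (eval b) hPs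
    have h4 := congrArg (eval b) hQs
    rw [eval_rootSlope_of_mem hS0 hbS, eval_mul, eval_C] at h3
    rw [eval_rootSlope_of_mem hS'0 hbS', eval_mul, eval_C] at h4
    rw [hW, neg_mul_derivative_rootProd hbL fun h => hL (h ▸ hbL)] at h2
    rw [hQ, (eval_rootProd_eq_zero hS'0).2 hbS', zero_sub, h4] at h1
    simp only [hβ, hβ', if_pos hb] at h1 h3
    have h5 : Real.exp (-a) * Real.exp a = 1 := by rw [← Real.exp_add]; simp
    have h6 := (h.pos b (hSB hbS)).ne'
    refine mul_left_cancel₀ h6 ?_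
    have h7 : (c.slope a).eval b =
        Real.exp (-a) * (σ b * θ b * (rootProd (S.erase b)).eval b) := by
      rw [← h3, ← mul_assoc, h5, one_mul]
    rw [h7] at h1
    linear_combination (-c.tau b) * h1 + Real.exp (-a) * σ b * θ b *
      (rootProd (S.erase b)).eval b * h2

/-- The right root set and the norming constants at the cancelled poles are arbitrary. -/
theorem exists_pair_of_tau (a : ℝ) (hL : (0 : ℝ) ∉ L) (h : GreenZeros L q B σ)
    (hZB : nullSet L q ⊆ B) {S : Finset ℝ} (hZS : nullSet L q ⊆ S) (hSB : S ⊆ B) {t : ℝ → ℝ}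
    (ht : ∀ b ∈ nullSet L q, 0 < t b) :
    ∃ c : PeakonPair, c.wronskian = rootProd L ∧ c.rightPoly a = rootProd S ∧
      (∀ b ∈ L, c.phi b a ^ 2 / c.tau b = q b) ∧ ∀ b ∈ nullSet L q, c.tau b = t b := by
  have hS'B : nullSet L q ∪ B \ S ⊆ B := Finset.union_subset hZB Finset.sdiff_subset
  have hS'0 := h.zero_notMem_of_subset hS'B
  have hr : ∀ b, (rootProd ((nullSet L q ∪ B \ S).erase b)).eval b ≠ 0 := fun b => by
    rw [Ne, eval_rootProd_eq_zero fun h => hS'0 (Finset.mem_of_mem_erase h)]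
    simp
  set K : ℝ → ℝ := fun b => -(Real.exp (-a) * (rootProd (S.erase b)).eval b *
    (rootProd (L.erase b)).eval b) / (rootProd ((nullSet L q ∪ B \ S).erase b)).eval b with hK
  have key : ∀ {θ : ℝ → ℝ}, (∀ b ∈ nullSet L q, 0 < θ b ∧ θ b < 1) →
      ∃ c : PeakonPair, c.wronskian = rootProd L ∧ c.rightPoly a = rootProd S ∧
      (∀ b ∈ L, c.phi b a ^ 2 / c.tau b = q b) ∧
      ∀ b ∈ nullSet L q, c.tau b * (1 - θ b) = θ b * K b := by
    intro θ hθ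
    obtain ⟨c, h1, h2, h3, h4⟩ := exists_pair_of_split a hL h hZB hZS hSB hθ
    refine ⟨c, h1, h2, h3, fun b hb => ?_⟩
    rw [hK, ← mul_div_assoc, eq_div_iff (hr b)]
    exact h4 b hb
  -- The sign of `K b` need not be computed: the pair with `θ = 1 / 2` has norming constant `K b`,
  -- which is positive.
  have hKpos : ∀ b ∈ nullSet L q, 0 < K b := by
    obtain ⟨c, h1, -, -, h4⟩ := key (θ := fun _ => 1 / 2) fun b _ => by norm_num
    intro b hb
    have h5 : 0 < c.tau b := tau_pos <| by
      rw [h1]; exact (eval_rootProd_eq_zero hL).2 (Finset.mem_of_mem_filter _ hb)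
    have h6 := h4 b hb
    linarith
  -- This `θ` solves `t (1 - θ) = θ K` and lies in `(0, 1)` since `t` and `K` are positive.
  obtain ⟨c, h1, h2, h3, h4⟩ := key (θ := fun b => t b / (t b + K b)) fun b hb => by
    have e1 := ht b hb
    have e2 := hKpos b hb
    exact ⟨by positivity, (div_lt_one (by positivity)).2 (by linarith)⟩
  refine ⟨c, h1, h2, h3, fun b hb => ?_⟩
  have e1 := ht b hb
  have e2 := hKpos b hb
  have h5 := h4 b hb
  have e3 : t b + K b ≠ 0 := by positivity
  rw [one_sub_div e3] at h5
  field_simp at h5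
  refine mul_right_cancel₀ e2.ne' ?_
  linear_combination h5

end PeakonPair

/-! ### The components as open orthants in affine subspaces. -/

/-- The points `(lam, τ)` with `τ i = val i` where `p i ≠ 0` and `τ i` positive elsewhere. -/
def normingSet {N : ℕ} (lam p val : Fin N → ℝ) : Set ((Fin N → ℝ) × (Fin N → ℝ)) :=
  {x | x.1 = lam ∧ ∀ i, (p i ≠ 0 → x.2 i = val i) ∧ (p i = 0 → 0 < x.2 i)}

section NormingSet

variable {N : ℕ} {lam p val : Fin N → ℝ}

theorem isConnected_normingSet : IsConnected (normingSet lam p val) := by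
  refine ⟨⟨(lam, fun i => if p i = 0 then 1 else val i), rfl, fun i => ⟨fun h => if_neg h, fun h => ?_⟩⟩,
    Convex.isPreconnected ?_⟩
  · simp [h]
  · rintro x ⟨hx, hx'⟩ y ⟨hy, hy'⟩ s t hs ht hst
    refine ⟨?_, fun i => ⟨fun h => ?_, fun h => ?_⟩⟩
    · rw [Prod.fst_add, Prod.smul_fst, Prod.smul_fst, hx, hy, ← add_smul, hst, one_smul]
    · simp only [Prod.snd_add, Prod.smul_snd, Pi.add_apply, Pi.smul_apply, (hx' i).1 h, (hy' i).1 h]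
      rw [← add_smul, hst, one_smul]
    · exact (convex_Ioi (0 : ℝ)) ((hx' i).2 h) ((hy' i).2 h) hs ht hst

theorem isOpen_setOf_pos_snd (p : Fin N → ℝ) :
    IsOpen {x : (Fin N → ℝ) × (Fin N → ℝ) | ∀ i, p i = 0 → 0 < x.2 i} := by
  simp only [ofPred_forall]
  refine isOpen_iInter_of_finite fun i => isOpen_iInter_of_finite fun _ => ?_
  exact isOpen_lt continuous_const ((continuous_apply i).comp continuous_snd)

-- The chart is a translation restricted to the open set where the free coordinates are positive.
-- The base point is `0` in these coordinates, so the image lies in the coordinate subspace they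
-- span.
open Classical in
theorem isEmbeddedSubmanifold_normingSet :
    IsEmbeddedSubmanifold {i | p i = 0}.ncard (normingSet lam p val) := by
  intro x hx
  set O := {x : (Fin N → ℝ) × (Fin N → ℝ) | ∀ i, p i = 0 → 0 < x.2 i} with hO
  have hOo : IsOpen O := isOpen_setOf_pos_snd p
  set b : (Fin N → ℝ) × (Fin N → ℝ) := (lam, fun i => if p i = 0 then 0 else val i) with hb
  let f : ({i // p i = 0} → ℝ) →ₗ[ℝ] (Fin N → ℝ) × (Fin N → ℝ) :=
    { toFun := fun u => (0, fun i => if h : p i = 0 then u ⟨i, h⟩ else 0)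
      map_add' := fun u v => by
        ext i
        · simp
        · by_cases h : p i = 0 <;> simp [h]
      map_smul' := fun r u => by
        ext i
        · simp
        · by_cases h : p i = 0 <;> simp [h] }
  have hf : Function.Injective f := fun u v huv => by
    ext ⟨i, hi⟩
    have := congrFun (congrArg Prod.snd huv) i
    simpa [f, hi] using this
  refine ⟨(Homeomorph.subRight b).toOpenPartialHomeomorph.restrOpen O hOo, LinearMap.range f, ?_, ?_,
    ?_, ?_, ?_⟩
  · exact ⟨mem_univ _, fun i hi => (hx.2 i).2 hi⟩
  · exact (contDiff_id.sub contDiff_const).contDiffOn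
  · exact (contDiff_id.add contDiff_const).contDiffOn
  · rw [LinearMap.finrank_range_of_inj hf, Module.finrank_pi, ← Nat.card_eq_fintype_card]
    exact Nat.card_coe_set_eq {i | p i = 0}
  · ext y
    have hsrc : ((Homeomorph.subRight b).toOpenPartialHomeomorph.restrOpen O hOo).source = O := by
      simp
    have htgt : y ∈ ((Homeomorph.subRight b).toOpenPartialHomeomorph.restrOpen O hOo).target ↔
        y + b ∈ O := by
      simp [OpenPartialHomeomorph.restrOpen_toPartialEquiv]
    rw [hsrc, mem_inter_iff, htgt]
    constructor
    · rintro ⟨z, ⟨hz, hz1, hz2⟩, rfl⟩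
      refine ⟨?_, ?_⟩
      · simpa using hz
      · refine ⟨fun i => z.2 i, ?_⟩
        ext i
        · simp [f, hb, hz1]
        · by_cases h : p i = 0
          · simp [f, hb, h]
          · simp [f, hb, h, (hz2 i).1 h]
    · rintro ⟨hy, u, rfl⟩
      refine ⟨f u + b, ⟨hy, ?_, fun i => ⟨fun h => ?_, hy i⟩⟩, ?_⟩
      · simp [f, hb]
      · simp [f, hb, h]
      · simp

theorem disjoint_normingSet_of_ne {val' : Fin N → ℝ} (h : ∃ i, p i ≠ 0 ∧ val i ≠ val' i) :
    Disjoint (normingSet lam p val) {x | ∀ i, p i ≠ 0 → x.2 i = val' i} := by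
  obtain ⟨i, hi, hne⟩ := h
  rw [Set.disjoint_left]
  rintro x ⟨-, hx⟩ hx'
  exact hne (((hx i).1 hi).symm.trans (hx' i hi))

theorem isDisjointUnionOfManifolds_normingSet {ι : Type*} [Finite ι] {m : ℕ} (hm : Nat.card ι = m)
    (v : ι → Fin N → ℝ) (hv : ∀ s t, s ≠ t → ∃ i, p i ≠ 0 ∧ v s i ≠ v t i)
    {F : Set ((Fin N → ℝ) × (Fin N → ℝ))} (hF : F = ⋃ s, normingSet lam p (v s)) :
    IsDisjointUnionOfManifolds m {i | p i = 0}.ncard F := by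
  let e : Fin m ≃ ι := (Finite.equivFinOfCardEq hm).symm
  have hsub : ∀ s, normingSet lam p (v s) ⊆ {x | ∀ i, p i ≠ 0 → x.2 i = v s i} :=
    fun s x hx i => (hx.2 i).1
  refine ⟨fun s => normingSet lam p (v (e s)), ?_, fun s t hst => ?_, fun s =>
    ⟨isConnected_normingSet, isEmbeddedSubmanifold_normingSet,
      -- The open set avoids the other finitely many closed affine subspaces, which contain the
      -- other components.
      ⋂ t, ⋂ _ : t ≠ e s, {x | ∀ i, p i ≠ 0 → x.2 i = v t i}ᶜ, ?_, ?_⟩⟩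
  · rw [hF, ← e.surjective.iUnion_comp]
  · exact (disjoint_normingSet_of_ne (hv _ _ (e.injective.ne hst))).mono_right (hsub _)
  · refine isOpen_iInter_of_finite fun t => isOpen_iInter_of_finite fun _ => ?_
    rw [isOpen_compl_iff]
    simp only [ofPred_forall]
    refine isClosed_iInter fun i => isClosed_iInter fun _ => ?_
    exact isClosed_eq ((continuous_apply i).comp continuous_snd) continuous_const
  · rw [hF]
    ext x
    simp only [mem_inter_iff, mem_iUnion, mem_iInter]
    constructor
    · intro hx
      exact ⟨⟨e s, hx⟩, fun t ht =>
        Set.disjoint_left.1 (disjoint_normingSet_of_ne (hv _ _ ht.symm)) hx⟩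
    · rintro ⟨⟨t, ht⟩, h⟩
      by_cases hts : t = e s
      · exact hts ▸ ht
      · exact absurd (hsub t ht) (h t hts)

theorem infinite_normingSet (h : ∃ i, p i = 0) : (normingSet lam p val).Infinite := by
  obtain ⟨i, hi⟩ := h
  refine Set.infinite_of_injective_forall_mem
    (f := fun n : ℕ => (lam, fun i => if p i = 0 then (n : ℝ) + 1 else val i)) (fun m n hmn => ?_)
    fun n => ⟨rfl, fun i => ⟨fun h => if_neg h, fun h => ?_⟩⟩
  · have := congrFun (congrArg Prod.snd hmn) i
    simpa [hi] using this
  · simp only [h, if_true]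
    positivity

end NormingSet

/-! ### The spectral data with given interior data. -/

namespace PeakonPair

open Polynomial

variable {c : PeakonPair} {N : ℕ} {lam p : Fin N → ℝ} {a : ℝ} {B : Finset ℝ} {q σ : ℝ → ℝ}

theorem phi_real (c : PeakonPair) (z a : ℝ) :
    c.phi z a = Real.exp (-a / 2) * (c.rightPoly a).eval z := by
  rw [phi, coe_aeval_eq_eval, smul_eq_mul]

theorem IsSpectrum.tau_pos (h : c.IsSpectrum lam) (i : Fin N) : 0 < c.tau (lam i) :=
  PeakonPair.tau_pos <| by
    rw [wronskian_eq_rootProd h]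
    exact (eval_rootProd_eq_zero (zero_notMem_spectrum h)).2
      (Finset.mem_image_of_mem _ (Finset.mem_univ i))

theorem IsInteriorData.sq_eq (h : c.IsInteriorData a lam p) (i : Fin N) :
    c.phi (lam i) a ^ 2 / c.tau (lam i) = p i ^ 2 := by
  have h1 := isInteriorData_iff.1 h
  rw [h1.2 i, div_pow, Real.sq_sqrt (h1.1.tau_pos i).le]

theorem IsInteriorData.mul_eval_pos (h : c.IsInteriorData a lam p) {i : Fin N} (hi : p i ≠ 0) :
    0 < p i * (c.rightPoly a).eval (lam i) := by
  have h1 := isInteriorData_iff.1 h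
  have h2 := Real.sqrt_pos.2 (h1.1.tau_pos i)
  have h3 := h1.2 i
  rw [phi_real] at h3
  have h4 : (c.rightPoly a).eval (lam i) ≠ 0 := by
    intro h0
    rw [h0, mul_zero, zero_div] at h3
    exact hi h3
  have h5 : p i * (c.rightPoly a).eval (lam i) =
      Real.exp (-a / 2) * (c.rightPoly a).eval (lam i) ^ 2 / √(c.tau (lam i)) := by
    rw [h3]; ring
  rw [h5]
  positivity

theorem isInteriorData_of_sq_eq (hs : c.IsSpectrum lam)
    (h1 : ∀ i, c.phi (lam i) a ^ 2 / c.tau (lam i) = p i ^ 2)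
    (h2 : ∀ i, p i ≠ 0 → 0 < p i * (c.rightPoly a).eval (lam i)) : c.IsInteriorData a lam p := by
  refine isInteriorData_iff.2 ⟨hs, fun i => ?_⟩
  have h3 := Real.sqrt_pos.2 (hs.tau_pos i)
  have h4 : (c.phi (lam i) a / √(c.tau (lam i))) ^ 2 = p i ^ 2 := by
    rw [div_pow, Real.sq_sqrt (hs.tau_pos i).le, h1]
  rcases sq_eq_sq_iff_eq_or_eq_neg.1 h4 with h5 | h5
  · exact h5.symm
  · by_cases hi : p i = 0
    · rw [h5, hi, neg_zero]
    · have h6 := h2 i hi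
      rw [phi_real, div_eq_iff h3.ne'] at h5
      have h7 : p i * (Real.exp (-a / 2) * (c.rightPoly a).eval (lam i)) =
          -(p i ^ 2 * √(c.tau (lam i))) := by rw [h5]; ring
      have h8 := mul_pos h6 (Real.exp_pos (-a / 2))
      have h9 := mul_nonneg (sq_nonneg (p i)) h3.le
      linarith

theorem IsInteriorData.tau_eq (h : c.IsInteriorData a lam p) {i : Fin N} (hi : p i ≠ 0) :
    c.tau (lam i) = Real.exp (-a) * (c.rightPoly a).eval (lam i) ^ 2 / p i ^ 2 := by
  have h1 := h.sq_eq i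
  rw [phi_sq, div_eq_iff ((isInteriorData_iff.1 h).1.tau_pos i).ne'] at h1
  rw [h1]
  field_simp

/-- The noncancelled poles, in terms of the interior data. -/
theorem mem_poleSet_of_ne_zero (hq : ∀ i, q (lam i) = p i ^ 2) {i : Fin N} (hi : p i ≠ 0) :
    lam i ∈ poleSet (Finset.univ.image lam) q :=
  Finset.mem_filter.2 ⟨Finset.mem_image_of_mem _ (Finset.mem_univ i), by
    rw [hq]; exact pow_ne_zero 2 hi⟩

theorem exists_of_mem_poleSet (hq : ∀ i, q (lam i) = p i ^ 2) {x : ℝ}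
    (hx : x ∈ poleSet (Finset.univ.image lam) q) : ∃ i, p i ≠ 0 ∧ lam i = x := by
  obtain ⟨h1, h2⟩ := Finset.mem_filter.1 hx
  obtain ⟨i, -, rfl⟩ := Finset.mem_image.1 h1
  rw [hq] at h2
  exact ⟨i, fun h => h2 (by rw [h]; simp), rfl⟩

theorem mem_nullSet_of_eq_zero (hq : ∀ i, q (lam i) = p i ^ 2) {i : Fin N} (hi : p i = 0) :
    lam i ∈ nullSet (Finset.univ.image lam) q :=
  Finset.mem_filter.2 ⟨Finset.mem_image_of_mem _ (Finset.mem_univ i), by rw [hq, hi]; simp⟩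

theorem exists_of_mem_nullSet (hq : ∀ i, q (lam i) = p i ^ 2) {x : ℝ}
    (hx : x ∈ nullSet (Finset.univ.image lam) q) : ∃ i, p i = 0 ∧ lam i = x := by
  obtain ⟨h1, h2⟩ := Finset.mem_filter.1 hx
  obtain ⟨i, -, rfl⟩ := Finset.mem_image.1 h1
  rw [hq] at h2
  exact ⟨i, pow_eq_zero_iff (two_ne_zero) |>.1 h2, rfl⟩

/-- The family of spectral data with the given interior data: the right root set is determined up
to the free zeros, and the norming constants are free precisely where `p` vanishes. -/
theorem inverseSpectralFamily_eq (hc : c.IsInteriorData a lam p) (hq : ∀ i, q (lam i) = p i ^ 2)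
    (h : GreenZeros (Finset.univ.image lam) q B σ)
    (hneg : ∃ x ∈ poleSet (Finset.univ.image lam) q, x < 0)
    (hpos : ∃ x ∈ poleSet (Finset.univ.image lam) q, 0 < x)
    (hZB : nullSet (Finset.univ.image lam) q ⊆ B) {S : Finset ℝ}
    (hZS : nullSet (Finset.univ.image lam) q ⊆ S) (hSB : S ⊆ B)
    (hS : c.rightPoly a = rootProd S) :
    inverseSpectralFamily a lam p =
      ⋃ E : (freeSet (Finset.univ.image lam) q B).powerset, normingSet lam p fun i =>
        Real.exp (-a) * (rootProd (symmDiff S E)).eval (lam i) ^ 2 / p i ^ 2 := by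
  set L := Finset.univ.image lam with hL
  have hspec := (isInteriorData_iff.1 hc).1
  have hL0 : (0 : ℝ) ∉ L := zero_notMem_spectrum hspec
  have hmem : ∀ i, lam i ∈ L := fun i => Finset.mem_image_of_mem _ (Finset.mem_univ i)
  ext x
  rw [mem_iUnion]
  constructor
  · rintro ⟨c', h1, h2⟩
    have h3 := isSpectralData_iff.1 h2
    have hspec' := (isInteriorData_iff.1 h1).1
    have hx : x.1 = lam := by
      refine (h3.1.strictMono.range_inj hspec'.strictMono).1 ?_
      ext y
      have e1 := h3.1.eigenvalue_iff y
      rw [hspec'.eigenvalue_iff] at e1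
      simp only [Complex.ofReal_inj] at e1
      simp only [mem_range, eq_comm (b := y)]
      exact e1.symm
    have hW' : c'.wronskian = rootProd L := wronskian_eq_rootProd hspec'
    obtain ⟨-, S', hZS', hSB', hS'⟩ := exists_rightPoly_eq_rootProd (a := a) hL0 hW' (fun b hb => by
      obtain ⟨i, -, rfl⟩ := Finset.mem_image.1 hb
      rw [hq, h1.sq_eq]) h
    -- The sign of `p i` is that of the right polynomial at `lam i`, so the root sets of two pairs
    -- with the same data give equal signs at all poles.
    have hE : symmDiff S S' ⊆ freeSet L q B := h.symmDiff_subset_freeSet hSB hSB' hZS hZS' (by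
      intro y hy
      obtain ⟨i, hi, rfl⟩ := exists_of_mem_poleSet hq hy
      have e1 := hc.mul_eval_pos hi
      have e2 := h1.mul_eval_pos hi
      rw [hS] at e1
      rw [hS'] at e2
      refine pos_of_mul_pos_right (a := p i ^ 2) ?_ (sq_nonneg _)
      calc 0 < _ := mul_pos e1 e2
        _ = _ := by ring)
    refine ⟨⟨symmDiff S S', Finset.mem_powerset.2 hE⟩, hx, fun i => ⟨fun hi => ?_, fun hi => ?_⟩⟩
    · rw [h3.2, hx, h1.tau_eq hi, hS', symmDiff_symmDiff_cancel_left]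
    · rw [h3.2, hx]
      exact hspec'.tau_pos i
  · rintro ⟨⟨E, hE⟩, hx, hx2⟩
    rw [Finset.mem_powerset] at hE
    have hZE : nullSet L q ⊆ symmDiff S E := fun b hb => Finset.mem_symmDiff.2 <| Or.inl
      ⟨hZS hb, fun hbE => (Finset.mem_sdiff.1 (Finset.mem_of_mem_filter _ (hE hbE))).2 hb⟩
    have hEB : E ⊆ B := fun b hb => (Finset.mem_sdiff.1 (Finset.mem_of_mem_filter _ (hE hb))).1
    have hSEB : symmDiff S E ⊆ B := fun b hb => by
      rcases Finset.mem_symmDiff.1 hb with h1 | h1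
      · exact hSB h1.1
      · exact hEB h1.1
    have hext : ∀ i, Function.extend lam x.2 0 (lam i) = x.2 i :=
      hspec.strictMono.injective.extend_apply _ _
    obtain ⟨c', hW', hP', hq', ht'⟩ := exists_pair_of_tau a hL0 h hZB hZE hSEB
      (t := Function.extend lam x.2 0) (fun b hb => by
        obtain ⟨i, hi, rfl⟩ := exists_of_mem_nullSet hq hb
        rw [hext]
        exact (hx2 i).2 hi)
    have hspec' : c'.IsSpectrum lam := isSpectrum_of_wronskian_eq hspec.strictMono hL0 hW'
    -- The squares of the values are prescribed by `q`; their signs survive because toggling free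
    -- zeros changes no sign at a pole.
    have hint : c'.IsInteriorData a lam p := by
      refine isInteriorData_of_sq_eq hspec' (fun i => by rw [hq' _ (hmem i), hq]) fun i hi => ?_
      have e1 := hc.mul_eval_pos hi
      have e2 := congrArg (Polynomial.eval (lam i)) (rootProd_symmDiff_mul S E)
      have e3 := GreenZeros.eval_free_pos hneg hpos hE (mem_poleSet_of_ne_zero hq hi)
      have e4 := h.eval_rootProd_ne_zero (Finset.sdiff_subset (t := E) |>.trans hSB)
        (mem_poleSet_of_ne_zero hq hi)
      have e5 := sq_pos_iff.2 e4
      rw [eval_mul, eval_mul, eval_pow, ← hS] at e2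
      rw [hP']
      refine pos_of_mul_pos_right (a := p i * (c.rightPoly a).eval (lam i)) ?_ e1.le
      have e6 := mul_pos (mul_pos e5 e3) (sq_pos_iff.2 hi)
      rw [← e2] at e6
      calc 0 < _ := e6
        _ = _ := by ring
    refine ⟨c', hint, isSpectralData_iff.2 ⟨hx ▸ hspec', fun i => ?_⟩⟩
    rw [hx]
    by_cases hi : p i = 0
    · rw [ht' _ (mem_nullSet_of_eq_zero hq hi), hext]
    · rw [hint.tau_eq hi, hP']
      exact (hx2 i).1 hi

/-- The norming constants see only squares of root polynomials. Since toggling free zeros keeps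
signs at the poles, equal squares would give equal values, and `eq_of_eval_eq` would identify the
root sets. -/
theorem exists_norming_ne (hq : ∀ i, q (lam i) = p i ^ 2)
    (h : GreenZeros (Finset.univ.image lam) q B σ)
    (hneg : ∃ x ∈ poleSet (Finset.univ.image lam) q, x < 0)
    (hpos : ∃ x ∈ poleSet (Finset.univ.image lam) q, 0 < x) {S : Finset ℝ} (hSB : S ⊆ B)
    {E E' : Finset ℝ}
    (hE : E ⊆ freeSet (Finset.univ.image lam) q B)
    (hE' : E' ⊆ freeSet (Finset.univ.image lam) q B) (hne : E ≠ E') :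
    ∃ i, p i ≠ 0 ∧ Real.exp (-a) * (rootProd (symmDiff S E)).eval (lam i) ^ 2 / p i ^ 2 ≠
      Real.exp (-a) * (rootProd (symmDiff S E')).eval (lam i) ^ 2 / p i ^ 2 := by
  by_contra! hcon
  have hB : ∀ {E}, E ⊆ freeSet (Finset.univ.image lam) q B → symmDiff S E ⊆ B := fun hE b hb => by
    rcases Finset.mem_symmDiff.1 hb with h1 | h1
    · exact hSB h1.1
    · exact (Finset.mem_sdiff.1 (Finset.mem_of_mem_filter _ (hE h1.1))).1
  have hsgn : ∀ {E}, E ⊆ freeSet (Finset.univ.image lam) q B → ∀ x ∈ poleSet (Finset.univ.image lam) q,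
      0 < (rootProd (symmDiff S E)).eval x * (rootProd S).eval x := fun {E} hE x hx => by
    rw [← eval_mul, rootProd_symmDiff_mul, eval_mul, eval_pow]
    exact mul_pos (sq_pos_iff.2 (h.eval_rootProd_ne_zero (Finset.sdiff_subset.trans hSB) hx))
      (GreenZeros.eval_free_pos hneg hpos hE hx)
  refine hne (symmDiff_right_injective S (h.eq_of_eval_eq (hB hE) (hB hE') fun x hx => ?_))
  have h1 := hsgn hE x hx
  have h2 := hsgn hE' x hx
  obtain ⟨i, hi, rfl⟩ := exists_of_mem_poleSet hq hx
  have h3 := hcon i hi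
  have h4 : (rootProd (symmDiff S E)).eval (lam i) ^ 2 =
      (rootProd (symmDiff S E')).eval (lam i) ^ 2 := by
    have h5 := pow_ne_zero 2 hi
    have h6 := (Real.exp_pos (-a)).ne'
    field_simp at h3
    exact h3
  rcases sq_eq_sq_iff_eq_or_eq_neg.1 h4 with h5 | h5
  · exact h5
  · rw [h5] at h1
    linarith

end PeakonPair

/-! ### Counting the components. -/

theorem theorem3p17 (a : ℝ) {N : ℕ} (lam p : Fin N → ℝ)
    (hdata : ∃ c : PeakonPair, c.IsInteriorData a lam p)
    (hα : 1 - ∑ i, |p i| ^ 2 ≠ 0)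
    (j : ℕ) (hj : j + 1 < N)
    (hneg : lam ⟨j, Nat.lt_of_succ_lt hj⟩ < 0) (hpos : 0 < lam ⟨j + 1, hj⟩)
    (first last : Fin N) (hfirst : (first : ℕ) = 0) (hlast : (last : ℕ) + 1 = N)
    (k : ℕ) (hk : {i | p i = 0}.ncard = k) :
    (0 < k → {c : PeakonPair | c.IsInteriorData a lam p}.Infinite) ∧
    (p first = 0 ∧ p last = 0 →
      IsConnected (inverseSpectralFamily a lam p) ∧
        IsEmbeddedSubmanifold k (inverseSpectralFamily a lam p)) ∧
    (Xor (p first = 0) (p last = 0) →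
      IsDisjointUnionOfManifolds 2 k (inverseSpectralFamily a lam p)) ∧
    (p first ≠ 0 ∧ p last ≠ 0 →
      IsDisjointUnionOfManifolds 4 k (inverseSpectralFamily a lam p)) := by
  obtain ⟨c, hc⟩ := hdata
  have hspec := (PeakonPair.isInteriorData_iff.1 hc).1
  set L := Finset.univ.image lam with hL
  have hL0 : (0 : ℝ) ∉ L := PeakonPair.zero_notMem_spectrum hspec
  have hW : c.wronskian = rootProd L := PeakonPair.wronskian_eq_rootProd hspec
  have hmem : ∀ i, lam i ∈ L := fun i => Finset.mem_image_of_mem _ (Finset.mem_univ i)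
  set q : ℝ → ℝ := fun b => c.phi b a ^ 2 / c.tau b with hqdef
  have hq : ∀ i, q (lam i) = p i ^ 2 := hc.sq_eq
  have hsum : ∑ b ∈ L, q b = ∑ i, |p i| ^ 2 := by
    rw [hL, Finset.sum_image fun i _ k _ h => hspec.strictMono.injective h]
    exact Finset.sum_congr rfl fun i _ => by rw [hq, sq_abs]
  have hαpos : 0 < 1 - ∑ b ∈ L, q b :=
    (PeakonPair.one_sub_sum_nonneg hL0 hW a).lt_of_ne' (by rw [hsum]; exact hα)
  obtain ⟨B, σ, hG⟩ := exists_greenZeros hL0 (q := q) (fun b hb => by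
    obtain ⟨i, -, rfl⟩ := Finset.mem_image.1 hb
    rw [hq]
    exact sq_nonneg _) hαpos
  obtain ⟨hZB, S, hZS, hSB, hS⟩ := PeakonPair.exists_rightPoly_eq_rootProd hL0 hW (fun _ _ => rfl) hG
  -- If the negative eigenvalue at hand is cancelled, it is a zero of the Green's function, and an
  -- actual pole separates it from the zero `0` of `z G`.
  have hpn : ∃ x ∈ poleSet L q, x < 0 := by
    by_cases h0 : p ⟨j, Nat.lt_of_succ_lt hj⟩ = 0
    · obtain ⟨x, hx, -, h1⟩ := hG.separated _ (Finset.mem_insert_of_mem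
        (hZB (PeakonPair.mem_nullSet_of_eq_zero hq h0))) 0 (Finset.mem_insert_self _ _) hneg
      exact ⟨x, hx, h1⟩
    · exact ⟨_, PeakonPair.mem_poleSet_of_ne_zero hq h0, hneg⟩
  have hpp : ∃ x ∈ poleSet L q, 0 < x := by
    by_cases h0 : p ⟨j + 1, hj⟩ = 0
    · obtain ⟨x, hx, h1, -⟩ := hG.separated 0 (Finset.mem_insert_self _ _) _
        (Finset.mem_insert_of_mem (hZB (PeakonPair.mem_nullSet_of_eq_zero hq h0))) hpos
      exact ⟨x, hx, h1⟩
    · exact ⟨_, PeakonPair.mem_poleSet_of_ne_zero hq h0, hpos⟩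
  have hF := PeakonPair.inverseSpectralFamily_eq hc hq hG hpn hpp hZB hZS hSB hS
  have hunion : ∀ m, 2 ^ (freeSet L q B).card = m →
      IsDisjointUnionOfManifolds m k (inverseSpectralFamily a lam p) := fun m hm => by
    rw [← hk]
    refine isDisjointUnionOfManifolds_normingSet
      (ι := (freeSet L q B).powerset) (by rw [Nat.card_eq_fintype_card, Fintype.card_coe,
        Finset.card_powerset, hm]) _ (fun E E' hne => ?_) hF
    exact PeakonPair.exists_norming_ne (a := a) hq hG hpn hpp hSB (Finset.mem_powerset.1 E.2)
      (Finset.mem_powerset.1 E'.2) fun h => hne (Subtype.ext h)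
  classical
  have hcard := hG.card_freeSet hZB hpn hpp (hmem first) (hmem last)
    (fun b hb => by
      obtain ⟨i, -, rfl⟩ := Finset.mem_image.1 hb
      exact hspec.strictMono.monotone (Fin.le_def.2 (by omega)))
    (fun b hb => by
      obtain ⟨i, -, rfl⟩ := Finset.mem_image.1 hb
      exact hspec.strictMono.monotone (Fin.le_def.2 (by omega)))
  simp only [hq, pow_eq_zero_iff two_ne_zero] at hcard
  refine ⟨fun hk0 hfin => ?_, fun ⟨h1, h2⟩ => ?_, fun hx => ?_, fun ⟨h1, h2⟩ => ?_⟩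
  -- The family is contained in the image of the set of pairs, so finitely many pairs would make it
  -- finite, against the free norming constants.
  · have hsub : inverseSpectralFamily a lam p ⊆
        (fun c : PeakonPair => (lam, fun i => c.tau (lam i))) ''
          {c : PeakonPair | c.IsInteriorData a lam p} := by
      intro x hx
      have hx' := hx
      rw [hF, mem_iUnion] at hx'
      obtain ⟨-, hx1, -⟩ := hx'
      obtain ⟨c', h1, h2⟩ := hx
      refine ⟨c', h1, Prod.ext hx1.symm (funext fun i => ?_)⟩
      rw [(PeakonPair.isSpectralData_iff.1 h2).2, hx1]
    have hne : ∃ i, p i = 0 := by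
      rw [← hk] at hk0
      exact (Set.ncard_pos (Set.toFinite _)).1 hk0
    have hfin' := (hfin.image _).subset hsub
    rw [hF] at hfin'
    exact infinite_normingSet hne
      (hfin'.subset (subset_iUnion_of_subset ⟨∅, Finset.empty_mem_powerset _⟩ subset_rfl))
  · rw [if_pos h1, if_pos h2] at hcard
    -- With no free zero there is `2 ^ 0 = 1` component, which is then the whole family.
    obtain ⟨M, hM, -, hM'⟩ := hunion 1 (by rw [hcard]; rfl)
    have : inverseSpectralFamily a lam p = M 0 := by
      rw [hM]; exact ciSup_unique
    rw [this]
    exact ⟨(hM' 0).1, (hM' 0).2.1⟩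
  · refine hunion 2 ?_
    rcases hx with ⟨h1, h2⟩ | ⟨h1, h2⟩
    · rw [hcard, if_pos h1, if_neg h2]; rfl
    · rw [hcard, if_neg h2, if_pos h1]; rfl
  · refine hunion 4 ?_
    rw [hcard, if_neg h1, if_neg h2]
    rfl
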